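/- **Main Theorem.** Every simple polygon in the plane has an inscribed square. That is, let $n\ge 3$ and let $x_1,\dots,x_n\in\mathbb R^2$ be pairwise distinct points such that, with indices modulo $n$ and edges $e_i=[x_i,x_{i+1}]$ (closed segments), consecutive edges satisfy $e_i\cap e_{i+1}=\{x_{i+1}\}$ and any two distinct non-consecutive edges are disjoint. Then the closed polygonal curve $X=e_1\cup\dots\cup e_n$ contains four points $a,b,c,d$ which are, in this cyclic order, the vertices of a square of positive side length in $\mathbb R^2$. -/

import Mathlib

/-- A polygon with `n ≥ 3` vertices in the Euclidean plane is *simple* if its vertices are pairwise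
distinct, any two consecutive edges meet exactly in their common vertex, and any two distinct
non-consecutive edges are disjoint. Here the `i`-th edge is the closed segment from the `i`-th
vertex to the cyclically next one, and `finRotate n` is the cyclic successor on `Fin n`. -/
structure Polygon.IsSimple {n : ℕ} (X : Polygon (EuclideanSpace ℝ (Fin 2)) n) : Prop where
  three_le : 3 ≤ n
  injective : Function.Injective X.vertices
  consecutive : ∀ i : Fin n,
    X.edgeSet ℝ i ∩ X.edgeSet ℝ (finRotate n i) = {X (finRotate n i)}
  disjoint : ∀ i j : Fin n, i ≠ j → j ≠ finRotate n i → i ≠ finRotate n j →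
    Disjoint (X.edgeSet ℝ i) (X.edgeSet ℝ j)

/-- The points `a, b, c, d` are, in this cyclic order, the vertices of a (nondegenerate) square in
the plane: a parallelogram whose adjacent sides `ab` and `ad` are orthogonal, of equal length, and
not zero. -/
structure FormSquare (a b c d : EuclideanSpace ℝ (Fin 2)) : Prop where
  ne : a ≠ b
  parallelogram : b - a = c - d
  orthogonal : inner ℝ (b - a) (d - a) = 0
  dist_eq : dist a b = dist a d

section

open Set Filter Topology

/-! The quadruples `(a, b, c, d)` of points of the polygon form a torus, cut into cubes by the
choice of four edges. On it one looks for rhombi with horizontal diagonal `ac` and vertical diagonal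
`bd`. These are four equations, affine on every cube (`quadG`), so for generic right-hand sides
solutions can be counted modulo 2. Only linked rhombi are counted: `a, c` separate `b, d` along the
polygon (`link < 0`), `c` is to the right of `a` and `d` is above `b`.

The count does not change when the polygon moves through simple polygons
(`exists_forall_hasParity`). Solutions could be lost only at `link = 0`, where all four points
coincide (`collapse_of_link_eq_zero`). All the edges then meet at one vertex, and two consecutive
edges inscribe no linked parallelogram (`SimpleLoop.link_nonneg_of_wedge`). By compactness linked
solutions satisfy `link < -δ` for a uniform `δ > 0` (`exists_link_lt_neg`), and `psi δ` has this
margin built in.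

If no square is inscribed, the count is 0 (`SimpleLoop.hasParity_zero`). The two diagonals never
have equal length, so the rhombi split according to the sign of `rho`, the difference of the
lengths. The parity of each class is constant while the polygon is rotated, and a quarter turn
exchanges the two classes. The total is `d + d = 0`.

But the count is always 1 (`SimpleLoop.exists_hasParity_eq_one`). Linear maps of determinant 1
deform the polygon until it is steep: the vertices are ordered by `X` oppositely to their order by
`Y`. There let the midpoint of `bd` lie at distance `t ≥ w > 0` above that of `ac`. The solutions
form arcs, whose ends are the solutions at `t = w` and triple points `a = b = c = p` at a local
extremum `p` of the height, with `d` above `p` (`SteepLoop.count_eq_sum`). Modulo 2 the number of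
such triple points is the number of local minima plus one (`SteepLoop.sum_vertexBelow`). Each local
minimum also carries one small solution at `t = w`, which collapses to `p` as `w` tends to 0 and is
rejected by the margin `δ`. What remains is 1, a contradiction. -/

/-- The indicator of a proposition with values in `ZMod 2`. -/
noncomputable def ind (P : Prop) : ZMod 2 := open Classical in if P then 1 else 0

theorem ind_true {P : Prop} (h : P) : ind P = 1 := by simp [ind, h]

theorem ind_false {P : Prop} (h : ¬ P) : ind P = 0 := by simp [ind, h]

theorem ind_congr {P Q : Prop} (h : P ↔ Q) : ind P = ind Q := by rw [propext h]

theorem zmod_two_add_self (a : ZMod 2) : a + a = 0 := CharTwo.add_self_eq_zero a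

/-! ### Parity of the facets met by a line in a cube -/

section Line

variable {ι : Type*} [Fintype ι]

/-- If a point of the line `r ↦ z + r k` lies in the unit cube and no coordinate blocks it on the
right, then a further point of the line lies in the cube. -/
theorem exists_gt_mem_cube {z k : ι → ℝ} {r : ℝ} (hr : ∀ i, z i + r * k i ∈ Icc (0 : ℝ) 1)
    (hpos : ∀ i, 0 < k i → z i + r * k i ≠ 1) (hneg : ∀ i, k i < 0 → z i + r * k i ≠ 0) :
    ∃ r' > r, ∀ i, z i + r' * k i ∈ Icc (0 : ℝ) 1 := by
  have : ∀ᶠ r' in 𝓝[>] r, ∀ i, z i + r' * k i ∈ Icc (0 : ℝ) 1 := by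
    rw [eventually_all]
    intro i
    have hc : Tendsto (fun r' => z i + r' * k i) (𝓝[>] r) (𝓝 (z i + r * k i)) :=
      ((by fun_prop : Continuous fun r' : ℝ => z i + r' * k i).tendsto r).mono_left
        nhdsWithin_le_nhds
    rcases lt_trichotomy (k i) 0 with h | h | h
    · have h0 : 0 < z i + r * k i := lt_of_le_of_ne (hr i).1 (hneg i h).symm
      filter_upwards [hc.eventually (lt_mem_nhds h0), self_mem_nhdsWithin] with r' h1 h2
      have : r < r' := h2
      exact ⟨h1.le, by have := (hr i).2; nlinarith⟩
    · filter_upwards with r'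
      simpa [h] using hr i
    · have h0 : z i + r * k i < 1 := lt_of_le_of_ne (hr i).2 (hpos i h)
      filter_upwards [hc.eventually (gt_mem_nhds h0), self_mem_nhdsWithin] with r' h1 h2
      have : r < r' := h2
      exact ⟨by have := (hr i).1; nlinarith, h1.le⟩
  obtain ⟨r', h1, h2⟩ := (this.and self_mem_nhdsWithin).exists
  exact ⟨r', h2, h1⟩

/-- The last parameter of a line in the unit cube is blocked by a coordinate. -/
theorem exists_blocking_right {z k : ι → ℝ} {r : ℝ} (hr : ∀ i, z i + r * k i ∈ Icc (0 : ℝ) 1)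
    (hmax : ∀ r', (∀ i, z i + r' * k i ∈ Icc (0 : ℝ) 1) → r' ≤ r) :
    ∃ i, (0 < k i ∧ z i + r * k i = 1) ∨ (k i < 0 ∧ z i + r * k i = 0) := by
  by_contra! h
  obtain ⟨r', h1, h2⟩ := exists_gt_mem_cube hr (fun i hi => (h i).1 hi) (fun i hi => (h i).2 hi)
  exact absurd (hmax r' h2) (not_le.mpr h1)

/-- The first parameter of a line in the unit cube is blocked by a coordinate. -/
theorem exists_blocking_left {z k : ι → ℝ} {r : ℝ} (hr : ∀ i, z i + r * k i ∈ Icc (0 : ℝ) 1)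
    (hmin : ∀ r', (∀ i, z i + r' * k i ∈ Icc (0 : ℝ) 1) → r ≤ r') :
    ∃ i, (0 < k i ∧ z i + r * k i = 0) ∨ (k i < 0 ∧ z i + r * k i = 1) := by
  obtain ⟨i, hi⟩ := exists_blocking_right (z := z) (k := fun i => - k i) (r := -r)
    (by intro i; simpa using hr i)
    (by
      intro r' h
      have := hmin (-r') (by intro i; simpa using h i)
      linarith)
  refine ⟨i, ?_⟩
  rcases hi with ⟨h1, h2⟩ | ⟨h1, h2⟩
  · right; exact ⟨by linarith, by linarith⟩
  · left; exact ⟨by linarith, by linarith⟩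

/-- Parity of the number of facets of the unit cube met by a line inside the region `0 < ψ`. The
line may run into `ψ = 0` only at an endpoint of its intersection with the cube. -/
theorem sum_ind_facets {z k : ι → ℝ} (hk : ∃ i, k i ≠ 0) {ψ : ℝ → ℝ} (hψ : Continuous ψ)
    (h2 : ∀ r, (∀ i, z i + r * k i ∈ Icc (0 : ℝ) 1) → 0 < ψ r → ∀ i j,
      (z i + r * k i = 0 ∨ z i + r * k i = 1) → (z j + r * k j = 0 ∨ z j + r * k j = 1) → i = j)
    (h0 : ∀ r, (∀ i, z i + r * k i ∈ Icc (0 : ℝ) 1) → ψ r = 0 →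
      ∃ i, k i ≠ 0 ∧ (z i + r * k i = 0 ∨ z i + r * k i = 1))
    (hu : ∀ r r', (∀ i, z i + r * k i ∈ Icc (0 : ℝ) 1) → (∀ i, z i + r' * k i ∈ Icc (0 : ℝ) 1) →
      ψ r = 0 → ψ r' = 0 → r = r') :
    ∑ i, (ind (∃ r, (∀ i, z i + r * k i ∈ Icc (0 : ℝ) 1) ∧ z i + r * k i = 0 ∧ 0 < ψ r) +
      ind (∃ r, (∀ i, z i + r * k i ∈ Icc (0 : ℝ) 1) ∧ z i + r * k i = 1 ∧ 0 < ψ r)) =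
    ind ((∃ r, (∀ i, z i + r * k i ∈ Icc (0 : ℝ) 1) ∧ ψ r = 0) ∧
      ∃ r, (∀ i, z i + r * k i ∈ Icc (0 : ℝ) 1) ∧ 0 < ψ r) := by
  by_cases hpos : ∃ r, (∀ i, z i + r * k i ∈ Icc (0 : ℝ) 1) ∧ 0 < ψ r
  swap
  · rw [ind_false (fun h => hpos h.2)]
    refine Finset.sum_eq_zero fun i _ => ?_
    rw [ind_false, ind_false, add_zero]
    · rintro ⟨r, h1, -, h3⟩; exact hpos ⟨r, h1, h3⟩
    · rintro ⟨r, h1, -, h3⟩; exact hpos ⟨r, h1, h3⟩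
  obtain ⟨rs, hrs, hrspos⟩ := hpos
  set I : Set ℝ := {r | ∀ i, z i + r * k i ∈ Icc (0 : ℝ) 1} with hI
  have hIc : IsClosed I := by
    simp only [hI, ofPred_forall]
    refine isClosed_iInter fun i => isClosed_Icc.preimage (by fun_prop)
  have hIconv : Convex ℝ I := by
    intro a ha b hb u v hu hv huv i
    have h1 := ha i; have h2 := hb i
    have : z i + (u • a + v • b) * k i = u * (z i + a * k i) + v * (z i + b * k i) := by
      simp only [smul_eq_mul]; linear_combination (-(z i)) * huv
    rw [this]
    constructor
    · have := mul_nonneg hu h1.1; have := mul_nonneg hv h2.1; linarith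
    · have := mul_le_mul_of_nonneg_left h1.2 hu; have := mul_le_mul_of_nonneg_left h2.2 hv; linarith
  obtain ⟨i0, hi0⟩ := hk
  have hIb : Bornology.IsBounded I := by
    refine (Metric.isBounded_Icc (-((1 + |z i0|) / |k i0|)) ((1 + |z i0|) / |k i0|)).subset ?_
    intro r hr
    have h1 := hr i0
    rw [mem_Icc, ← abs_le, le_div_iff₀ (abs_pos.mpr hi0), ← abs_mul]
    have : r * k i0 = (z i0 + r * k i0) - z i0 := by ring
    rw [this]
    refine (abs_sub _ _).trans ?_
    have : |z i0 + r * k i0| ≤ 1 := abs_le.mpr ⟨by linarith [h1.1], h1.2⟩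
    linarith
  have hIk : IsCompact I := Metric.isCompact_of_isClosed_isBounded hIc hIb
  obtain ⟨r0, hr0, hmin⟩ := hIk.exists_isLeast ⟨rs, hrs⟩
  obtain ⟨r1, hr1, hmax⟩ := hIk.exists_isGreatest ⟨rs, hrs⟩
  have hIcc : ∀ r, r0 ≤ r → r ≤ r1 → r ∈ I := fun r h h' =>
    hIconv.ordConnected.out hr0 hr1 ⟨h, h'⟩
  obtain ⟨i0', hb0⟩ := exists_blocking_left hr0 (fun r' h => hmin h)
  obtain ⟨i1', hb1⟩ := exists_blocking_right hr1 (fun r' h => hmax h)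
  clear hi0 i0
  -- zeros of ψ are endpoints
  have hend : ∀ r ∈ I, ∀ i, k i ≠ 0 → (z i + r * k i = 0 ∨ z i + r * k i = 1) →
      r = r0 ∨ r = r1 := by
    intro r hr i hki hbd
    by_contra! hne
    have hlt0 : r0 < r := lt_of_le_of_ne (hmin hr) hne.1.symm
    have hlt1 : r < r1 := lt_of_le_of_ne (hmax hr) hne.2
    have a0 := hr0 i; have a1 := hr1 i
    rcases lt_or_gt_of_ne hki with h | h
    · have e0 : z i + r * k i < z i + r0 * k i := by nlinarith
      have e1 : z i + r1 * k i < z i + r * k i := by nlinarith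
      rcases hbd with h | h
      · linarith [a1.1]
      · linarith [a0.2]
    · have e0 : z i + r0 * k i < z i + r * k i := by nlinarith
      have e1 : z i + r * k i < z i + r1 * k i := by nlinarith
      rcases hbd with h | h
      · linarith [a0.1]
      · linarith [a1.2]
  have hzero : ∀ r ∈ I, ψ r = 0 → r = r0 ∨ r = r1 := by
    intro r hr hz
    obtain ⟨i, hi, hbd⟩ := h0 r hr hz
    exact hend r hr i hi hbd
  -- If the segment were a single point, that point would be blocked on both sides. By `h2` one
  -- coordinate would do both, which its direction forbids.
  have hne01 : r0 ≠ r1 := by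
    intro h
    have : rs = r0 := le_antisymm (h ▸ hmax hrs) (hmin hrs)
    subst this
    subst h
    have := h2 rs hrs hrspos i0' i1' (by tauto) (by tauto)
    subst this
    rcases hb0 with ⟨h, h'⟩ | ⟨h, h'⟩ <;> rcases hb1 with ⟨g, g'⟩ | ⟨g, g'⟩ <;> linarith
  have hlt : r0 < r1 := lt_of_le_of_ne (hmin hr1) hne01
  -- positivity propagates
  have hprop : ∀ r ∈ I, ψ r ≠ 0 → 0 < ψ r := by
    intro r hr hrne
    by_contra! hle
    have hneg : ψ r < 0 := lt_of_le_of_ne hle hrne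
    obtain ⟨q, hq, hq0⟩ : ∃ q ∈ uIcc rs r, ψ q = 0 := by
      have := intermediate_value_uIcc (hψ.continuousOn (s := uIcc rs r))
      exact this (by rw [uIcc_of_ge (by linarith)]; exact ⟨hneg.le, hrspos.le⟩)
    have hqI : q ∈ I := hIconv.ordConnected.uIcc_subset hrs hr hq
    have hqrs : q ≠ rs := by rintro rfl; linarith
    have hqr : q ≠ r := by rintro rfl; linarith
    have b1 := hmin hrs; have b2 := hmin hr; have b3 := hmax hrs; have b4 := hmax hr
    rcases le_total rs r with h | h
    · rw [uIcc_of_le h] at hq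
      have := lt_of_le_of_ne hq.1 hqrs.symm; have := lt_of_le_of_ne hq.2 hqr
      rcases hzero q hqI hq0 with rfl | rfl <;> linarith
    · rw [uIcc_of_ge h] at hq
      have := lt_of_le_of_ne hq.1 hqr.symm; have := lt_of_le_of_ne hq.2 hqrs
      rcases hzero q hqI hq0 with rfl | rfl <;> linarith
  -- hits occur only at the endpoints
  have hhit : ∀ r ∈ I, 0 < ψ r → ∀ i, (z i + r * k i = 0 ∨ z i + r * k i = 1) →
      r = r0 ∨ r = r1 := by
    intro r hr hp i hbd
    -- A coordinate constant along the line would be on its facet throughout. By `hu` some endpoint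
    -- has `ψ ≠ 0`, hence `0 < ψ`, and there the blocking coordinate would be a second one on the
    -- boundary, against `h2`.
    by_cases hki : k i = 0
    · exfalso
      have hconst : ∀ r', z i + r' * k i = z i + r * k i := by intro r'; simp [hki]
      have key : ∀ e ∈ I, ψ e ≠ 0 → ∀ j, k j ≠ 0 → (z j + e * k j = 0 ∨ z j + e * k j = 1) →
          False := by
        intro e he hpe j hj hbj
        have := h2 e he (hprop e he hpe) i j (by rw [hconst]; exact hbd) hbj
        exact hj (this ▸ hki)
      by_cases hz0 : ψ r0 = 0
      · have hz1 : ψ r1 ≠ 0 := fun h => hne01 (hu r0 r1 hr0 hr1 hz0 h)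
        rcases hb1 with ⟨h, h'⟩ | ⟨h, h'⟩
        · exact key r1 hr1 hz1 i1' h.ne' (Or.inr h')
        · exact key r1 hr1 hz1 i1' h.ne (Or.inl h')
      · rcases hb0 with ⟨h, h'⟩ | ⟨h, h'⟩
        · exact key r0 hr0 hz0 i0' h.ne' (Or.inl h')
        · exact key r0 hr0 hz0 i0' h.ne (Or.inr h')
    · exact hend r hr i hki hbd
  -- the hits at a given endpoint
  have hsum : ∀ e ∈ I, ∀ j, k j ≠ 0 → (z j + e * k j = 0 ∨ z j + e * k j = 1) →
      ∑ i, (ind (z i + e * k i = 0 ∧ 0 < ψ e) + ind (z i + e * k i = 1 ∧ 0 < ψ e)) =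
        ind (ψ e ≠ 0) := by
    intro e he j hj hbj
    by_cases hz : ψ e = 0
    · rw [ind_false (by simpa using hz)]
      refine Finset.sum_eq_zero fun i _ => ?_
      rw [ind_false (by rw [hz]; simp), ind_false (by rw [hz]; simp), add_zero]
    · have hp := hprop e he hz
      rw [Finset.sum_eq_single j, ind_true hz]
      · rcases hbj with h | h
        · rw [ind_true ⟨h, hp⟩, ind_false (by rw [h]; simp), add_zero]
        · rw [ind_true (P := _ = (1:ℝ) ∧ _) ⟨h, hp⟩, ind_false (by rw [h]; simp), zero_add]
      · intro i _ hij
        rw [ind_false, ind_false, add_zero]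
        · rintro ⟨h, -⟩; exact hij (h2 e he hp i j (Or.inr h) hbj)
        · rintro ⟨h, -⟩; exact hij (h2 e he hp i j (Or.inl h) hbj)
      · simp
  have hs0 := hsum r0 hr0 i0' (by rcases hb0 with h | h; exacts [h.1.ne', h.1.ne])
    (by tauto)
  have hs1 := hsum r1 hr1 i1' (by rcases hb1 with h | h; exacts [h.1.ne', h.1.ne])
    (by tauto)
  have hsplit : ∀ i, ∀ ε : ℝ, (ε = 0 ∨ ε = 1) →
      ind (∃ r, (∀ i, z i + r * k i ∈ Icc (0 : ℝ) 1) ∧ z i + r * k i = ε ∧ 0 < ψ r) =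
      ind (z i + r0 * k i = ε ∧ 0 < ψ r0) + ind (z i + r1 * k i = ε ∧ 0 < ψ r1) := by
    intro i ε hε
    by_cases hA : z i + r0 * k i = ε ∧ 0 < ψ r0
    · by_cases hB : z i + r1 * k i = ε ∧ 0 < ψ r1
      · exfalso
        have hk0 : k i = 0 := by
          have : (r1 - r0) * k i = 0 := by linarith [hA.1, hB.1]
          rcases mul_eq_zero.mp this with h | h
          · exact absurd (by linarith) hne01
          · exact h
        have := h2 r0 hr0 hA.2 i i0' (by rcases hε with h | h <;> rw [h] at hA <;> tauto) (by tauto)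
        subst this
        rcases hb0 with h | h <;> linarith [h.1]
      · rw [ind_true hA, ind_false hB, ind_true ⟨r0, hr0, hA⟩, add_zero]
    · by_cases hB : z i + r1 * k i = ε ∧ 0 < ψ r1
      · rw [ind_false hA, ind_true hB, ind_true ⟨r1, hr1, hB⟩, zero_add]
      · rw [ind_false hA, ind_false hB, ind_false, add_zero]
        rintro ⟨r, h1, h3, h4⟩
        rcases hhit r h1 h4 i (by rcases hε with h | h <;> rw [h] at h3 <;> tauto) with rfl | rfl
        · exact hA ⟨h3, h4⟩
        · exact hB ⟨h3, h4⟩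
  have hgoal : ∑ i, (ind (∃ r, (∀ i, z i + r * k i ∈ Icc (0 : ℝ) 1) ∧ z i + r * k i = 0 ∧ 0 < ψ r) +
      ind (∃ r, (∀ i, z i + r * k i ∈ Icc (0 : ℝ) 1) ∧ z i + r * k i = 1 ∧ 0 < ψ r)) =
      ind (ψ r0 ≠ 0) + ind (ψ r1 ≠ 0) := by
    rw [← hs0, ← hs1, ← Finset.sum_add_distrib]
    refine Finset.sum_congr rfl fun i _ => ?_
    rw [hsplit i 0 (Or.inl rfl), hsplit i 1 (Or.inr rfl)]
    ring
  rw [hgoal]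
  by_cases hz0 : ψ r0 = 0
  · have hz1 : ψ r1 ≠ 0 := fun h => hne01 (hu r0 r1 hr0 hr1 hz0 h)
    rw [ind_false (by simpa using hz0), ind_true hz1, ind_true ⟨⟨r0, hr0, hz0⟩, rs, hrs, hrspos⟩,
      zero_add]
  · by_cases hz1 : ψ r1 = 0
    · rw [ind_true hz0, ind_false (by simpa using hz1),
        ind_true ⟨⟨r1, hr1, hz1⟩, rs, hrs, hrspos⟩, add_zero]
    · rw [ind_true hz0, ind_true hz1, ind_false]
      · exact zmod_two_add_self 1
      · rintro ⟨⟨r, hr, hz⟩, -⟩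
        rcases hzero r hr hz with rfl | rfl
        · exact hz0 hz
        · exact hz1 hz

end Line

/-! ### Piecewise linear maps on the torus and stability of the count -/

section Engine

variable {ι : Type*} [Fintype ι] {n : ℕ}

/-- The piecewise linear function through the values `g`, on the `i`-th edge. -/
def pl (g : ZMod n → ℝ) (i : ZMod n) (t : ℝ) : ℝ := g i + t * (g (i + 1) - g i)

theorem pl_zero (g : ZMod n → ℝ) (i : ZMod n) : pl g i 0 = g i := by simp [pl]

theorem pl_one (g : ZMod n → ℝ) (i : ZMod n) : pl g i 1 = g (i + 1) := by simp [pl]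

/-- The sum of piecewise linear loops, on the cell `c` of the torus. -/
def cellMap (G : ι → ι → ZMod n → ℝ) (c : ι → ZMod n) (x : ι → ℝ) : ι → ℝ :=
  fun r => ∑ k, pl (G r k) (c k) (x k)

/-- The linear part of `cellMap`. -/
def cellMatrix (G : ι → ι → ZMod n → ℝ) (c : ι → ZMod n) : Matrix ι ι ℝ :=
  Matrix.of fun r k => G r k (c k + 1) - G r k (c k)

theorem cellMap_eq (G : ι → ι → ZMod n → ℝ) (c : ι → ZMod n) (x : ι → ℝ) :
    cellMap G c x = cellMap G c 0 + (cellMatrix G c).mulVec x := by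
  ext r
  simp only [cellMap, pl, Pi.add_apply, Matrix.mulVec, dotProduct, cellMatrix, Matrix.of_apply,
    Pi.zero_apply, ← Finset.sum_add_distrib]
  exact Finset.sum_congr rfl fun k _ => by ring

theorem continuous_cellMap {L : Type*} [TopologicalSpace L] {G : L → ι → ι → ZMod n → ℝ}
    (hG : ∀ r k i, Continuous fun l => G l r k i) (c : ι → ZMod n) :
    Continuous fun p : L × (ι → ℝ) => cellMap (G p.1) c p.2 := by
  unfold cellMap pl
  refine continuous_pi fun r => continuous_finsetSum _ fun k _ => ?_
  have h := fun i => (hG r k i).comp (continuous_fst : Continuous (Prod.fst : L × (ι → ℝ) → L))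
  simp only [Function.comp_def] at h
  have := h (c k); have := h (c k + 1)
  fun_prop

/-- The function `ψ` on the cells defines a function on the torus. -/
def Glued [DecidableEq ι] (ψ : (ι → ZMod n) → (ι → ℝ) → ℝ) : Prop :=
  ∀ c x k, x k = 1 → ψ c x = ψ (c + Pi.single k 1) (Function.update x k 0)

theorem cellMap_glued [DecidableEq ι] (G : ι → ι → ZMod n → ℝ) (c : ι → ZMod n) {x : ι → ℝ} {k : ι}
    (hx : x k = 1) :
    cellMap G c x = cellMap G (c + Pi.single k 1) (Function.update x k 0) := by
  ext r
  refine Finset.sum_congr rfl fun j _ => ?_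
  by_cases h : j = k
  · subst h; simp [hx, pl]
  · simp [h]

/-- The parity of the number of solutions of `cellMap G c x = y` with `0 < ψ c x`. -/
noncomputable def count [NeZero n] [DecidableEq ι] (G : ι → ι → ZMod n → ℝ)
    (ψ : (ι → ZMod n) → (ι → ℝ) → ℝ) (y : ι → ℝ) : ZMod 2 :=
  ∑ c, ind (∃ x ∈ Icc (0 : ι → ℝ) 1, cellMap G c x = y ∧ 0 < ψ c x)

/-- All solutions of `cellMap G c x = y` with `0 < ψ c x` are interior and transversal. -/
def RegularAt [DecidableEq ι] (G : ι → ι → ZMod n → ℝ) (ψ : (ι → ZMod n) → (ι → ℝ) → ℝ)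
    (y : ι → ℝ) : Prop :=
  ∀ c, ∀ x ∈ Icc (0 : ι → ℝ) 1, cellMap G c x = y → 0 < ψ c x →
    (∀ k, 0 < x k ∧ x k < 1) ∧ (cellMatrix G c).det ≠ 0

/-- Every facet `x k = 1` of a cell is the facet `x k = 0` of the next cell in direction `k`, with
the same values of `cellMap` and `ψ`. So every facet of the torus is counted twice. -/
theorem sum_facets_eq_zero [NeZero n] [DecidableEq ι] (G : ι → ι → ZMod n → ℝ)
    {ψ : (ι → ZMod n) → (ι → ℝ) → ℝ} (hψ : Glued ψ) (S : Set (ι → ℝ)) :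
    ∑ c, ∑ k, (ind (∃ x ∈ Icc (0 : ι → ℝ) 1, x k = 0 ∧ cellMap G c x ∈ S ∧ 0 < ψ c x) +
      ind (∃ x ∈ Icc (0 : ι → ℝ) 1, x k = 1 ∧ cellMap G c x ∈ S ∧ 0 < ψ c x)) = 0 := by
  rw [Finset.sum_comm]
  refine Finset.sum_eq_zero fun k _ => ?_
  rw [Finset.sum_add_distrib]
  have : ∑ c : ι → ZMod n, ind (∃ x ∈ Icc (0 : ι → ℝ) 1, x k = 1 ∧ cellMap G c x ∈ S ∧ 0 < ψ c x) =
      ∑ c : ι → ZMod n, ind (∃ x ∈ Icc (0 : ι → ℝ) 1, x k = 0 ∧ cellMap G c x ∈ S ∧ 0 < ψ c x) := by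
    rw [← Equiv.sum_comp (Equiv.addRight (Pi.single k (1 : ZMod n)))
      (fun c => ind (∃ x ∈ Icc (0 : ι → ℝ) 1, x k = 0 ∧ cellMap G c x ∈ S ∧ 0 < ψ c x))]
    refine Finset.sum_congr rfl fun c _ => ind_congr ?_
    simp only [Equiv.coe_addRight]
    constructor
    · rintro ⟨x, hx, hk, hS, hp⟩
      refine ⟨Function.update x k 0, ⟨?_, ?_⟩, by simp, ?_, ?_⟩
      · intro j
        by_cases h : j = k
        · subst h; simp
        · simpa [h] using hx.1 j
      · intro j
        by_cases h : j = k
        · subst h; simp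
        · simpa [h] using hx.2 j
      · rwa [← cellMap_glued G c hk]
      · rwa [← hψ c x k hk]
    · rintro ⟨x, hx, hk, hS, hp⟩
      have hup : Function.update (Function.update x k 1) k 0 = x := by
        rw [Function.update_idem, ← hk, Function.update_eq_self]
      have h1 : Function.update x k (1 : ℝ) k = 1 := by simp
      refine ⟨Function.update x k 1, ⟨?_, ?_⟩, h1, ?_, ?_⟩
      · intro j
        by_cases h : j = k
        · subst h; simp
        · simpa [h] using hx.1 j
      · intro j
        by_cases h : j = k
        · subst h; simp
        · simpa [h] using hx.2 j
      · rwa [cellMap_glued G c h1, hup]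
      · rwa [hψ c _ k h1, hup]
  rw [this, zmod_two_add_self]

/-- Near a parameter at which the target is regular, regularity and the number of solutions
persist. -/
theorem eventually_regularAt_and_count_eq [NeZero n] [DecidableEq ι] {L : Type*}
    [TopologicalSpace L] {G : L → ι → ι → ZMod n → ℝ}
    (hG : ∀ r k i, Continuous fun l => G l r k i) {ψ : L → (ι → ZMod n) → (ι → ℝ) → ℝ}
    (hψ : ∀ c, Continuous fun p : L × (ι → ℝ) => ψ p.1 c p.2) {y : L → ι → ℝ} (hy : Continuous y)
    {l₀ : L} (hreg : RegularAt (G l₀) (ψ l₀) (y l₀))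
    (hne : ∀ c, ∀ x ∈ Icc (0 : ι → ℝ) 1, cellMap (G l₀) c x = y l₀ → ψ l₀ c x ≠ 0) :
    ∀ᶠ l in 𝓝 l₀, RegularAt (G l) (ψ l) (y l) ∧ count (G l) (ψ l) (y l) =
      count (G l₀) (ψ l₀) (y l₀) := by
  have key : ∀ c, ∀ᶠ l in 𝓝 l₀,
      (∀ x ∈ Icc (0 : ι → ℝ) 1, cellMap (G l) c x = y l → 0 < ψ l c x →
        (∀ k, 0 < x k ∧ x k < 1) ∧ (cellMatrix (G l) c).det ≠ 0) ∧
      ((∃ x ∈ Icc (0 : ι → ℝ) 1, cellMap (G l) c x = y l ∧ 0 < ψ l c x) ↔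
        ∃ x ∈ Icc (0 : ι → ℝ) 1, cellMap (G l₀) c x = y l₀ ∧ 0 < ψ l₀ c x) := by
    intro c
    by_cases hex : ∃ x ∈ Icc (0 : ι → ℝ) 1, cellMap (G l₀) c x = y l₀ ∧ 0 < ψ l₀ c x
    · obtain ⟨x₀, hx₀, hF, hp⟩ := hex
      obtain ⟨hint, hdet⟩ := hreg c x₀ hx₀ hF hp
      have hA : Continuous fun l => cellMatrix (G l) c := by
        refine continuous_pi fun r => continuous_pi fun k => ?_
        exact (hG r k _).sub (hG r k _)
      have hdetc : Continuous fun l => (cellMatrix (G l) c).det := hA.matrix_det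
      have hb : Continuous fun l => y l - cellMap (G l) c 0 := by
        refine hy.sub ?_
        exact (continuous_cellMap hG c).comp (by fun_prop : Continuous fun l : L => (l, (0 : ι → ℝ)))
      -- Cramer's rule, which makes the continuity of the solution in the parameter evident.
      let sol : L → ι → ℝ := fun l =>
        ((cellMatrix (G l) c).det)⁻¹ • (cellMatrix (G l) c).adjugate.mulVec
          (y l - cellMap (G l) c 0)
      have hsolc : ContinuousAt sol l₀ := by
        refine ContinuousAt.smul (hdetc.continuousAt.inv₀ hdet) ?_
        exact (Continuous.matrix_mulVec hA.matrix_adjugate hb).continuousAt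
      have hsol : ∀ l, (cellMatrix (G l) c).det ≠ 0 → ∀ x, cellMap (G l) c x = y l ↔ x = sol l := by
        intro l hl x
        rw [cellMap_eq]
        constructor
        · intro h
          have h' : y l - cellMap (G l) c 0 = (cellMatrix (G l) c).mulVec x := by
            rw [← h]; simp
          simp only [sol, h', Matrix.mulVec_mulVec, Matrix.adjugate_mul, Matrix.smul_mulVec,
            Matrix.one_mulVec, smul_smul, inv_mul_cancel₀ hl, one_smul]
        · rintro rfl
          simp only [sol, Matrix.mulVec_smul, Matrix.mulVec_mulVec, Matrix.mul_adjugate,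
            Matrix.smul_mulVec, Matrix.one_mulVec, smul_smul, inv_mul_cancel₀ hl, one_smul]
          simp
      have hx₀s : x₀ = sol l₀ := (hsol l₀ hdet x₀).mp hF
      have e1 : ∀ᶠ l in 𝓝 l₀, (cellMatrix (G l) c).det ≠ 0 :=
        hdetc.continuousAt.eventually_ne hdet
      have e2 : ∀ᶠ l in 𝓝 l₀, ∀ k, 0 < sol l k ∧ sol l k < 1 := by
        rw [eventually_all]
        intro k
        have hk : ContinuousAt (fun l => sol l k) l₀ := (continuous_apply k).continuousAt.comp hsolc
        have := hint k
        rw [hx₀s] at this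
        exact (hk.eventually (lt_mem_nhds this.1)).and (hk.eventually (gt_mem_nhds this.2))
      have e3 : ∀ᶠ l in 𝓝 l₀, 0 < ψ l c (sol l) := by
        have : ContinuousAt (fun l => ψ l c (sol l)) l₀ :=
          ContinuousAt.comp (f := fun l => (l, sol l)) (g := fun p : L × (ι → ℝ) => ψ p.1 c p.2)
            (hψ c).continuousAt (continuousAt_id.prodMk hsolc)
        rw [hx₀s] at hp
        exact this.eventually (lt_mem_nhds hp)
      filter_upwards [e1, e2, e3] with l h1 h2 h3
      refine ⟨?_, ?_⟩
      · intro x hx hFx hpx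
        rw [hsol l h1] at hFx
        exact ⟨hFx ▸ h2, h1⟩
      · refine iff_of_true ⟨sol l, ⟨fun k => (h2 k).1.le, fun k => (h2 k).2.le⟩,
          (hsol l h1 _).mpr rfl, h3⟩ ⟨x₀, hx₀, hF, hp⟩
    -- Without a counted solution, every point of the cube misses the target or has `ψ < 0`. Both
    -- conditions are open, and the cube is compact.
    · have : ∀ᶠ l in 𝓝 l₀, ∀ x ∈ Icc (0 : ι → ℝ) 1, ¬ (cellMap (G l) c x = y l ∧ 0 < ψ l c x) := by
        refine isCompact_Icc.eventually_forall_of_forall_eventually fun x hx => ?_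
        by_cases hF : cellMap (G l₀) c x = y l₀
        · have hneg : ψ l₀ c x < 0 := by
            rcases lt_trichotomy (ψ l₀ c x) 0 with h | h | h
            · exact h
            · exact absurd h (hne c x hx hF)
            · exact absurd ⟨x, hx, hF, h⟩ hex
          have := (hψ c).continuousAt (x := (l₀, x)) |>.eventually (gt_mem_nhds hneg)
          filter_upwards [this] with p hp h
          exact absurd h.2 (not_lt.mpr hp.le)
        · have hc : Continuous fun p : L × (ι → ℝ) => cellMap (G p.1) c p.2 - y p.1 :=
            (continuous_cellMap hG c).sub (hy.comp continuous_fst)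
          have := hc.continuousAt (x := (l₀, x)) |>.eventually_ne (sub_ne_zero.mpr hF)
          filter_upwards [this] with p hp h
          exact hp (sub_eq_zero.mpr h.1)
      filter_upwards [this] with l hl
      refine ⟨fun x hx h1 h2 => absurd ⟨h1, h2⟩ (hl x hx), iff_of_false ?_ hex⟩
      rintro ⟨x, hx, h⟩
      exact hl x hx h
  filter_upwards [eventually_all.mpr key] with l hl
  refine ⟨fun c => (hl c).1, Finset.sum_congr rfl fun c _ => ind_congr (hl c).2⟩

end Engine

/-! ### General position and invariance of the count along a segment of targets -/

section Generic

variable {ι : Type*} [Fintype ι] {n : ℕ}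

/-- Finitely many proper affine subspaces form a null set, whose complement is dense. -/
theorem frequently_forall_sub_notMem {α : Type*} [Finite α] (S : α → Submodule ℝ (ι → ℝ))
    (hS : ∀ a, S a ≠ ⊤) (b : α → ι → ℝ) (z₀ : ι → ℝ) :
    ∃ᶠ z in 𝓝 z₀, ∀ a, z - b a ∉ S a := by
  have h : ∀ᵐ z : ι → ℝ, ∀ a, z - b a ∉ S a := by
    rw [MeasureTheory.ae_all_iff]
    intro a
    rw [MeasureTheory.ae_iff]
    have : {z : ι → ℝ | ¬ (z - b a ∉ S a)} = (fun z => z + -b a) ⁻¹' (S a : Set (ι → ℝ)) := by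
      ext z; simp [sub_eq_add_neg]
    rw [this, MeasureTheory.measure_preimage_add_right]
    exact MeasureTheory.Measure.addHaar_submodule _ _ (hS a)
  exact mem_closure_iff_frequently.mp ((MeasureTheory.Measure.dense_of_ae h).closure_eq ▸ mem_univ z₀)

/-- The differential of `(x, t) ↦ cellMap G c x - t w`; the parameter `t` is the coordinate
`none`. -/
def prismMap (G : ι → ι → ZMod n → ℝ) (w : ι → ℝ) (c : ι → ZMod n) :
    (Option ι → ℝ) →ₗ[ℝ] (ι → ℝ) where
  toFun v := (cellMatrix G c).mulVec (fun k => v (some k)) - v none • w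
  map_add' u v := by
    have : (fun k => (u + v) (some k)) = (fun k => u (some k)) + fun k => v (some k) := rfl
    rw [this, Matrix.mulVec_add, Pi.add_apply, add_smul]; abel
  map_smul' a v := by
    have : (fun k => (a • v) (some k)) = a • fun k => v (some k) := rfl
    rw [this, Matrix.mulVec_smul, Pi.smul_apply, smul_assoc, RingHom.id_apply, smul_sub]

theorem cellMap_sub_eq_prismMap (G : ι → ι → ZMod n → ℝ) (w : ι → ℝ) (c : ι → ZMod n)
    (v : Option ι → ℝ) :
    cellMap G c (fun k => v (some k)) - v none • w = cellMap G c 0 + prismMap G w c v := by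
  rw [cellMap_eq]; simp only [prismMap, LinearMap.coe_mk, AddHom.coe_mk]; abel

/-- Fixing two of the `card ι + 1` coordinates leaves a space of dimension `card ι - 1`, too small
to map onto the target. Hence a generic target avoids the images of the faces of codimension two. -/
theorem map_prismMap_ne_top [DecidableEq ι] (G : ι → ι → ZMod n → ℝ) (w : ι → ℝ) (c : ι → ZMod n)
    {k₁ k₂ : Option ι} (h : k₁ ≠ k₂) :
    (LinearMap.ker ((LinearMap.proj (R := ℝ) (φ := fun _ : Option ι => ℝ) k₁).prod
      (LinearMap.proj k₂))).map (prismMap G w c) ≠ ⊤ := by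
  intro htop
  set P := (LinearMap.proj (R := ℝ) (φ := fun _ : Option ι => ℝ) k₁).prod (LinearMap.proj k₂)
  have hsurj : LinearMap.range P = ⊤ := by
    rw [LinearMap.range_eq_top]
    rintro ⟨a, b⟩
    refine ⟨fun j => if j = k₁ then a else b, ?_⟩
    simp [P, h.symm]
  have h1 := LinearMap.finrank_range_add_finrank_ker P
  rw [hsurj, finrank_top, Module.finrank_prod, Module.finrank_self,
    Module.finrank_fintype_fun_eq_card, Fintype.card_option] at h1
  have h2 := Submodule.finrank_map_le (prismMap G w c) (LinearMap.ker P)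
  rw [htop, finrank_top, Module.finrank_fintype_fun_eq_card] at h2
  omega

/-- Two targets have the same number of solutions if the segment between them is generic. -/
theorem count_eq_of_generic [NeZero n] [DecidableEq ι] {G : ι → ι → ZMod n → ℝ}
    {ψ : (ι → ZMod n) → (ι → ℝ) → ℝ} (hψ : ∀ c, Continuous (ψ c)) (hglue : Glued ψ) {y w : ι → ℝ}
    (hne : ∀ t ∈ Icc (0 : ℝ) 1, ∀ c, ∀ x ∈ Icc (0 : ι → ℝ) 1, cellMap G c x = y + t • w → ψ c x ≠ 0)
    (hsurj : ∀ c, ∀ v ∈ Icc (0 : Option ι → ℝ) 1,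
      cellMap G c (fun k => v (some k)) = y + v none • w → LinearMap.range (prismMap G w c) = ⊤)
    (hcodim : ∀ c, ∀ v ∈ Icc (0 : Option ι → ℝ) 1,
      cellMap G c (fun k => v (some k)) = y + v none • w → ∀ i j, (v i = 0 ∨ v i = 1) →
        (v j = 0 ∨ v j = 1) → i = j) :
    count G ψ y = count G ψ (y + w) := by
  set S : Set (ι → ℝ) := {u | ∃ t ∈ Icc (0 : ℝ) 1, u = y + t • w} with hS
  have hcell : ∀ c, ind (∃ x ∈ Icc (0 : ι → ℝ) 1, cellMap G c x = y ∧ 0 < ψ c x) +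
      ind (∃ x ∈ Icc (0 : ι → ℝ) 1, cellMap G c x = y + w ∧ 0 < ψ c x) +
      ∑ k, (ind (∃ x ∈ Icc (0 : ι → ℝ) 1, x k = 0 ∧ cellMap G c x ∈ S ∧ 0 < ψ c x) +
      ind (∃ x ∈ Icc (0 : ι → ℝ) 1, x k = 1 ∧ cellMap G c x ∈ S ∧ 0 < ψ c x)) = 0 := by
    intro c
    by_cases hex : ∃ v ∈ Icc (0 : Option ι → ℝ) 1,
        cellMap G c (fun k => v (some k)) = y + v none • w
    swap
    · have hno : ∀ x ∈ Icc (0 : ι → ℝ) 1, cellMap G c x ∉ S := by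
        rintro x hx ⟨t, ht, hxt⟩
        refine hex ⟨fun o => o.elim t x, ⟨?_, ?_⟩, hxt⟩
        · rintro (_ | k); exacts [ht.1, hx.1 k]
        · rintro (_ | k); exacts [ht.2, hx.2 k]
      have hyS : y ∈ S := ⟨0, by simp, by simp⟩
      have hyS' : y + w ∈ S := ⟨1, by simp, by simp⟩
      rw [ind_false, ind_false, Finset.sum_eq_zero]
      · simp
      · intro k _
        rw [ind_false, ind_false, add_zero]
        · rintro ⟨x, hx, -, h, -⟩; exact hno x hx h
        · rintro ⟨x, hx, -, h, -⟩; exact hno x hx h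
      · rintro ⟨x, hx, h, -⟩; exact hno x hx (h ▸ hyS')
      · rintro ⟨x, hx, h, -⟩; exact hno x hx (h ▸ hyS)
    obtain ⟨z, hz, hzF⟩ := hex
    -- A surjection from dimension `card ι + 1` to dimension `card ι` has a one-dimensional kernel,
    -- so the solutions in the prism lie on a line.
    have hker : Module.finrank ℝ (LinearMap.ker (prismMap G w c)) = 1 := by
      have := LinearMap.finrank_range_add_finrank_ker (prismMap G w c)
      rw [hsurj c z hz hzF, finrank_top, Module.finrank_fintype_fun_eq_card,
        Module.finrank_fintype_fun_eq_card, Fintype.card_option] at this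
      omega
    obtain ⟨⟨k, hkker⟩, hk0, hkspan⟩ := finrank_eq_one_iff'.mp hker
    have hk : ∃ i, k i ≠ 0 := by
      by_contra! h
      exact hk0 (Subtype.ext (funext h))
    have hsol : ∀ v : Option ι → ℝ, cellMap G c (fun k => v (some k)) = y + v none • w ↔
        ∃ r : ℝ, v = fun i => z i + r * k i := by
      intro v
      have e : ∀ v : Option ι → ℝ, cellMap G c (fun k => v (some k)) = y + v none • w ↔
          cellMap G c 0 + prismMap G w c v = y := by
        intro v; rw [← cellMap_sub_eq_prismMap, sub_eq_iff_eq_add]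
      rw [e]
      have ez := (e z).mp hzF
      constructor
      · intro h
        have : v - z ∈ LinearMap.ker (prismMap G w c) := by
          rw [LinearMap.mem_ker, map_sub, sub_eq_zero]
          exact add_left_cancel (h.trans ez.symm)
        obtain ⟨r, hr⟩ := hkspan ⟨v - z, this⟩
        refine ⟨r, ?_⟩
        have hr' : r • k = v - z := congrArg Subtype.val hr
        funext i
        have := congrFun hr' i
        simp only [Pi.smul_apply, smul_eq_mul, Pi.sub_apply] at this
        linarith
      · rintro ⟨r, rfl⟩
        have : (fun i => z i + r * k i) = z + r • k := rfl
        rw [this, map_add, map_smul, LinearMap.mem_ker.mp hkker, smul_zero, add_zero, ez]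
    have hcube : ∀ v : Option ι → ℝ, v ∈ Icc (0 : Option ι → ℝ) 1 ↔ ∀ i, v i ∈ Icc (0 : ℝ) 1 :=
      fun v => ⟨fun h i => ⟨h.1 i, h.2 i⟩, fun h => ⟨fun i => (h i).1, fun i => (h i).2⟩⟩
    have hne' : ∀ r, (∀ i, z i + r * k i ∈ Icc (0 : ℝ) 1) →
        ψ c (fun j => z (some j) + r * k (some j)) ≠ 0 := by
      intro r hr
      exact hne (z none + r * k none) (hr none) c _ ⟨fun i => (hr _).1, fun i => (hr _).2⟩
        ((hsol _).mpr ⟨r, rfl⟩)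
    -- As `ψ` does not vanish on the solutions, the line meets an even number of facets of the
    -- prism. The facets of the coordinate `none` give the two targets, the others are the walls
    -- between cells.
    have main := sum_ind_facets (z := z) (k := k) hk
      (ψ := fun r => ψ c (fun j => z (some j) + r * k (some j)))
      ((hψ c).comp (by fun_prop))
      (fun r hr _ i j => hcodim c _ ((hcube fun i => z i + r * k i).mpr hr) ((hsol _).mpr ⟨r, rfl⟩) i j)
      (fun r hr h => absurd h (hne' r hr))
      (fun r _ hr _ h _ => absurd h (hne' r hr))
    rw [ind_false (by rintro ⟨⟨r, hr, h⟩, -⟩; exact hne' r hr h), Fintype.sum_option] at main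
    rw [← main]
    have key : ∀ (i : Option ι) (ε : ℝ),
        (∃ r, (∀ i, z i + r * k i ∈ Icc (0 : ℝ) 1) ∧ z i + r * k i = ε ∧
          0 < ψ c (fun j => z (some j) + r * k (some j))) ↔
        ∃ v ∈ Icc (0 : Option ι → ℝ) 1, cellMap G c (fun k => v (some k)) = y + v none • w ∧
          v i = ε ∧ 0 < ψ c (fun j => v (some j)) := by
      intro i ε
      constructor
      · rintro ⟨r, h1, h2, h3⟩
        exact ⟨_, (hcube fun i => z i + r * k i).mpr h1, (hsol _).mpr ⟨r, rfl⟩, h2, h3⟩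
      · rintro ⟨v, h1, h2, h3, h4⟩
        obtain ⟨r, rfl⟩ := (hsol v).mp h2
        exact ⟨r, (hcube _).mp h1, h3, h4⟩
    simp only [key]
    congr 1
    · congr 1
      · refine ind_congr ⟨?_, ?_⟩
        · rintro ⟨x, hx, h, hp⟩
          refine ⟨fun o => o.elim 0 x, ⟨?_, ?_⟩, by simpa using h, rfl, hp⟩
          · rintro (_ | k); exacts [le_rfl, hx.1 k]
          · rintro (_ | k); exacts [zero_le_one, hx.2 k]
        · rintro ⟨v, hv, h, h0, hp⟩
          exact ⟨_, ⟨fun i => hv.1 _, fun i => hv.2 _⟩, by rw [h, h0]; simp, hp⟩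
      · refine ind_congr ⟨?_, ?_⟩
        · rintro ⟨x, hx, h, hp⟩
          refine ⟨fun o => o.elim 1 x, ⟨?_, ?_⟩, by simpa using h, rfl, hp⟩
          · rintro (_ | k); exacts [zero_le_one, hx.1 k]
          · rintro (_ | k); exacts [le_rfl, hx.2 k]
        · rintro ⟨v, hv, h, h0, hp⟩
          exact ⟨_, ⟨fun i => hv.1 _, fun i => hv.2 _⟩, by rw [h, h0]; simp, hp⟩
    · refine Finset.sum_congr rfl fun j _ => ?_
      have : ∀ ε : ℝ, (∃ x ∈ Icc (0 : ι → ℝ) 1, x j = ε ∧ cellMap G c x ∈ S ∧ 0 < ψ c x) ↔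
          ∃ v ∈ Icc (0 : Option ι → ℝ) 1, cellMap G c (fun k => v (some k)) = y + v none • w ∧
          v (some j) = ε ∧ 0 < ψ c (fun j => v (some j)) := by
        intro ε
        constructor
        · rintro ⟨x, hx, hxj, ⟨t, ht, hxt⟩, hp⟩
          refine ⟨fun o => o.elim t x, ⟨?_, ?_⟩, hxt, hxj, hp⟩
          · rintro (_ | k); exacts [ht.1, hx.1 k]
          · rintro (_ | k); exacts [ht.2, hx.2 k]
        · rintro ⟨v, hv, h, h0, hp⟩
          exact ⟨_, ⟨fun i => hv.1 _, fun i => hv.2 _⟩, h0, ⟨v none, ⟨hv.1 _, hv.2 _⟩, h⟩, hp⟩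
      rw [ind_congr (this 0), ind_congr (this 1)]
  have htot := Finset.sum_congr rfl (fun c (_ : c ∈ Finset.univ) => hcell c)
  rw [Finset.sum_add_distrib, Finset.sum_add_distrib, sum_facets_eq_zero G hglue S] at htot
  simp only [Finset.sum_const_zero, add_zero] at htot
  exact CharTwo.add_eq_zero.mp htot

/-- Regular targets have the same number of solutions if no solution on the segment between them
lies on the boundary of `0 < ψ`. -/
theorem count_eq_of_segment [NeZero n] [Nonempty ι] [DecidableEq ι] {G : ι → ι → ZMod n → ℝ}
    {ψ : (ι → ZMod n) → (ι → ℝ) → ℝ} (hψ : ∀ c, Continuous (ψ c)) (hglue : Glued ψ) {y y' : ι → ℝ}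
    (hy : RegularAt G ψ y) (hy' : RegularAt G ψ y')
    (hne : ∀ t ∈ Icc (0 : ℝ) 1, ∀ c, ∀ x ∈ Icc (0 : ι → ℝ) 1,
      cellMap G c x = y + t • (y' - y) → ψ c x ≠ 0) :
    count G ψ y = count G ψ y' := by
  set w := y' - y with hw
  have hyw : y + w = y' := by rw [hw]; abel
  have hcm : ∀ c, Continuous (cellMap G c) := fun c =>
    (continuous_cellMap (L := Unit) (G := fun _ => G) (fun _ _ _ => continuous_const) c).comp
      (by fun_prop : Continuous fun x : ι → ℝ => ((), x))
  have st : ∀ u : ι → ℝ, RegularAt G ψ u →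
      (∀ c, ∀ x ∈ Icc (0 : ι → ℝ) 1, cellMap G c x = u → ψ c x ≠ 0) →
      ∀ᶠ z in 𝓝 (0 : ι → ℝ), count G ψ (u + z) = count G ψ u := by
    intro u hu hun
    have := eventually_regularAt_and_count_eq (L := ι → ℝ) (G := fun _ => G) (ψ := fun _ => ψ)
      (y := fun z => u + z) (fun _ _ _ => continuous_const)
      (fun c => (hψ c).comp continuous_snd) (by fun_prop) (l₀ := 0) (by simpa using hu)
      (by simpa using hun)
    filter_upwards [this] with z hz
    simpa using hz.2
  have s1 := st y hy (fun c x hx h => hne 0 (by simp) c x hx (by simpa using h))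
  have s2 := st y' hy' (fun c x hx h => hne 1 (by simp) c x hx (by simpa [hyw] using h))
  have s3 : ∀ᶠ z in 𝓝 (0 : ι → ℝ), ∀ c, ∀ p ∈ Icc (0 : ℝ) 1 ×ˢ Icc (0 : ι → ℝ) 1,
      ¬ (cellMap G c p.2 = y + z + p.1 • w ∧ ψ c p.2 = 0) := by
    rw [eventually_all]
    intro c
    refine (isCompact_Icc.prod isCompact_Icc).eventually_forall_of_forall_eventually ?_
    rintro ⟨t, x⟩ ⟨ht, hx⟩
    by_cases h : ψ c x = 0
    · have hF : cellMap G c x - (y + 0 + t • w) ≠ 0 := by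
        intro h'
        exact hne t ht c x hx (by simpa using sub_eq_zero.mp h') h
      have hc : Continuous fun q : (ι → ℝ) × (ℝ × (ι → ℝ)) =>
          cellMap G c q.2.2 - (y + q.1 + q.2.1 • w) :=
        ((hcm c).comp (by fun_prop)).sub (by fun_prop)
      have := (hc.continuousAt (x := (0, (t, x)))).eventually_ne hF
      filter_upwards [this] with q hq h
      exact hq (sub_eq_zero.mpr h.1)
    · have hc : Continuous fun q : (ι → ℝ) × (ℝ × (ι → ℝ)) => ψ c q.2.2 :=
        (hψ c).comp (by fun_prop)
      have := (hc.continuousAt (x := (0, (t, x)))).eventually_ne h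
      filter_upwards [this] with q hq h
      exact hq h.2
  -- The whole segment is translated by a small `z`. `α` lists the faces of codimension two of the
  -- prisms, as pairs of coordinates with their values, and `β` the cells where `prismMap` is not
  -- onto. Avoiding their images makes the segment generic, while `s1` and `s2` keep the counts at
  -- its ends.
  let α := (ι → ZMod n) × {p : Option ι × Option ι // p.1 ≠ p.2} × (Option ι → Fin 2)
  let β := {c : ι → ZMod n // LinearMap.range (prismMap G w c) ≠ ⊤}
  obtain ⟨z, hz, ⟨hz1, hz2⟩, hz3⟩ := (frequently_forall_sub_notMem (α := α ⊕ β)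
    (Sum.elim (fun a => (LinearMap.ker ((LinearMap.proj (R := ℝ) (φ := fun _ : Option ι => ℝ)
      a.2.1.1.1).prod (LinearMap.proj a.2.1.1.2))).map (prismMap G w a.1))
      (fun b => LinearMap.range (prismMap G w b.1)))
    (by
      rintro (a | b)
      · exact map_prismMap_ne_top G w _ a.2.1.2
      · exact b.2)
    (Sum.elim (fun a => cellMap G a.1 0 - y + prismMap G w a.1 (fun i =>
        if i = a.2.1.1.1 ∨ i = a.2.1.1.2 then ((a.2.2 i : ℕ) : ℝ) else 0))
      (fun b => cellMap G b.1 0 - y)) 0).and_eventually ((s1.and s2).and s3) |>.exists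
  rw [← hz1, ← hz2, ← hyw, add_right_comm]
  have hzeq : ∀ c (v : Option ι → ℝ), cellMap G c (fun k => v (some k)) = y + z + v none • w →
      z - (cellMap G c 0 - y) = prismMap G w c v := by
    intro c v h
    have := cellMap_sub_eq_prismMap G w c v
    rw [h] at this
    have h2 : prismMap G w c v = y + z + v none • w - v none • w - cellMap G c 0 := by
      rw [this]; abel
    rw [h2]; abel
  refine count_eq_of_generic hψ hglue ?_ ?_ ?_
  · intro t ht c x hx h h0
    exact hz3 c (t, x) ⟨ht, hx⟩ ⟨h, h0⟩
  · intro c v hv h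
    by_contra hr
    refine hz (Sum.inr ⟨c, hr⟩) ?_
    simp only [Sum.elim_inr]
    exact ⟨v, (hzeq c v h).symm⟩
  · intro c v hv h i j hi hj
    by_contra hij
    let ε : Option ι → Fin 2 := fun o => if v o = 1 then 1 else 0
    have hε : ∀ o, (v o = 0 ∨ v o = 1) → ((ε o : ℕ) : ℝ) = v o := by
      rintro o (h | h) <;> simp [ε, h]
    refine hz (Sum.inl (c, ⟨(i, j), hij⟩, ε)) ?_
    simp only [Sum.elim_inl]
    rw [← sub_sub, hzeq c v h, ← map_sub]
    refine Submodule.mem_map_of_mem ?_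
    rw [LinearMap.mem_ker]
    simp [hε i hi, hε j hj]

end Generic

/-! ### The parity at the target zero: existence, homotopy invariance, additivity -/

section Parity

variable {ι : Type*} [Fintype ι] [DecidableEq ι] {n : ℕ}

/-- In the form of injectivity, transversality passes easily through a relabelling of the variables.
-/
theorem det_cellMatrix_ne_zero_iff (G : ι → ι → ZMod n → ℝ) (c : ι → ZMod n) :
    (cellMatrix G c).det ≠ 0 ↔ Function.Injective (cellMap G c) := by
  rw [← isUnit_iff_ne_zero, ← Matrix.isUnit_iff_isUnit_det, ← Matrix.mulVec_injective_iff_isUnit]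
  have : cellMap G c = (fun u => cellMap G c 0 + u) ∘ (cellMatrix G c).mulVec :=
    funext fun x => cellMap_eq G c x
  rw [this, Function.Injective.of_comp_iff (add_right_injective _)]

/-- The number of solutions is `d` for all small regular targets. -/
def HasParity [NeZero n] (G : ι → ι → ZMod n → ℝ) (ψ : (ι → ZMod n) → (ι → ℝ) → ℝ)
    (d : ZMod 2) : Prop :=
  ∀ᶠ y in 𝓝 (0 : ι → ℝ), RegularAt G ψ y → count G ψ y = d

/-- The targets to be avoided are the images of the facets and of the cells with singular matrix,
which lie in finitely many proper affine subspaces. -/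
theorem frequently_interior_and_det_ne_zero [NeZero n] [Nonempty ι] (G : ι → ι → ZMod n → ℝ)
    (y₀ : ι → ℝ) :
    ∃ᶠ y in 𝓝 y₀, ∀ c, ∀ x ∈ Icc (0 : ι → ℝ) 1, cellMap G c x = y →
      (∀ k, 0 < x k ∧ x k < 1) ∧ (cellMatrix G c).det ≠ 0 := by
  let α := (ι → ZMod n) × ι × Fin 2
  let β := {c : ι → ZMod n // (cellMatrix G c).det = 0}
  refine (frequently_forall_sub_notMem (α := α ⊕ β)
    (Sum.elim (fun a => (LinearMap.ker (LinearMap.proj (R := ℝ) (φ := fun _ : ι => ℝ) a.2.1)).map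
      (cellMatrix G a.1).mulVecLin) (fun b => LinearMap.range (cellMatrix G b.1).mulVecLin))
    ?_ (Sum.elim (fun a => cellMap G a.1 0 + (cellMatrix G a.1).mulVec
      (Pi.single a.2.1 ((a.2.2 : ℕ) : ℝ))) (fun b => cellMap G b.1 0)) y₀).mono ?_
  · rintro (⟨c, k, e⟩ | ⟨c, hc⟩) htop
    · simp only [Sum.elim_inl] at htop
      have h1 := LinearMap.finrank_range_add_finrank_ker
        (LinearMap.proj (R := ℝ) (φ := fun _ : ι => ℝ) k)
      have hsurj : LinearMap.range (LinearMap.proj (R := ℝ) (φ := fun _ : ι => ℝ) k) = ⊤ := by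
        rw [LinearMap.range_eq_top]
        exact fun a => ⟨fun _ => a, rfl⟩
      rw [hsurj, finrank_top, Module.finrank_self, Module.finrank_fintype_fun_eq_card] at h1
      have h2 := Submodule.finrank_map_le (cellMatrix G c).mulVecLin
        (LinearMap.ker (LinearMap.proj (R := ℝ) (φ := fun _ : ι => ℝ) k))
      rw [htop, finrank_top, Module.finrank_fintype_fun_eq_card] at h2
      omega
    · simp only [Sum.elim_inr] at htop
      rw [LinearMap.range_eq_top] at htop
      have : Function.Surjective (cellMatrix G c).mulVec := htop
      rw [Matrix.mulVec_surjective_iff_isUnit, Matrix.isUnit_iff_isUnit_det, hc] at this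
      simp at this
  · intro y hy c x hx hF
    rw [cellMap_eq] at hF
    have hend : ∀ (k : ι) (e : Fin 2), x k ≠ ((e : ℕ) : ℝ) := by
      intro k e hk
      refine hy (Sum.inl (c, k, e)) ?_
      simp only [Sum.elim_inl]
      refine ⟨x - Pi.single k ((e : ℕ) : ℝ), ?_, ?_⟩
      · rw [SetLike.mem_coe, LinearMap.mem_ker]
        simp [hk]
      · rw [Matrix.mulVecLin_apply, Matrix.mulVec_sub, ← hF]; abel
    refine ⟨fun k => ⟨lt_of_le_of_ne (hx.1 k) ?_, lt_of_le_of_ne (hx.2 k) ?_⟩, ?_⟩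
    · simpa using (hend k 0).symm
    · simpa using hend k 1
    · intro hdet
      refine hy (Sum.inr ⟨c, hdet⟩) ?_
      simp only [Sum.elim_inr]
      exact ⟨x, by rw [Matrix.mulVecLin_apply, ← hF]; abel⟩

theorem frequently_regularAt [NeZero n] [Nonempty ι] (G : ι → ι → ZMod n → ℝ)
    (ψ : (ι → ZMod n) → (ι → ℝ) → ℝ) (y₀ : ι → ℝ) : ∃ᶠ y in 𝓝 y₀, RegularAt G ψ y :=
  (frequently_interior_and_det_ne_zero G y₀).mono fun _ h c x hx hF _ => h c x hx hF

theorem HasParity.eq_of_frequently [NeZero n] {G : ι → ι → ZMod n → ℝ}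
    {ψ : (ι → ZMod n) → (ι → ℝ) → ℝ} {d d' : ZMod 2} (h : HasParity G ψ d)
    (h' : ∃ᶠ y in 𝓝 (0 : ι → ℝ), RegularAt G ψ y ∧ count G ψ y = d') : d = d' := by
  obtain ⟨y, ⟨h1, h2⟩, h3⟩ := (h'.and_eventually h).exists
  exact (h3 h1).symm.trans h2

/-- Regular targets accumulate at `0`, so the condition that defines `HasParity` is not vacuous. -/
theorem HasParity.unique [NeZero n] [Nonempty ι] {G : ι → ι → ZMod n → ℝ}
    {ψ : (ι → ZMod n) → (ι → ℝ) → ℝ} {d d' : ZMod 2} (h : HasParity G ψ d)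
    (h' : HasParity G ψ d') : d = d' :=
  h.eq_of_frequently (((frequently_regularAt G ψ 0).and_eventually h').mono
    fun _ h => ⟨h.1, h.2 h.1⟩)

/-- By compactness no solution for a parameter near `l₀` and a target near `0` has `ψ = 0`. One
regular target `y` in a small ball serves as reference: its count is stable in `l`, and within the
ball it is joined to every other regular target by a segment. -/
theorem exists_eventually_hasParity [NeZero n] [Nonempty ι] {L : Type*}
    [TopologicalSpace L] {G : L → ι → ι → ZMod n → ℝ}
    (hG : ∀ r k i, Continuous fun l => G l r k i) {ψ : L → (ι → ZMod n) → (ι → ℝ) → ℝ}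
    (hψ : ∀ c, Continuous fun p : L × (ι → ℝ) => ψ p.1 c p.2) (hglue : ∀ l, Glued (ψ l)) {l₀ : L}
    (hne : ∀ c, ∀ x ∈ Icc (0 : ι → ℝ) 1, cellMap (G l₀) c x = 0 → ψ l₀ c x ≠ 0) :
    ∃ d, ∀ᶠ l in 𝓝 l₀, HasParity (G l) (ψ l) d := by
  have s : ∀ᶠ q : L × (ι → ℝ) in 𝓝 (l₀, 0), ∀ c, ∀ x ∈ Icc (0 : ι → ℝ) 1,
      ¬ (cellMap (G q.1) c x = q.2 ∧ ψ q.1 c x = 0) := by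
    rw [eventually_all]
    intro c
    refine isCompact_Icc.eventually_forall_of_forall_eventually fun x hx => ?_
    by_cases h : ψ l₀ c x = 0
    · have hF : cellMap (G l₀) c x - 0 ≠ 0 := by
        intro h'
        exact hne c x hx (sub_eq_zero.mp h') h
      have hc : Continuous fun q : (L × (ι → ℝ)) × (ι → ℝ) =>
          cellMap (G q.1.1) c q.2 - q.1.2 :=
        ((continuous_cellMap hG c).comp (by fun_prop :
          Continuous fun q : (L × (ι → ℝ)) × (ι → ℝ) => (q.1.1, q.2))).sub (by fun_prop)
      have := (hc.continuousAt (x := ((l₀, 0), x))).eventually_ne hF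
      filter_upwards [this] with q hq h
      exact hq (sub_eq_zero.mpr h.1)
    · have hc : Continuous fun q : (L × (ι → ℝ)) × (ι → ℝ) => ψ q.1.1 c q.2 :=
        (hψ c).comp (by fun_prop : Continuous fun q : (L × (ι → ℝ)) × (ι → ℝ) => (q.1.1, q.2))
      have := (hc.continuousAt (x := ((l₀, 0), x))).eventually_ne h
      filter_upwards [this] with q hq h
      exact hq h.2
  rw [nhds_prod_eq, eventually_prod_iff] at s
  obtain ⟨P, hP, Q, hQ, hPQ⟩ := s
  obtain ⟨ε, hε, hball⟩ := Metric.eventually_nhds_iff_ball.mp hQ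
  obtain ⟨y, hyreg, hy⟩ := ((frequently_regularAt (G l₀) (ψ l₀) 0).and_eventually
    (Metric.ball_mem_nhds (0 : ι → ℝ) hε)).exists
  refine ⟨count (G l₀) (ψ l₀) y, ?_⟩
  have st := eventually_regularAt_and_count_eq hG hψ (y := fun _ => y) continuous_const hyreg
    (fun c x hx hF h0 => hPQ hP.self_of_nhds (hball y hy) c x hx ⟨hF, h0⟩)
  filter_upwards [st, hP] with l hl hlP
  rw [← hl.2]
  filter_upwards [Metric.ball_mem_nhds (0 : ι → ℝ) hε] with y' hy' hreg'
  have hψl : ∀ c, Continuous (ψ l c) := fun c =>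
    (hψ c).comp (by fun_prop : Continuous fun x : ι → ℝ => (l, x))
  refine count_eq_of_segment hψl (hglue l) hreg' hl.1 ?_
  intro t ht c x hx hF h0
  refine hPQ hlP (hball (y' + t • (y - y')) ?_) c x hx ⟨hF, h0⟩
  exact (convex_ball (0 : ι → ℝ) ε).add_smul_sub_mem hy' hy ht

/-- The parity is constant in connected families in which no solution reaches `ψ = 0`. -/
theorem exists_forall_hasParity [NeZero n] [Nonempty ι] {L : Type*}
    [TopologicalSpace L] [PreconnectedSpace L] [Nonempty L] {G : L → ι → ι → ZMod n → ℝ}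
    (hG : ∀ r k i, Continuous fun l => G l r k i) {ψ : L → (ι → ZMod n) → (ι → ℝ) → ℝ}
    (hψ : ∀ c, Continuous fun p : L × (ι → ℝ) => ψ p.1 c p.2) (hglue : ∀ l, Glued (ψ l))
    (hne : ∀ l c, ∀ x ∈ Icc (0 : ι → ℝ) 1, cellMap (G l) c x = 0 → ψ l c x ≠ 0) :
    ∃ d, ∀ l, HasParity (G l) (ψ l) d := by
  choose d hd using fun l => exists_eventually_hasParity hG hψ hglue (hne l)
  have hloc : IsLocallyConstant d := by
    rw [IsLocallyConstant.iff_eventually_eq]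
    intro l
    filter_upwards [hd l] with l' hl'
    exact (hd l').self_of_nhds.unique hl'
  obtain ⟨l₀⟩ := ‹Nonempty L›
  refine ⟨d l₀, fun l => ?_⟩
  rw [hloc.apply_eq_of_preconnectedSpace l₀ l]
  exact (hd l).self_of_nhds

/-- A counted solution has either `0 < ρ` or `ρ < 0`. In a cell it is unique by transversality, so
the two indicators add up without overlap. -/
theorem HasParity.add [NeZero n] {G : ι → ι → ZMod n → ℝ}
    {ψ ρ : (ι → ZMod n) → (ι → ℝ) → ℝ} (hψ : ∀ c, Continuous (ψ c)) (hρ : ∀ c, Continuous (ρ c))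
    {d₁ d₂ : ZMod 2} (h₁ : HasParity G (fun c x => min (ψ c x) (ρ c x)) d₁)
    (h₂ : HasParity G (fun c x => min (ψ c x) (-ρ c x)) d₂)
    (hne : ∀ c, ∀ x ∈ Icc (0 : ι → ℝ) 1, cellMap G c x = 0 → 0 ≤ ψ c x → ρ c x ≠ 0) :
    HasParity G ψ (d₁ + d₂) := by
  have hcm : ∀ c, Continuous (cellMap G c) := fun c =>
    (continuous_cellMap (L := Unit) (G := fun _ => G) (fun _ _ _ => continuous_const) c).comp
      (by fun_prop : Continuous fun x : ι → ℝ => ((), x))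
  have s : ∀ᶠ y in 𝓝 (0 : ι → ℝ), ∀ c, ∀ x ∈ Icc (0 : ι → ℝ) 1,
      ¬ (cellMap G c x = y ∧ 0 ≤ ψ c x ∧ ρ c x = 0) := by
    rw [eventually_all]
    intro c
    refine isCompact_Icc.eventually_forall_of_forall_eventually fun x hx => ?_
    by_cases h : cellMap G c x = 0
    · by_cases hp : 0 ≤ ψ c x
      · have hc : Continuous fun q : (ι → ℝ) × (ι → ℝ) => ρ c q.2 := (hρ c).comp continuous_snd
        have := (hc.continuousAt (x := (0, x))).eventually_ne (hne c x hx h hp)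
        filter_upwards [this] with q hq h
        exact hq h.2.2
      · have hc : Continuous fun q : (ι → ℝ) × (ι → ℝ) => ψ c q.2 := (hψ c).comp continuous_snd
        have := (hc.continuousAt (x := (0, x))).eventually (gt_mem_nhds (not_le.mp hp))
        filter_upwards [this] with q hq h
        exact absurd h.2.1 (not_le.mpr hq)
    · have hc : Continuous fun q : (ι → ℝ) × (ι → ℝ) => cellMap G c q.2 - q.1 :=
        ((hcm c).comp continuous_snd).sub continuous_fst
      have := (hc.continuousAt (x := (0, x))).eventually_ne (by simpa using h)
      filter_upwards [this] with q hq h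
      exact hq (sub_eq_zero.mpr h.1)
  filter_upwards [h₁, h₂, s] with y hy₁ hy₂ hs hreg
  rw [← hy₁ (fun c x hx hF hp => hreg c x hx hF (lt_min_iff.mp hp).1),
    ← hy₂ (fun c x hx hF hp => hreg c x hx hF (lt_min_iff.mp hp).1)]
  unfold count
  rw [← Finset.sum_add_distrib]
  refine Finset.sum_congr rfl fun c _ => ?_
  by_cases hex : ∃ x ∈ Icc (0 : ι → ℝ) 1, cellMap G c x = y ∧ 0 < ψ c x
  · rw [ind_true hex]
    obtain ⟨x, hx, hF, hp⟩ := hex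
    have huniq : ∀ x', cellMap G c x' = y → x' = x := fun x' h' =>
      (det_cellMatrix_ne_zero_iff G c).mp (hreg c x hx hF hp).2 (h'.trans hF.symm)
    rcases lt_trichotomy (ρ c x) 0 with h | h | h
    · rw [ind_false, ind_true ⟨x, hx, hF, lt_min hp (by linarith)⟩, zero_add]
      rintro ⟨x', hx', hF', hp'⟩
      obtain rfl := huniq x' hF'
      linarith [(lt_min_iff.mp hp').2]
    · exact absurd ⟨hF, hp.le, h⟩ (hs c x hx)
    · rw [ind_true ⟨x, hx, hF, lt_min hp h⟩, ind_false, add_zero]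
      rintro ⟨x', hx', hF', hp'⟩
      obtain rfl := huniq x' hF'
      linarith [(lt_min_iff.mp hp').2]
  · rw [ind_false hex, ind_false, ind_false, add_zero]
    · rintro ⟨x, hx, hF, hp⟩; exact hex ⟨x, hx, hF, (lt_min_iff.mp hp).1⟩
    · rintro ⟨x, hx, hF, hp⟩; exact hex ⟨x, hx, hF, (lt_min_iff.mp hp).1⟩

/-- The parity is invariant under permutations of the variables and linear changes of the
target. -/
theorem HasParity.relabel [NeZero n] {G G' : ι → ι → ZMod n → ℝ}
    {ψ ψ' : (ι → ZMod n) → (ι → ℝ) → ℝ} {d : ZMod 2} (h : HasParity G ψ d) (σ : Equiv.Perm ι)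
    (T : (ι → ℝ) ≃L[ℝ] (ι → ℝ)) (hG : ∀ c x, cellMap G' c x = T (cellMap G (c ∘ σ) (x ∘ σ)))
    (hψ : ∀ c x, ψ' c x = ψ (c ∘ σ) (x ∘ σ)) : HasParity G' ψ' d := by
  have hT : Tendsto T.symm (𝓝 0) (𝓝 0) := by
    simpa using T.symm.continuous.tendsto 0
  filter_upwards [hT.eventually h] with y hy hreg
  have hcube : ∀ x : ι → ℝ, x ∘ σ ∈ Icc (0 : ι → ℝ) 1 ↔ x ∈ Icc (0 : ι → ℝ) 1 := by
    intro x
    constructor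
    · rintro ⟨h0, h1⟩
      exact ⟨fun i => by simpa using h0 (σ.symm i), fun i => by simpa using h1 (σ.symm i)⟩
    · rintro ⟨h0, h1⟩
      exact ⟨fun i => h0 (σ i), fun i => h1 (σ i)⟩
  have hsol : ∀ c x, cellMap G' c x = y ↔ cellMap G (c ∘ σ) (x ∘ σ) = T.symm y := by
    intro c x
    rw [hG, ← T.symm.injective.eq_iff, T.symm_apply_apply]
  have hback : ∀ {β : Type _} (f : ι → β), (f ∘ σ.symm) ∘ σ = f := by
    intro β f; funext i; simp
  have hreg' : RegularAt G ψ (T.symm y) := by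
    intro c x hx hF hp
    have := hreg (c ∘ σ.symm) (x ∘ σ.symm) ((hcube _).mp (by rwa [hback]))
      ((hsol _ _).mpr (by rwa [hback, hback])) (by rwa [hψ, hback, hback])
    refine ⟨fun k => by simpa using this.1 (σ k), ?_⟩
    rw [det_cellMatrix_ne_zero_iff] at this ⊢
    intro x₁ x₂ h12
    have h3 : (x₁ ∘ σ.symm) = x₂ ∘ σ.symm := this.2 (by
      rw [hG, hG, hback, hback, hback, h12])
    rw [← hback x₁, h3, hback]
  rw [← hy hreg']
  unfold count
  have e := Equiv.sum_comp (Equiv.arrowCongr σ.symm (Equiv.refl (ZMod n)))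
    (fun c => ind (∃ x ∈ Icc (0 : ι → ℝ) 1, cellMap G c x = T.symm y ∧ 0 < ψ c x))
  rw [← e]
  refine Finset.sum_congr rfl fun c _ => ind_congr ?_
  have hc : (Equiv.arrowCongr σ.symm (Equiv.refl (ZMod n))) c = c ∘ σ := by
    funext i; simp [Equiv.arrowCongr]
  rw [hc]
  constructor
  · rintro ⟨x, hx, hF, hp⟩
    exact ⟨x ∘ σ, (hcube x).mpr hx, (hsol c x).mp hF, by rwa [← hψ]⟩
  · rintro ⟨x, hx, hF, hp⟩
    refine ⟨x ∘ σ.symm, (hcube _).mp (by rwa [hback]), (hsol c _).mpr (by rwa [hback]), ?_⟩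
    rwa [hψ, hback]

end Parity

/-! ### The equations for rhombi and the linking function -/

section Quad

variable {n : ℕ}

/-- The closed polygon with vertices `(X i, Y i)` is simple. -/
def SimpleLoop (X Y : ZMod n → ℝ) : Prop :=
  ∀ i j : ZMod n, ∀ s ∈ Icc (0 : ℝ) 1, ∀ t ∈ Icc (0 : ℝ) 1,
    pl X i s = pl X j t → pl Y i s = pl Y j t →
    (i = j ∧ s = t) ∨ (j = i + 1 ∧ s = 1 ∧ t = 0) ∨ (i = j + 1 ∧ s = 0 ∧ t = 1)

/-- The system of equations for four points `a, b, c, d` to form a parallelogram `abcd` with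
horizontal diagonal `ac` and vertical diagonal `bd`. -/
def quadG (X Y : ZMod n → ℝ) : Fin 4 → Fin 4 → ZMod n → ℝ :=
  ![![Y, 0, -Y, 0], ![0, X, 0, -X], ![X, -X, X, -X], ![Y, -Y, Y, -Y]]

theorem pl_neg (g : ZMod n → ℝ) (i : ZMod n) (t : ℝ) : pl (-g) i t = -pl g i t := by
  simp only [pl, Pi.neg_apply]; ring

theorem pl_zero_fun (i : ZMod n) (t : ℝ) : pl (0 : ZMod n → ℝ) i t = 0 := by simp [pl]

theorem cellMap_quadG (X Y : ZMod n → ℝ) (c : Fin 4 → ZMod n) (x : Fin 4 → ℝ) :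
    cellMap (quadG X Y) c x = ![pl Y (c 0) (x 0) - pl Y (c 2) (x 2),
      pl X (c 1) (x 1) - pl X (c 3) (x 3),
      pl X (c 0) (x 0) - pl X (c 1) (x 1) + pl X (c 2) (x 2) - pl X (c 3) (x 3),
      pl Y (c 0) (x 0) - pl Y (c 1) (x 1) + pl Y (c 2) (x 2) - pl Y (c 3) (x 3)] := by
  ext r
  fin_cases r <;>
    simp [cellMap, quadG, Fin.sum_univ_four, pl_neg, pl_zero_fun] <;> ring

theorem cellMap_quadG_eq_iff (X Y : ZMod n → ℝ) (c : Fin 4 → ZMod n) (x y : Fin 4 → ℝ) :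
    cellMap (quadG X Y) c x = y ↔ pl Y (c 0) (x 0) - pl Y (c 2) (x 2) = y 0 ∧
      pl X (c 1) (x 1) - pl X (c 3) (x 3) = y 1 ∧
      pl X (c 0) (x 0) - pl X (c 1) (x 1) + pl X (c 2) (x 2) - pl X (c 3) (x 3) = y 2 ∧
      pl Y (c 0) (x 0) - pl Y (c 1) (x 1) + pl Y (c 2) (x 2) - pl Y (c 3) (x 3) = y 3 := by
  rw [cellMap_quadG]
  constructor
  · rintro rfl; simp
  · rintro ⟨h0, h1, h2, h3⟩
    ext r
    fin_cases r <;> simp [h0, h1, h2, h3]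

theorem continuous_quadG {L : Type*} [TopologicalSpace L] {X Y : L → ZMod n → ℝ}
    (hX : ∀ i, Continuous fun l => X l i) (hY : ∀ i, Continuous fun l => Y l i) (r k : Fin 4)
    (i : ZMod n) : Continuous fun l => quadG (X l) (Y l) r k i := by
  have := hX i; have := hY i
  fin_cases r <;> fin_cases k <;> simp [quadG] <;> fun_prop

/-- A periodic function of four parameters on a circle of length `n`, which is negative if and
only if `s₀, s₂` separate `s₁, s₃`. -/
noncomputable def linkFn (n : ℕ) (s₀ s₁ s₂ s₃ : ℝ) : ℝ :=
  Real.sin (Real.pi * (s₀ - s₁) / n) * Real.sin (Real.pi * (s₁ - s₂) / n) *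
    Real.sin (Real.pi * (s₂ - s₃) / n) * Real.sin (Real.pi * (s₃ - s₀) / n)

/-- The linking function on the cells of quadruples of points of a polygon. -/
noncomputable def link (c : Fin 4 → ZMod n) (x : Fin 4 → ℝ) : ℝ :=
  linkFn n ((c 0).val + x 0) ((c 1).val + x 1) ((c 2).val + x 2) ((c 3).val + x 3)

theorem linkFn_rotate (s₀ s₁ s₂ s₃ : ℝ) : linkFn n s₁ s₂ s₃ s₀ = linkFn n s₀ s₁ s₂ s₃ := by
  unfold linkFn; ring

/-- A full period multiplies exactly two of the four sines by the same sign. This makes the product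
a function on the torus. -/
theorem linkFn_add_mul [NeZero n] (s₀ s₁ s₂ s₃ : ℝ) (m : ℤ) :
    linkFn n (s₀ + m * n) s₁ s₂ s₃ = linkFn n s₀ s₁ s₂ s₃ := by
  have hn : (n : ℝ) ≠ 0 := Nat.cast_ne_zero.mpr (NeZero.ne n)
  unfold linkFn
  have e1 : Real.pi * (s₀ + m * n - s₁) / n = Real.pi * (s₀ - s₁) / n + m * Real.pi := by
    field_simp; ring
  have e2 : Real.pi * (s₃ - (s₀ + m * n)) / n = Real.pi * (s₃ - s₀) / n - m * Real.pi := by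
    field_simp; ring
  rw [e1, e2, Real.sin_add_int_mul_pi, Real.sin_sub_int_mul_pi]
  have : ((-1 : ℝ) ^ m) * ((-1 : ℝ) ^ m) = 1 := by
    rw [← mul_zpow]; norm_num
  linear_combination (Real.sin (Real.pi * (s₀ - s₁) / n) * Real.sin (Real.pi * (s₁ - s₂) / n) *
    Real.sin (Real.pi * (s₂ - s₃) / n) * Real.sin (Real.pi * (s₃ - s₀) / n)) * this

theorem linkFn_congr [NeZero n] {s t : Fin 4 → ℝ} (h : ∀ k, ∃ m : ℤ, s k = t k + m * n) :
    linkFn n (s 0) (s 1) (s 2) (s 3) = linkFn n (t 0) (t 1) (t 2) (t 3) := by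
  obtain ⟨m0, h0⟩ := h 0
  obtain ⟨m1, h1⟩ := h 1
  obtain ⟨m2, h2⟩ := h 2
  obtain ⟨m3, h3⟩ := h 3
  rw [h0, linkFn_add_mul, ← linkFn_rotate, h1, linkFn_add_mul, ← linkFn_rotate, h2, linkFn_add_mul,
    ← linkFn_rotate, h3, linkFn_add_mul, ← linkFn_rotate]

theorem val_add_one_eq [NeZero n] (i : ZMod n) : ∃ m : ℤ, (i.val : ℝ) + 1 = (i + 1).val + m * n := by
  have h : (((i.val : ℤ) + 1 - (i + 1).val : ℤ) : ZMod n) = 0 := by simp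
  rw [ZMod.intCast_zmod_eq_zero_iff_dvd] at h
  obtain ⟨m, hm⟩ := h
  refine ⟨m, ?_⟩
  have : ((i.val : ℤ) : ℝ) + 1 - ((i + 1).val : ℤ) = n * m := by exact_mod_cast hm
  push_cast at this
  linarith

theorem glued_link [NeZero n] : Glued (link (n := n)) := by
  intro c x k hk
  have key := linkFn_congr (s := fun k => ((c k).val : ℝ) + x k)
    (t := fun j => (((c + Pi.single k 1 : Fin 4 → ZMod n) j).val : ℝ) +
      Function.update x k 0 j) (by
      intro j
      by_cases h : j = k
      · subst h
        simpa [hk] using val_add_one_eq (c j)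
      · exact ⟨0, by simp [h]⟩)
  beta_reduce at key
  rw [link, link, key]

theorem continuous_link (c : Fin 4 → ZMod n) : Continuous (link c) := by
  unfold link linkFn; fun_prop

/-- With two opposite points equal, the product of sines is a square. -/
theorem linkFn_nonneg_of_eq (s₀ s₁ s₃ : ℝ) : 0 ≤ linkFn n s₀ s₁ s₀ s₃ := by
  unfold linkFn
  have e1 : Real.pi * (s₁ - s₀) / n = -(Real.pi * (s₀ - s₁) / n) := by ring
  have e2 : Real.pi * (s₃ - s₀) / n = -(Real.pi * (s₀ - s₃) / n) := by ring
  rw [e1, e2, Real.sin_neg, Real.sin_neg]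
  have : Real.sin (Real.pi * (s₀ - s₁) / n) * -Real.sin (Real.pi * (s₀ - s₁) / n) *
      Real.sin (Real.pi * (s₀ - s₃) / n) * -Real.sin (Real.pi * (s₀ - s₃) / n) =
      (Real.sin (Real.pi * (s₀ - s₁) / n) * Real.sin (Real.pi * (s₀ - s₃) / n)) ^ 2 := by ring
  rw [this]; positivity

theorem link_nonneg_of_eq [NeZero n] {c : Fin 4 → ZMod n} {x : Fin 4 → ℝ}
    (h : ∃ m : ℤ, ((c 2).val : ℝ) + x 2 = (c 0).val + x 0 + m * n) : 0 ≤ link c x := by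
  obtain ⟨m, hm⟩ := h
  unfold link
  rw [← linkFn_rotate, ← linkFn_rotate, hm, linkFn_add_mul, linkFn_rotate, linkFn_rotate]
  exact linkFn_nonneg_of_eq _ _ _

theorem link_nonneg_of_eq' [NeZero n] {c : Fin 4 → ZMod n} {x : Fin 4 → ℝ}
    (h : ∃ m : ℤ, ((c 3).val : ℝ) + x 3 = (c 1).val + x 1 + m * n) : 0 ≤ link c x := by
  obtain ⟨m, hm⟩ := h
  unfold link
  rw [← linkFn_rotate, ← linkFn_rotate, ← linkFn_rotate, hm, linkFn_add_mul, ← linkFn_rotate,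
    ← linkFn_rotate]
  exact linkFn_nonneg_of_eq _ _ _

/-- Points of a simple polygon agree only if their parameters agree modulo the period. -/
theorem SimpleLoop.val_add_eq [NeZero n] {X Y : ZMod n → ℝ} (h : SimpleLoop X Y) {i j : ZMod n}
    {s t : ℝ} (hs : s ∈ Icc (0 : ℝ) 1) (ht : t ∈ Icc (0 : ℝ) 1) (hX : pl X i s = pl X j t)
    (hY : pl Y i s = pl Y j t) : ∃ m : ℤ, (i.val : ℝ) + s = j.val + t + m * n := by
  rcases h i j s hs t ht hX hY with ⟨rfl, rfl⟩ | ⟨rfl, rfl, rfl⟩ | ⟨rfl, rfl, rfl⟩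
  · exact ⟨0, by simp⟩
  · simpa using val_add_one_eq i
  · obtain ⟨m, hm⟩ := val_add_one_eq j
    exact ⟨-m, by push_cast; linarith⟩

theorem sin_eq_zero_imp [NeZero n] {u : ℝ} (h : Real.sin (Real.pi * u / n) = 0) :
    ∃ m : ℤ, u = m * n := by
  have hn : (n : ℝ) ≠ 0 := Nat.cast_ne_zero.mpr (NeZero.ne n)
  obtain ⟨m, hm⟩ := Real.sin_eq_zero_iff.mp h
  refine ⟨m, ?_⟩
  have hpi := Real.pi_ne_zero
  field_simp at hm
  linarith

theorem val_eq_of_natCast_eq [NeZero n] {i j : ZMod n} {m : ℤ}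
    (h : (i.val : ℤ) = j.val + m * n) : i = j := by
  have := congrArg (Int.cast : ℤ → ZMod n) h
  simpa using this

/-- Equal parameters modulo the period give equal points. -/
theorem pl_eq_of_val_add_eq [NeZero n] (g : ZMod n → ℝ) {i j : ZMod n} {s t : ℝ}
    (hs : s ∈ Icc (0 : ℝ) 1) (ht : t ∈ Icc (0 : ℝ) 1) {m : ℤ}
    (h : (i.val : ℝ) + s = j.val + t + m * n) : pl g i s = pl g j t := by
  have key : ∀ {i j : ZMod n} {s t : ℝ} {m : ℤ}, s ∈ Icc (0 : ℝ) 1 → t ∈ Icc (0 : ℝ) 1 → s ≤ t →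
      (i.val : ℝ) + s = j.val + t + m * n → pl g i s = pl g j t := by
    intro i j s t m hs ht hst h
    -- The number `t - s` is an integer in `[0, 1]`. The value 0 means the same point of the same
    -- edge, the value 1 the common vertex of consecutive edges.
    have hint : t - s = (((i.val : ℤ) - j.val - m * n : ℤ) : ℝ) := by push_cast; linarith
    have h0 : (0 : ℤ) ≤ (i.val : ℤ) - j.val - m * n := by
      have : (0 : ℝ) ≤ (((i.val : ℤ) - j.val - m * n : ℤ) : ℝ) := by rw [← hint]; linarith
      exact_mod_cast this
    have h1 : (i.val : ℤ) - j.val - m * n ≤ 1 := by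
      have : (((i.val : ℤ) - j.val - m * n : ℤ) : ℝ) ≤ 1 := by rw [← hint]; linarith [ht.2, hs.1]
      exact_mod_cast this
    have h01 : (i.val : ℤ) - j.val - m * n = 0 ∨ (i.val : ℤ) - j.val - m * n = 1 := by omega
    rcases h01 with h01 | h01
    · have hij : i = j := val_eq_of_natCast_eq (m := m) (by linarith)
      rw [h01] at hint
      have : s = t := by push_cast at hint; linarith
      rw [hij, this]
    · rw [h01] at hint
      push_cast at hint
      have ht1 : t = 1 := by linarith [ht.2, hs.1]
      have hs0 : s = 0 := by linarith
      obtain ⟨m', hm'⟩ := val_add_one_eq j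
      have hm'' : (j.val : ℤ) + 1 = (j + 1).val + m' * n := by exact_mod_cast hm'
      have : i = j + 1 := val_eq_of_natCast_eq (m := m + m') (by linarith)
      rw [ht1, hs0, pl_zero, pl_one, this]
  rcases le_total s t with hst | hst
  · exact key hs ht hst h
  · refine (key (m := -m) ht hs hst ?_).symm
    push_cast; linarith

/-- A vanishing sine makes two neighbours of the quadruple equal as parameters on the circle. Two
functions `g, g'` are carried along so that one application yields both coordinates. -/
theorem link_eq_zero_imp [NeZero n] {c : Fin 4 → ZMod n} {x : Fin 4 → ℝ}
    (hx : x ∈ Icc (0 : Fin 4 → ℝ) 1) (h : link c x = 0) (g g' : ZMod n → ℝ) :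
    (pl g (c 0) (x 0) = pl g (c 1) (x 1) ∧ pl g' (c 0) (x 0) = pl g' (c 1) (x 1)) ∨
    (pl g (c 1) (x 1) = pl g (c 2) (x 2) ∧ pl g' (c 1) (x 1) = pl g' (c 2) (x 2)) ∨
    (pl g (c 2) (x 2) = pl g (c 3) (x 3) ∧ pl g' (c 2) (x 2) = pl g' (c 3) (x 3)) ∨
    (pl g (c 3) (x 3) = pl g (c 0) (x 0) ∧ pl g' (c 3) (x 3) = pl g' (c 0) (x 0)) := by
  have key : ∀ i j : Fin 4, Real.sin (Real.pi * (((c i).val + x i) - ((c j).val + x j)) / n) = 0 →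
      pl g (c i) (x i) = pl g (c j) (x j) ∧ pl g' (c i) (x i) = pl g' (c j) (x j) := by
    intro i j hs
    obtain ⟨m, hm⟩ := sin_eq_zero_imp hs
    have e : ((c i).val : ℝ) + x i = (c j).val + x j + m * n := by linarith
    exact ⟨pl_eq_of_val_add_eq g ⟨hx.1 i, hx.2 i⟩ ⟨hx.1 j, hx.2 j⟩ e,
      pl_eq_of_val_add_eq g' ⟨hx.1 i, hx.2 i⟩ ⟨hx.1 j, hx.2 j⟩ e⟩
  unfold link linkFn at h
  rcases mul_eq_zero.mp h with h | h
  · rcases mul_eq_zero.mp h with h | h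
    · rcases mul_eq_zero.mp h with h | h
      · exact Or.inl (key 0 1 h)
      · exact Or.inr (Or.inl (key 1 2 h))
    · exact Or.inr (Or.inr (Or.inl (key 2 3 h)))
  · exact Or.inr (Or.inr (Or.inr (key 3 0 h)))

end Quad

/-! ### No linked parallelograms near a vertex, and the uniform margin -/

section Wedge

variable {n : ℕ}

theorem zmod_one_ne_zero (h3 : 3 ≤ n) : (1 : ZMod n) ≠ 0 := by
  intro h
  have := (ZMod.natCast_eq_zero_iff 1 n).mp (by exact_mod_cast h)
  have := Nat.le_of_dvd one_pos this
  omega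

theorem zmod_two_ne_zero (h3 : 3 ≤ n) : (2 : ZMod n) ≠ 0 := by
  intro h
  have := (ZMod.natCast_eq_zero_iff 2 n).mp (by exact_mod_cast h)
  have := Nat.le_of_dvd two_pos this
  omega

theorem SimpleLoop.edge_ne (h3 : 3 ≤ n) {X Y : ZMod n → ℝ} (h : SimpleLoop X Y) (i : ZMod n)
    (hX : X (i + 1) - X i = 0) (hY : Y (i + 1) - Y i = 0) : False := by
  rcases h i i 0 (by simp) 1 (by simp) (by simp [pl, hX]) (by simp [pl, hY]) with h | h | h
  · exact zero_ne_one h.2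
  · exact zero_ne_one h.2.1
  · have : (1 : ZMod n) = 0 := by simpa using h.1.symm
    exact zmod_one_ne_zero h3 this

/-- Consecutive edges of a simple polygon do not point in opposite directions: some linear
functional increases along both of them. -/
theorem SimpleLoop.exists_functional (h3 : 3 ≤ n) {X Y : ZMod n → ℝ} (h : SimpleLoop X Y)
    (p : ZMod n) : ∃ α β : ℝ, 0 < α * (X p - X (p - 1)) + β * (Y p - Y (p - 1)) ∧
      0 < α * (X (p + 1) - X p) + β * (Y (p + 1) - Y p) := by
  have hm := h.edge_ne h3 (p - 1)
  have hp := h.edge_ne h3 p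
  rw [sub_add_cancel] at hm
  set a := X p - X (p - 1) with ha
  set b := Y p - Y (p - 1) with hb
  set a' := X (p + 1) - X p with ha'
  set b' := Y (p + 1) - Y p with hb'
  by_cases hcr : a * b' - b * a' = 0
  · refine ⟨a, b, ?_, ?_⟩
    · by_contra! hle
      have : a = 0 := by nlinarith [sq_nonneg a, sq_nonneg b]
      have : b = 0 := by nlinarith [sq_nonneg a, sq_nonneg b]
      exact hm ‹_› ‹_›
    · by_contra! hle
      set N := a * a + b * b with hN
      have hNpos : 0 < N := by
        by_contra! hle'
        have : a = 0 := by nlinarith [sq_nonneg a, sq_nonneg b]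
        have : b = 0 := by nlinarith [sq_nonneg a, sq_nonneg b]
        exact hm ‹_› ‹_›
      set D := -(a * a' + b * b') with hD
      have hDnn : 0 ≤ D := by linarith
      have ea : N * a' = -D * a := by simp only [hN, hD]; linear_combination (-b) * hcr
      have eb : N * b' = -D * b := by simp only [hN, hD]; linear_combination a * hcr
      have hDpos : 0 < D := by
        rcases hDnn.lt_or_eq with h | h
        · exact h
        · exfalso
          rw [← h] at ea eb
          exact hp (by simpa [hNpos.ne'] using ea) (by simpa [hNpos.ne'] using eb)
      -- the points `p + t w` and `p - (t D / N) w` agree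
      have key := h p (p - 1) (N / (N + D)) ⟨by positivity, by
          rw [div_le_one (by positivity)]; linarith⟩ (1 - D / (N + D)) ⟨by
          rw [sub_nonneg, div_le_one (by positivity)]; linarith, by
          have : 0 ≤ D / (N + D) := by positivity
          linarith⟩ (by
            simp only [pl, sub_add_cancel, ← ha, ← ha']
            have : X p = X (p - 1) + a := by rw [ha]; ring
            rw [this]; field_simp; linear_combination ea) (by
            simp only [pl, sub_add_cancel, ← hb, ← hb']
            have : Y p = Y (p - 1) + b := by rw [hb]; ring
            rw [this]; field_simp; linear_combination eb)
      have hpos1 : 0 < N / (N + D) := by positivity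
      have hpos2 : 0 < D / (N + D) := by positivity
      rcases key with ⟨h1, -⟩ | ⟨h1, -, h2⟩ | ⟨-, h2, -⟩
      · exact zmod_one_ne_zero h3 (by linear_combination h1)
      · exact zmod_two_ne_zero h3 (by linear_combination -h1)
      · linarith
  · refine ⟨(b' - b) / (a * b' - b * a'), (a - a') / (a * b' - b * a'), ?_, ?_⟩
    · have : (b' - b) / (a * b' - b * a') * a + (a - a') / (a * b' - b * a') * b = 1 := by
        rw [div_mul_eq_mul_div, div_mul_eq_mul_div, ← add_div, div_eq_one_iff_eq hcr]; ring
      rw [this]; exact one_pos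
    · have : (b' - b) / (a * b' - b * a') * a' + (a - a') / (a * b' - b * a') * b' = 1 := by
        rw [div_mul_eq_mul_div, div_mul_eq_mul_div, ← add_div, div_eq_one_iff_eq hcr]; ring
      rw [this]; exact one_pos

/-- Equality of signs is expressed as a positive factor, since such factors can be multiplied over
the four differences in `link`. -/
theorem exists_pos_mul_eq {d e : ℝ} (h0 : d = 0 → e = 0) (hpos : 0 < d → 0 < e)
    (hneg : d < 0 → e < 0) : ∃ κ > 0, e = κ * d := by
  rcases lt_trichotomy d 0 with h | h | h
  · exact ⟨e / d, div_pos_of_neg_of_neg (hneg h) h, (div_mul_cancel₀ e h.ne).symm⟩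
  · exact ⟨1, one_pos, by rw [h0 h, h, mul_zero]⟩
  · exact ⟨e / d, div_pos (hpos h) h, (div_mul_cancel₀ e h.ne').symm⟩

theorem exists_sin_eq_mul [NeZero n] {d : ℝ} (hd : |d| < n) :
    ∃ κ > 0, Real.sin (Real.pi * d / n) = κ * d := by
  have hn : (0 : ℝ) < n := Nat.cast_pos.mpr (NeZero.pos n)
  rw [abs_lt] at hd
  refine exists_pos_mul_eq ?_ ?_ ?_
  · rintro rfl; simp
  · intro h
    refine Real.sin_pos_of_pos_of_lt_pi (by positivity) ?_
    rw [div_lt_iff₀ hn]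
    exact mul_lt_mul_of_pos_left hd.2 Real.pi_pos
  · intro h
    refine Real.sin_neg_of_neg_of_neg_pi_lt ?_ ?_
    · exact div_neg_of_neg_of_pos (mul_neg_of_pos_of_neg Real.pi_pos h) hn
    · rw [lt_div_iff₀ hn]
      have := mul_lt_mul_of_pos_left hd.1 Real.pi_pos
      linarith

/-- For parameters in an interval shorter than the period, the sign of the linking function is the
sign of a product of differences. -/
theorem exists_linkFn_eq_mul [NeZero n] {s₀ s₁ s₂ s₃ : ℝ} (h01 : |s₀ - s₁| < n)
    (h12 : |s₁ - s₂| < n) (h23 : |s₂ - s₃| < n) (h30 : |s₃ - s₀| < n) :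
    ∃ κ > 0, linkFn n s₀ s₁ s₂ s₃ = κ * ((s₀ - s₁) * (s₁ - s₂) * (s₂ - s₃) * (s₃ - s₀)) := by
  obtain ⟨k0, h0, e0⟩ := exists_sin_eq_mul h01
  obtain ⟨k1, h1, e1⟩ := exists_sin_eq_mul h12
  obtain ⟨k2, h2, e2⟩ := exists_sin_eq_mul h23
  obtain ⟨k3, h3, e3⟩ := exists_sin_eq_mul h30
  refine ⟨k0 * k1 * k2 * k3, by positivity, ?_⟩
  rw [linkFn, e0, e1, e2, e3]; ring

/-- The parameter of a point on the two edges at the vertex `p`, relative to `p`. -/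
noncomputable def relPos (p i : ZMod n) (t : ℝ) : ℝ := if i = p then t else t - 1

theorem val_add_eq_relPos [NeZero n] {p i : ZMod n} (t : ℝ) (hi : i = p ∨ i = p - 1) :
    ∃ m : ℤ, (i.val : ℝ) + t = p.val + relPos p i t + m * n := by
  unfold relPos
  by_cases h : i = p
  · exact ⟨0, by simp [h]⟩
  · have hi' : i = p - 1 := hi.resolve_left h
    obtain ⟨m, hm⟩ := val_add_one_eq i
    have : i + 1 = p := by rw [hi']; ring
    rw [this] at hm
    exact ⟨m, by simp only [h, if_false]; linarith⟩

theorem relPos_mem {p i : ZMod n} {t : ℝ} (ht : t ∈ Icc (0 : ℝ) 1) :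
    relPos p i t ∈ Icc (-1 : ℝ) 1 := by
  unfold relPos
  split_ifs
  · exact ⟨by linarith [ht.1], ht.2⟩
  · exact ⟨by linarith [ht.1], by linarith [ht.2]⟩

theorem exists_link_eq_mul_relPos [NeZero n] (h3 : 3 ≤ n) {c : Fin 4 → ZMod n} {x : Fin 4 → ℝ}
    {p : ZMod n} (hc : ∀ k, c k = p ∨ c k = p - 1) (hx : x ∈ Icc (0 : Fin 4 → ℝ) 1) :
    ∃ κ > 0, link c x = κ * ((relPos p (c 0) (x 0) - relPos p (c 1) (x 1)) *
      (relPos p (c 1) (x 1) - relPos p (c 2) (x 2)) *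
      (relPos p (c 2) (x 2) - relPos p (c 3) (x 3)) *
      (relPos p (c 3) (x 3) - relPos p (c 0) (x 0))) := by
  have hq : ∀ k, relPos p (c k) (x k) ∈ Icc (-1 : ℝ) 1 := fun k => relPos_mem ⟨hx.1 k, hx.2 k⟩
  have hn : (3 : ℝ) ≤ n := by exact_mod_cast h3
  have key := linkFn_congr (s := fun k => ((c k).val : ℝ) + x k)
    (t := fun k => (p.val : ℝ) + relPos p (c k) (x k)) (fun k => val_add_eq_relPos (x k) (hc k))
  beta_reduce at key
  have hd : ∀ i j, |((p.val : ℝ) + relPos p (c i) (x i)) - (p.val + relPos p (c j) (x j))| < n := by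
    intro i j
    have := hq i; have := hq j
    rw [abs_lt]
    constructor <;> linarith [(hq i).1, (hq i).2, (hq j).1, (hq j).2]
  obtain ⟨κ, hκ, e⟩ := exists_linkFn_eq_mul (hd 0 1) (hd 1 2) (hd 2 3) (hd 3 0)
  refine ⟨κ, hκ, ?_⟩
  rw [link, key, e]
  ring

/-- No parallelogram inscribed in two consecutive edges is linked. -/
theorem SimpleLoop.link_nonneg_of_wedge [NeZero n] (h3 : 3 ≤ n) {X Y : ZMod n → ℝ}
    (h : SimpleLoop X Y) {c : Fin 4 → ZMod n} {x : Fin 4 → ℝ} {p : ZMod n}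
    (hc : ∀ k, c k = p ∨ c k = p - 1) (hx : x ∈ Icc (0 : Fin 4 → ℝ) 1)
    (hX : pl X (c 0) (x 0) - pl X (c 1) (x 1) + pl X (c 2) (x 2) - pl X (c 3) (x 3) = 0)
    (hY : pl Y (c 0) (x 0) - pl Y (c 1) (x 1) + pl Y (c 2) (x 2) - pl Y (c 3) (x 3) = 0) :
    0 ≤ link c x := by
  obtain ⟨α, β, hm, hp⟩ := h.exists_functional h3 p
  obtain ⟨κ, hκ, e⟩ := exists_link_eq_mul_relPos h3 hc hx
  set A : Fin 4 → ℝ := fun k => α * pl X (c k) (x k) + β * pl Y (c k) (x k) with hA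
  -- The functional increases along both edges, so its differences have the signs of the differences
  -- of parameters.
  have hmono : ∀ i j, ∃ κ > 0, A i - A j =
      κ * (relPos p (c i) (x i) - relPos p (c j) (x j)) := by
    intro i j
    have hi0 := hx.1 i; have hi1 := hx.2 i; have hj0 := hx.1 j; have hj1 := hx.2 j
    simp only [Pi.zero_apply, Pi.one_apply] at hi0 hi1 hj0 hj1
    have hne : p - 1 ≠ p := fun h => zmod_one_ne_zero h3 (by linear_combination -h)
    rcases hc i with hi | hi <;> rcases hc j with hj | hj
    · refine ⟨_, hp, ?_⟩
      simp only [hA, hi, hj, relPos, pl, if_true]; ring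
    · have e1 : A i - A j = x i * (α * (X (p + 1) - X p) + β * (Y (p + 1) - Y p)) +
          (1 - x j) * (α * (X p - X (p - 1)) + β * (Y p - Y (p - 1))) := by
        simp only [hA, hi, hj, pl, sub_add_cancel]; ring
      have e2 : relPos p (c i) (x i) - relPos p (c j) (x j) = x i + (1 - x j) := by
        simp only [hi, hj, relPos, if_true, hne, if_false]; ring
      rw [e1, e2]
      refine exists_pos_mul_eq ?_ ?_ ?_
      · intro h0
        have a0 : x i = 0 := by linarith
        have b0 : 1 - x j = 0 := by linarith
        rw [a0, b0]; ring
      · intro h0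
        rcases hi0.lt_or_eq with h | h
        · have := mul_pos h hp; have := mul_nonneg (sub_nonneg.mpr hj1) hm.le; linarith
        · have : 0 < 1 - x j := by linarith
          have := mul_pos this hm; rw [← h]; linarith
      · intro h0; linarith
    · have e1 : A i - A j = -(x j * (α * (X (p + 1) - X p) + β * (Y (p + 1) - Y p)) +
          (1 - x i) * (α * (X p - X (p - 1)) + β * (Y p - Y (p - 1)))) := by
        simp only [hA, hi, hj, pl, sub_add_cancel]; ring
      have e2 : relPos p (c i) (x i) - relPos p (c j) (x j) = -(x j + (1 - x i)) := by
        simp only [hi, hj, relPos, if_true, hne, if_false]; ring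
      rw [e1, e2]
      refine exists_pos_mul_eq ?_ ?_ ?_
      · intro h0
        have a0 : x j = 0 := by linarith
        have b0 : 1 - x i = 0 := by linarith
        rw [a0, b0]; ring
      · intro h0; linarith
      · intro h0
        rcases hj0.lt_or_eq with h | h
        · have := mul_pos h hp; have := mul_nonneg (sub_nonneg.mpr hi1) hm.le; linarith
        · have : 0 < 1 - x i := by linarith
          have := mul_pos this hm; rw [← h]; linarith
    · refine ⟨_, hm, ?_⟩
      simp only [hA, hi, hj, relPos, hne, if_false, pl, sub_add_cancel]; ring
  obtain ⟨k0, h0, e0⟩ := hmono 0 1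
  obtain ⟨k1, h1, e1⟩ := hmono 1 2
  obtain ⟨k2, h2, e2⟩ := hmono 2 3
  obtain ⟨k3, h3', e3⟩ := hmono 3 0
  have hsum : A 0 - A 1 + A 2 - A 3 = 0 := by
    simp only [hA]; linear_combination α * hX + β * hY
  -- In a parallelogram opposite sides are opposite vectors, so the cyclic product of differences is
  -- a square.
  have hprod : (A 0 - A 1) * (A 1 - A 2) * (A 2 - A 3) * (A 3 - A 0) =
      ((A 2 - A 3) * (A 3 - A 0)) ^ 2 := by
    have a : A 0 - A 1 = -(A 2 - A 3) := by linarith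
    have b : A 1 - A 2 = -(A 3 - A 0) := by linarith
    rw [a, b]; ring
  have hnn : 0 ≤ (A 0 - A 1) * (A 1 - A 2) * (A 2 - A 3) * (A 3 - A 0) := by
    rw [hprod]; positivity
  rw [e0, e1, e2, e3] at hnn
  rw [e]
  refine mul_nonneg hκ.le ?_
  have hk : 0 < k0 * k1 * k2 * k3 := by positivity
  refine nonneg_of_mul_nonneg_right (a := k0 * k1 * k2 * k3) ?_ hk
  linarith

/-- Points on distinct edges of a simple polygon agree only at a common vertex. If `x 0 = 1`, the
relevant vertex is the far end of the edge `c 0`, otherwise its near end. -/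
theorem SimpleLoop.exists_vertex_of_collapse {X Y : ZMod n → ℝ}
    (h : SimpleLoop X Y) {c : Fin 4 → ZMod n} {x : Fin 4 → ℝ} (hx : x ∈ Icc (0 : Fin 4 → ℝ) 1)
    (hX : ∀ k, pl X (c 0) (x 0) = pl X (c k) (x k))
    (hY : ∀ k, pl Y (c 0) (x 0) = pl Y (c k) (x k)) : ∃ p, ∀ k, c k = p ∨ c k = p - 1 := by
  by_cases h0 : x 0 = 1
  · refine ⟨c 0 + 1, fun k => ?_⟩
    rcases h _ _ _ ⟨hx.1 0, hx.2 0⟩ _ ⟨hx.1 k, hx.2 k⟩ (hX k) (hY k) with h | h | h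
    · right; rw [← h.1]; ring
    · left; exact h.1
    · rw [h0] at h; exact absurd h.2.1 one_ne_zero
  · refine ⟨c 0, fun k => ?_⟩
    rcases h _ _ _ ⟨hx.1 0, hx.2 0⟩ _ ⟨hx.1 k, hx.2 k⟩ (hX k) (hY k) with h | h | h
    · left; exact h.1.symm
    · exact absurd h.2.1 h0
    · right; rw [h.1]; ring

/-- A degenerate solution has all four points equal. -/
theorem collapse_of_link_eq_zero [NeZero n] {X Y : ZMod n → ℝ} {c : Fin 4 → ZMod n}
    {x : Fin 4 → ℝ} (hx : x ∈ Icc (0 : Fin 4 → ℝ) 1) (hF : cellMap (quadG X Y) c x = 0)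
    (hl : link c x = 0) : (∀ k, pl X (c 0) (x 0) = pl X (c k) (x k)) ∧
      ∀ k, pl Y (c 0) (x 0) = pl Y (c k) (x k) := by
  rw [cellMap_quadG_eq_iff] at hF
  obtain ⟨h0, h1, h2, h3⟩ := hF
  simp only [Pi.zero_apply] at h0 h1 h2 h3
  have : (pl X (c 0) (x 0) = pl X (c 1) (x 1) ∧ pl X (c 0) (x 0) = pl X (c 2) (x 2) ∧
      pl X (c 0) (x 0) = pl X (c 3) (x 3)) ∧ (pl Y (c 0) (x 0) = pl Y (c 1) (x 1) ∧
      pl Y (c 0) (x 0) = pl Y (c 2) (x 2) ∧ pl Y (c 0) (x 0) = pl Y (c 3) (x 3)) := by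
    rcases link_eq_zero_imp hx hl X Y with h | h | h | h <;> obtain ⟨ha, hb⟩ := h <;>
      refine ⟨⟨?_, ?_, ?_⟩, ?_, ?_, ?_⟩ <;> linarith
  constructor
  · intro k; fin_cases k
    exacts [rfl, this.1.1, this.1.2.1, this.1.2.2]
  · intro k; fin_cases k
    exacts [rfl, this.2.1, this.2.2.1, this.2.2.2]

/-- In a compact family of simple polygons, the linked solutions are uniformly linked. -/
theorem exists_link_lt_neg [NeZero n] (h3 : 3 ≤ n) {L : Type*} [TopologicalSpace L]
    [CompactSpace L] {X Y : L → ZMod n → ℝ} (hX : ∀ i, Continuous fun l => X l i)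
    (hY : ∀ i, Continuous fun l => Y l i) (hs : ∀ l, SimpleLoop (X l) (Y l)) :
    ∃ δ₀ > 0, ∀ δ ∈ Ioc (0 : ℝ) δ₀, ∀ l c, ∀ x ∈ Icc (0 : Fin 4 → ℝ) 1,
      cellMap (quadG (X l) (Y l)) c x = 0 → link c x < 0 → link c x < -δ := by
  have key : ∀ᶠ δ in 𝓝 (0 : ℝ), ∀ c, ∀ p ∈ (univ : Set L) ×ˢ Icc (0 : Fin 4 → ℝ) 1,
      ¬ (cellMap (quadG (X p.1) (Y p.1)) c p.2 = 0 ∧ link c p.2 < 0 ∧ -δ ≤ link c p.2) := by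
    rw [eventually_all]
    intro c
    -- Cells whose edges meet at one vertex contain no linked solutions at all. In all others `link`
    -- does not vanish at solutions, and compactness keeps it away from zero.
    by_cases hc : ∃ p, ∀ k, c k = p ∨ c k = p - 1
    · obtain ⟨p, hp⟩ := hc
      filter_upwards with δ
      rintro ⟨l, x⟩ ⟨-, hx⟩ ⟨hF, hneg, -⟩
      obtain ⟨-, -, h2, h3'⟩ := (cellMap_quadG_eq_iff _ _ _ _ _).mp hF
      exact absurd ((hs l).link_nonneg_of_wedge h3 hp hx h2 h3') (not_le.mpr hneg)
    · refine (isCompact_univ.prod isCompact_Icc).eventually_forall_of_forall_eventually ?_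
      rintro ⟨l, x⟩ ⟨-, hx⟩
      have hcl : Continuous fun q : ℝ × (L × (Fin 4 → ℝ)) => link c q.2.2 :=
        (continuous_link c).comp (by fun_prop)
      rcases lt_trichotomy (link c x) 0 with hl | hl | hl
      · have hcl' : Continuous fun q : ℝ × (L × (Fin 4 → ℝ)) => link c q.2.2 + q.1 :=
          hcl.add continuous_fst
        have := (hcl'.continuousAt (x := (0, (l, x)))).eventually
          (gt_mem_nhds (show link c x + 0 < 0 by linarith))
        filter_upwards [this] with q hq h
        linarith [h.2.2]
      · have hF : cellMap (quadG (X l) (Y l)) c x ≠ 0 := by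
          intro hF
          obtain ⟨e1, e2⟩ := collapse_of_link_eq_zero hx hF hl
          exact hc ((hs l).exists_vertex_of_collapse hx e1 e2)
        have hcF : Continuous fun q : ℝ × (L × (Fin 4 → ℝ)) =>
            cellMap (quadG (X q.2.1) (Y q.2.1)) c q.2.2 :=
          (continuous_cellMap (fun r k i => continuous_quadG hX hY r k i) c).comp continuous_snd
        have := (hcF.continuousAt (x := (0, (l, x)))).eventually_ne hF
        filter_upwards [this] with q hq h
        exact hq h.1
      · have := (hcl.continuousAt (x := (0, (l, x)))).eventually (lt_mem_nhds hl)
        filter_upwards [this] with q hq h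
        linarith [h.2.1]
  obtain ⟨ε, hε, hball⟩ := Metric.eventually_nhds_iff_ball.mp key
  refine ⟨ε / 2, by positivity, ?_⟩
  intro δ hδ l c x hx hF hneg
  by_contra! hge
  refine hball δ ?_ c (l, x) ⟨mem_univ _, hx⟩ ⟨hF, hneg, hge⟩
  rw [Metric.mem_ball, Real.dist_eq, sub_zero, abs_of_pos hδ.1]
  linarith [hδ.2]

end Wedge

/-! ### Rotation by a quarter turn: without squares the parity is zero -/

section Rotation

variable {n : ℕ}

theorem pl_linear (α β : ℝ) (X Y : ZMod n → ℝ) (i : ZMod n) (t : ℝ) :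
    pl (fun i => α * X i + β * Y i) i t = α * pl X i t + β * pl Y i t := by
  unfold pl; ring

theorem SimpleLoop.linear {X Y : ZMod n → ℝ} (h : SimpleLoop X Y) {α β γ ε : ℝ}
    (hdet : α * ε - β * γ ≠ 0) :
    SimpleLoop (fun i => α * X i + β * Y i) (fun i => γ * X i + ε * Y i) := by
  intro i j s hs t ht hX hY
  rw [pl_linear, pl_linear] at hX hY
  refine h i j s hs t ht ?_ ?_
  · refine mul_left_cancel₀ hdet ?_
    linear_combination ε * hX - β * hY
  · refine mul_left_cancel₀ hdet ?_
    linear_combination α * hY - γ * hX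

/-- This function is positive if the diagonals `ac` and `bd` are linked, with a margin `δ`, and
point to the right and up, respectively. -/
noncomputable def psi (δ : ℝ) (X Y : ZMod n → ℝ) (c : Fin 4 → ZMod n) (x : Fin 4 → ℝ) : ℝ :=
  min (min (-link c x - δ) (pl X (c 2) (x 2) - pl X (c 0) (x 0)))
    (pl Y (c 3) (x 3) - pl Y (c 1) (x 1))

theorem psi_pos_iff {δ : ℝ} {X Y : ZMod n → ℝ} {c : Fin 4 → ZMod n} {x : Fin 4 → ℝ} :
    0 < psi δ X Y c x ↔ link c x < -δ ∧ pl X (c 0) (x 0) < pl X (c 2) (x 2) ∧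
      pl Y (c 1) (x 1) < pl Y (c 3) (x 3) := by
  unfold psi
  rw [lt_min_iff, lt_min_iff, and_assoc]
  constructor
  · rintro ⟨h1, h2, h3⟩
    exact ⟨by linarith, by linarith, by linarith⟩
  · rintro ⟨h1, h2, h3⟩
    exact ⟨by linarith, by linarith, by linarith⟩

theorem glued_pl (g : ZMod n → ℝ) (j : Fin 4) :
    Glued fun (c : Fin 4 → ZMod n) x => pl g (c j) (x j) := by
  intro c x k hk
  by_cases h : j = k
  · subst h; simp [hk, pl]
  · simp [h]

theorem glued_psi [NeZero n] (δ : ℝ) (X Y : ZMod n → ℝ) : Glued (psi δ X Y) := by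
  intro c x k hk
  have h1 := glued_link c x k hk
  have h2 := glued_pl X 2 c x k hk
  have h3 := glued_pl X 0 c x k hk
  have h4 := glued_pl Y 3 c x k hk
  have h5 := glued_pl Y 1 c x k hk
  beta_reduce at h2 h3 h4 h5
  rw [psi, psi, h1, h2, h3, h4, h5]

theorem continuous_pl {L : Type*} [TopologicalSpace L] {X : L → ZMod n → ℝ}
    (hX : ∀ i, Continuous fun l => X l i) (c : Fin 4 → ZMod n) (k : Fin 4) :
    Continuous fun p : L × (Fin 4 → ℝ) => pl (X p.1) (c k) (p.2 k) := by
  have h := fun i => (hX i).comp (continuous_fst : Continuous (Prod.fst : L × (Fin 4 → ℝ) → L))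
  simp only [Function.comp_def] at h
  have := h (c k); have := h (c k + 1)
  unfold pl; fun_prop

theorem continuous_psi {L : Type*} [TopologicalSpace L] (δ : ℝ) {X Y : L → ZMod n → ℝ}
    (hX : ∀ i, Continuous fun l => X l i) (hY : ∀ i, Continuous fun l => Y l i)
    (c : Fin 4 → ZMod n) :
    Continuous fun p : L × (Fin 4 → ℝ) => psi δ (X p.1) (Y p.1) c p.2 := by
  have h1 := (continuous_link c).comp (continuous_snd : Continuous (Prod.snd : L × _ → _))
  exact (((h1.neg.sub continuous_const).min ((continuous_pl hX c 2).sub (continuous_pl hX c 0)))).min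
    ((continuous_pl hY c 3).sub (continuous_pl hY c 1))

theorem SimpleLoop.lt_of_link_neg [NeZero n] {X Y : ZMod n → ℝ} (h : SimpleLoop X Y)
    {c : Fin 4 → ZMod n} {x : Fin 4 → ℝ} (hx : x ∈ Icc (0 : Fin 4 → ℝ) 1) (hl : link c x < 0) :
    ¬ (pl X (c 2) (x 2) = pl X (c 0) (x 0) ∧ pl Y (c 2) (x 2) = pl Y (c 0) (x 0)) ∧
    ¬ (pl X (c 3) (x 3) = pl X (c 1) (x 1) ∧ pl Y (c 3) (x 3) = pl Y (c 1) (x 1)) :=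
  ⟨fun ⟨h1, h2⟩ => hl.not_ge (link_nonneg_of_eq
      (h.val_add_eq ⟨hx.1 2, hx.2 2⟩ ⟨hx.1 0, hx.2 0⟩ h1 h2)),
    fun ⟨h1, h2⟩ => hl.not_ge (link_nonneg_of_eq'
      (h.val_add_eq ⟨hx.1 3, hx.2 3⟩ ⟨hx.1 1, hx.2 1⟩ h1 h2))⟩

/-- The margin excludes `link = -δ`. As `ac` is horizontal and `bd` vertical, a vanishing second or
third term of `psi` would mean `a = c` or `b = d`, which contradicts linking. -/
theorem SimpleLoop.psi_ne_zero [NeZero n] {X Y : ZMod n → ℝ} (h : SimpleLoop X Y) {δ : ℝ}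
    (hδ : 0 < δ) {c : Fin 4 → ZMod n} {x : Fin 4 → ℝ} (hx : x ∈ Icc (0 : Fin 4 → ℝ) 1)
    (hF : cellMap (quadG X Y) c x = 0) (hl : link c x < 0 → link c x < -δ) :
    psi δ X Y c x ≠ 0 := by
  intro h0
  obtain ⟨e0, e1, -, -⟩ := (cellMap_quadG_eq_iff _ _ _ _ _).mp hF
  simp only [Pi.zero_apply] at e0 e1
  unfold psi at h0
  have h1 : 0 ≤ min (-link c x - δ) (pl X (c 2) (x 2) - pl X (c 0) (x 0)) := h0 ▸ min_le_left _ _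
  have h2 : 0 ≤ -link c x - δ := h1.trans (min_le_left _ _)
  have hneg : link c x < 0 := by linarith
  obtain ⟨hac, hbd⟩ := h.lt_of_link_neg hx hneg
  rcases min_choice (min (-link c x - δ) (pl X (c 2) (x 2) - pl X (c 0) (x 0)))
    (pl Y (c 3) (x 3) - pl Y (c 1) (x 1)) with h' | h'
  · rcases min_choice (-link c x - δ) (pl X (c 2) (x 2) - pl X (c 0) (x 0)) with h'' | h''
    · have := hl hneg
      linarith
    · exact hac ⟨by linarith, by linarith⟩
  · exact hbd ⟨by linarith, by linarith⟩

/-- The difference of the lengths of the diagonals. -/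
def rho (X Y : ZMod n → ℝ) (c : Fin 4 → ZMod n) (x : Fin 4 → ℝ) : ℝ :=
  (pl X (c 2) (x 2) - pl X (c 0) (x 0)) - (pl Y (c 3) (x 3) - pl Y (c 1) (x 1))

theorem glued_rho (X Y : ZMod n → ℝ) : Glued (rho X Y) := by
  intro c x k hk
  have h2 := glued_pl X 2 c x k hk
  have h3 := glued_pl X 0 c x k hk
  have h4 := glued_pl Y 3 c x k hk
  have h5 := glued_pl Y 1 c x k hk
  beta_reduce at h2 h3 h4 h5
  rw [rho, rho, h2, h3, h4, h5]

theorem continuous_rho {L : Type*} [TopologicalSpace L] {X Y : L → ZMod n → ℝ}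
    (hX : ∀ i, Continuous fun l => X l i) (hY : ∀ i, Continuous fun l => Y l i)
    (c : Fin 4 → ZMod n) :
    Continuous fun p : L × (Fin 4 → ℝ) => rho (X p.1) (Y p.1) c p.2 :=
  ((continuous_pl hX c 2).sub (continuous_pl hX c 0)).sub
    ((continuous_pl hY c 3).sub (continuous_pl hY c 1))

/-- The change of coordinates in the target which corresponds to a quarter turn. -/
def quarterTurn : (Fin 4 → ℝ) ≃ₗ[ℝ] (Fin 4 → ℝ) where
  toFun v := ![-v 1, -v 0, v 3, -v 2]
  invFun v := ![-v 1, -v 0, -v 3, v 2]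
  map_add' u v := by ext i; fin_cases i <;> simp <;> ring
  map_smul' a v := by ext i; fin_cases i <;> simp
  left_inv v := by ext i; fin_cases i <;> simp
  right_inv v := by ext i; fin_cases i <;> simp

/-- The cyclic shift `a, b, c, d ↦ b, c, d, a` turns the equations of the rotated polygon into those
of the original one, up to a change of coordinates in the target. It keeps `link` and exchanges the
diagonals, so `rho` changes sign. -/
theorem hasParity_quarter_turn [NeZero n] {δ : ℝ} {X Y : ZMod n → ℝ} {d : ZMod 2}
    (h : HasParity (quadG Y (-X)) (fun c x => min (psi δ Y (-X) c x) (rho Y (-X) c x)) d) :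
    HasParity (quadG X Y) (fun c x => min (psi δ X Y c x) (-rho X Y c x)) d := by
  have hσ : ∀ k, Equiv.addRight (1 : Fin 4) k = k + 1 := fun _ => rfl
  refine h.relabel (Equiv.addRight (1 : Fin 4)) quarterTurn.toContinuousLinearEquiv ?_ ?_
  · intro c x
    rw [cellMap_quadG, cellMap_quadG]
    ext r
    fin_cases r <;> simp [quarterTurn, pl_neg] <;> ring
  · intro c x
    have hl : link (c ∘ Equiv.addRight (1 : Fin 4)) (x ∘ Equiv.addRight (1 : Fin 4)) = link c x := by
      simp only [link, Function.comp, hσ]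
      exact linkFn_rotate _ _ _ _
    simp only [psi, rho, hl]
    simp only [Function.comp, hσ, pl_neg]
    have e0 : (0 : Fin 4) + 1 = 1 := rfl
    have e1 : (1 : Fin 4) + 1 = 2 := rfl
    have e2 : (2 : Fin 4) + 1 = 3 := rfl
    have e3 : (3 : Fin 4) + 1 = 0 := rfl
    rw [e0, e1, e2, e3]
    congr 1
    · rw [min_right_comm]
      congr 1
      rw [sub_neg_eq_add, neg_add_eq_sub]
    · ring

theorem continuous_psi_cell (δ : ℝ) (X Y : ZMod n → ℝ) (c : Fin 4 → ZMod n) :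
    Continuous (psi δ X Y c) := by
  have h := continuous_link c
  unfold psi pl
  fun_prop

theorem continuous_rho_cell (X Y : ZMod n → ℝ) (c : Fin 4 → ZMod n) :
    Continuous (rho X Y c) := by
  unfold rho pl
  fun_prop

section Family

variable [NeZero n] {L : Type*} [TopologicalSpace L] [CompactSpace L] {X Y : L → ZMod n → ℝ}

/-- In a compact family of simple polygons, the function `psi δ` does not vanish at solutions. -/
theorem exists_psi_ne_zero (h3 : 3 ≤ n) (hX : ∀ i, Continuous fun l => X l i)
    (hY : ∀ i, Continuous fun l => Y l i) (hs : ∀ l, SimpleLoop (X l) (Y l)) :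
    ∃ δ₀ > 0, ∀ δ ∈ Ioc (0 : ℝ) δ₀, ∀ l c, ∀ x ∈ Icc (0 : Fin 4 → ℝ) 1,
      cellMap (quadG (X l) (Y l)) c x = 0 → psi δ (X l) (Y l) c x ≠ 0 := by
  obtain ⟨δ₀, hδ₀, hlink⟩ := exists_link_lt_neg h3 hX hY hs
  exact ⟨δ₀, hδ₀, fun δ hδ l c x hx hF =>
    (hs l).psi_ne_zero hδ.1 hx hF (hlink δ hδ l c x hx hF)⟩

theorem exists_hasParity_psi [PreconnectedSpace L] [Nonempty L] (h3 : 3 ≤ n)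
    (hX : ∀ i, Continuous fun l => X l i)
    (hY : ∀ i, Continuous fun l => Y l i) (hs : ∀ l, SimpleLoop (X l) (Y l)) :
    ∃ δ₀ > 0, ∀ δ ∈ Ioc (0 : ℝ) δ₀, ∃ d, ∀ l,
      HasParity (quadG (X l) (Y l)) (psi δ (X l) (Y l)) d := by
  obtain ⟨δ₀, hδ₀, hne⟩ := exists_psi_ne_zero h3 hX hY hs
  exact ⟨δ₀, hδ₀, fun δ hδ => exists_forall_hasParity (fun r k i => continuous_quadG hX hY r k i)
    (continuous_psi δ hX hY) (fun l => glued_psi δ _ _) (hne δ hδ)⟩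

/-- The hypothesis `hno` says that no square occurs in the family. Then the rhombi with `0 < rho`
can be counted separately, because `min psi rho` does not vanish at solutions. -/
theorem exists_hasParity_min [PreconnectedSpace L] [Nonempty L] (h3 : 3 ≤ n)
    (hX : ∀ i, Continuous fun l => X l i)
    (hY : ∀ i, Continuous fun l => Y l i) (hs : ∀ l, SimpleLoop (X l) (Y l))
    (hno : ∀ l c, ∀ x ∈ Icc (0 : Fin 4 → ℝ) 1, cellMap (quadG (X l) (Y l)) c x = 0 →
      pl (X l) (c 0) (x 0) < pl (X l) (c 2) (x 2) → rho (X l) (Y l) c x ≠ 0) :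
    ∃ δ₀ > 0, ∀ δ ∈ Ioc (0 : ℝ) δ₀, (∀ l c, ∀ x ∈ Icc (0 : Fin 4 → ℝ) 1,
        cellMap (quadG (X l) (Y l)) c x = 0 → 0 ≤ psi δ (X l) (Y l) c x →
          rho (X l) (Y l) c x ≠ 0) ∧
      ∃ d, ∀ l, HasParity (quadG (X l) (Y l))
        (fun c x => min (psi δ (X l) (Y l) c x) (rho (X l) (Y l) c x)) d := by
  obtain ⟨δ₀, hδ₀, hpsi⟩ := exists_psi_ne_zero h3 hX hY hs
  refine ⟨δ₀, hδ₀, fun δ hδ => ?_⟩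
  have hrho : ∀ l c, ∀ x ∈ Icc (0 : Fin 4 → ℝ) 1, cellMap (quadG (X l) (Y l)) c x = 0 →
      0 ≤ psi δ (X l) (Y l) c x → rho (X l) (Y l) c x ≠ 0 := by
    intro l c x hx hF h0
    have h0' := lt_of_le_of_ne h0 (hpsi δ hδ l c x hx hF).symm
    exact hno l c x hx hF (psi_pos_iff.mp h0').2.1
  refine ⟨hrho, exists_forall_hasParity (fun r k i => continuous_quadG hX hY r k i)
    (fun c => (continuous_psi δ hX hY c).min (continuous_rho hX hY c)) ?_ ?_⟩
  · intro l c x k hk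
    beta_reduce
    rw [glued_psi δ _ _ c x k hk, glued_rho _ _ c x k hk]
  · intro l c x hx hF h0
    rcases min_choice (psi δ (X l) (Y l) c x) (rho (X l) (Y l) c x) with h' | h'
    · exact hpsi δ hδ l c x hx hF (h'.symm.trans h0)
    · exact hrho l c x hx hF (h0 ▸ min_le_left _ _) (h'.symm.trans h0)

end Family

/-- If a simple polygon inscribes no square, then it inscribes an even number of linked rhombi with
horizontal and vertical diagonals. -/
theorem SimpleLoop.hasParity_zero [NeZero n] (h3 : 3 ≤ n) {X Y : ZMod n → ℝ} (h : SimpleLoop X Y)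
    (hno : ∀ α β : ℝ, α ^ 2 + β ^ 2 = 1 → ∀ c, ∀ x ∈ Icc (0 : Fin 4 → ℝ) 1,
      cellMap (quadG (fun i => α * X i + β * Y i) (fun i => -β * X i + α * Y i)) c x = 0 →
      pl (fun i => α * X i + β * Y i) (c 0) (x 0) < pl (fun i => α * X i + β * Y i) (c 2) (x 2) →
      rho (fun i => α * X i + β * Y i) (fun i => -β * X i + α * Y i) c x ≠ 0) :
    ∃ δ₀ > 0, ∀ δ ∈ Ioc (0 : ℝ) δ₀, HasParity (quadG X Y) (psi δ X Y) 0 := by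
  have : PreconnectedSpace (Icc (0 : ℝ) (Real.pi / 2)) :=
    Subtype.preconnectedSpace isPreconnected_Icc
  have hpi : (0 : ℝ) ≤ Real.pi / 2 := by positivity
  have : Nonempty (Icc (0 : ℝ) (Real.pi / 2)) := ⟨⟨0, le_rfl, hpi⟩⟩
  -- The family of rotated polygons, for angles in `[0, π / 2]`.
  obtain ⟨δ₀, hδ₀, hmain⟩ := exists_hasParity_min h3 (L := Icc (0 : ℝ) (Real.pi / 2))
    (X := fun l i => Real.cos l * X i + Real.sin l * Y i)
    (Y := fun l i => -Real.sin l * X i + Real.cos l * Y i) (fun i => by fun_prop)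
    (fun i => by fun_prop) (fun l => h.linear (by
      have := Real.cos_sq_add_sin_sq (l : ℝ)
      intro h0; nlinarith)) (fun l => hno _ _ (Real.cos_sq_add_sin_sq (l : ℝ)))
  refine ⟨δ₀, hδ₀, fun δ hδ => ?_⟩
  obtain ⟨hrho, d, hd⟩ := hmain δ hδ
  have hd0 := hd ⟨0, le_rfl, hpi⟩
  have hr0 := hrho ⟨0, le_rfl, hpi⟩
  have hd1 := hd ⟨Real.pi / 2, hpi, le_rfl⟩
  simp only [Real.cos_zero, Real.sin_zero, one_mul, zero_mul, neg_zero, add_zero, zero_add]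
    at hd0 hr0
  simp only [Real.cos_pi_div_two, Real.sin_pi_div_two, one_mul, zero_mul, neg_one_mul, add_zero,
    zero_add] at hd1
  have hd1' : HasParity (quadG X Y) (fun c x => min (psi δ X Y c x) (-rho X Y c x)) d :=
    hasParity_quarter_turn hd1
  -- The rhombi with longer horizontal diagonal have parity `d` at angle 0. Those with longer
  -- vertical diagonal also have parity `d`, by the quarter turn.
  rw [← zmod_two_add_self d]
  exact hd0.add (continuous_psi_cell δ X Y) (continuous_rho_cell X Y) hd1' hr0

end Rotation

/-! ### Indicator calculus modulo 2 -/

section Indicators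

theorem ind_lt_add_ind_gt {a b : ℝ} (h : a ≠ b) : ind (a < b) + ind (b < a) = 1 := by
  rcases lt_or_gt_of_ne h with h | h
  · rw [ind_true h, ind_false h.not_gt, add_zero]
  · rw [ind_true h, ind_false h.not_gt, zero_add]

/-- The number `a` lies strictly between `b` and `c`. -/
def Between (a b c : ℝ) : Prop := (b < a ∧ a < c) ∨ (c < a ∧ a < b)

theorem ind_between {a b c : ℝ} (hb : a ≠ b) (hc : a ≠ c) :
    ind (Between a b c) = ind (a < b) + ind (a < c) := by
  rcases lt_or_gt_of_ne hb with hb | hb <;> rcases lt_or_gt_of_ne hc with hc | hc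
  · rw [ind_true hb, ind_true hc, ind_false, zmod_two_add_self]
    rintro (h | h) <;> linarith [h.1, h.2]
  · rw [ind_true hb, ind_false hc.not_gt, ind_true, add_zero]
    exact Or.inr ⟨hc, hb⟩
  · rw [ind_true hc, ind_false hb.not_gt, ind_true, zero_add]
    exact Or.inl ⟨hb, hc⟩
  · rw [ind_false hc.not_gt, ind_false hb.not_gt, ind_false, add_zero]
    rintro (h | h) <;> linarith [h.1, h.2]

/-- It suffices to compare the contributions of unordered pairs: the exchange of the two indices
pairs off the differences. -/
theorem sum_sum_eq_of_symm {α : Type*} [Fintype α] [DecidableEq α] {f g : α → α → ZMod 2}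
    (hd : ∀ j, f j j = g j j)
    (hs : ∀ j l, j ≠ l → f j l + f l j = g j l + g l j) :
    ∑ j, ∑ l, f j l = ∑ j, ∑ l, g j l := by
  have : ∑ p : α × α, (f p.1 p.2 + g p.1 p.2) = 0 := by
    refine Finset.sum_ninvolution (fun p => (p.2, p.1)) ?_ ?_ (fun _ => Finset.mem_univ _)
      (fun _ => rfl)
    · rintro ⟨j, l⟩
      by_cases h : j = l
      · subst h; exact zmod_two_add_self _
      · have := hs j l h
        calc f j l + g j l + (f l j + g l j) = (f j l + f l j) + (g j l + g l j) := by ring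
          _ = 0 := by rw [this, zmod_two_add_self]
    · rintro ⟨j, l⟩ h h'
      have : l = j := congrArg Prod.fst h'
      subst this
      simp only [hd, zmod_two_add_self, ne_eq, not_true] at h
  rw [Finset.sum_add_distrib, Fintype.sum_prod_type, Fintype.sum_prod_type] at this
  exact CharTwo.add_eq_zero.mp this

end Indicators

/-! ### Steep polygons: counting edges above local extrema of the height -/

section Steep

variable {n : ℕ}

/-- A simple polygon with generic vertices, the heights of which are ordered like the opposites of
the first coordinates, and with the vertex `0` at the top. -/
structure SteepLoop (X Y : ZMod n → ℝ) : Prop where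
  simple : SimpleLoop X Y
  inj : Function.Injective Y
  anti : ∀ i j, Y i < Y j → X j < X i
  top : ∀ i, i ≠ 0 → Y i < Y 0
  mid : ∀ p k q, ∀ t ∈ Icc (0 : ℝ) 1, pl Y k t = Y p → pl X k t ≠ X p → X p + pl X k t ≠ 2 * X q

/-- Some point of the edge `j` lies vertically below some point of the edge `l`. -/
def EdgeBelow (X Y : ZMod n → ℝ) (j l : ZMod n) : Prop :=
  ∃ s ∈ Icc (0 : ℝ) 1, ∃ t ∈ Icc (0 : ℝ) 1, pl X j s = pl X l t ∧ pl Y j s < pl Y l t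

/-- The vertex `p` lies vertically below some point of the edge `l`. -/
def VertexBelow (X Y : ZMod n → ℝ) (p l : ZMod n) : Prop :=
  ∃ t ∈ Icc (0 : ℝ) 1, pl X l t = X p ∧ Y p < pl Y l t

/-- The vertex `p` is a local minimum of the height. -/
def LocalMin (Y : ZMod n → ℝ) (p : ZMod n) : Prop := Y p < Y (p - 1) ∧ Y p < Y (p + 1)

/-- The vertex `p` is a local maximum of the height. -/
def LocalMax (Y : ZMod n → ℝ) (p : ZMod n) : Prop := Y (p - 1) < Y p ∧ Y (p + 1) < Y p

theorem pl_mem_of_convex {S : Set ℝ} (hS : Convex ℝ S) {g : ZMod n → ℝ} {i : ZMod n} {t : ℝ}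
    (ht : t ∈ Icc (0 : ℝ) 1) (h0 : g i ∈ S) (h1 : g (i + 1) ∈ S) : pl g i t ∈ S := by
  have := hS h0 h1 (sub_nonneg.mpr ht.2) ht.1 (by ring)
  convert this using 1
  simp only [pl, smul_eq_mul]; ring

theorem pl_combo (g : ZMod n → ℝ) (i : ZMod n) (s s' r : ℝ) :
    pl g i ((1 - r) * s + r * s') = (1 - r) * pl g i s + r * pl g i s' := by
  unfold pl; ring

theorem combo_mem {s s' r : ℝ} (hs : s ∈ Icc (0 : ℝ) 1) (hs' : s' ∈ Icc (0 : ℝ) 1)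
    (hr : r ∈ Icc (0 : ℝ) 1) : (1 - r) * s + r * s' ∈ Icc (0 : ℝ) 1 :=
  (convex_Icc (0 : ℝ) 1) hs hs' (sub_nonneg.mpr hr.2) hr.1 (by ring)

theorem combo_eq_one {s s' r : ℝ} (hs : s ∈ Icc (0 : ℝ) 1) (hs' : s' ∈ Icc (0 : ℝ) 1)
    (hr : r ∈ Ioo (0 : ℝ) 1) (h : (1 - r) * s + r * s' = 1) : s = 1 ∧ s' = 1 := by
  have h1 : 0 ≤ (1 - r) * (1 - s) :=
    mul_nonneg (sub_nonneg.mpr hr.2.le) (sub_nonneg.mpr hs.2)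
  have h2 : 0 ≤ r * (1 - s') := mul_nonneg hr.1.le (sub_nonneg.mpr hs'.2)
  have e1 : (1 - r) * (1 - s) = 0 := by linarith
  have e2 : r * (1 - s') = 0 := by linarith
  have := (mul_eq_zero.mp e1).resolve_left (by linarith [hr.2])
  have := (mul_eq_zero.mp e2).resolve_left hr.1.ne'
  constructor <;> linarith

theorem combo_eq_zero {s s' r : ℝ} (hs : s ∈ Icc (0 : ℝ) 1) (hs' : s' ∈ Icc (0 : ℝ) 1)
    (hr : r ∈ Ioo (0 : ℝ) 1) (h : (1 - r) * s + r * s' = 0) : s = 0 ∧ s' = 0 := by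
  have h1 : 0 ≤ (1 - r) * s := mul_nonneg (sub_nonneg.mpr hr.2.le) hs.1
  have h2 : 0 ≤ r * s' := mul_nonneg hr.1.le hs'.1
  have e1 : (1 - r) * s = 0 := by linarith
  have e2 : r * s' = 0 := by linarith
  exact ⟨(mul_eq_zero.mp e1).resolve_left (by linarith [hr.2]),
    (mul_eq_zero.mp e2).resolve_left hr.1.ne'⟩

/-- The vertical gap between the edges is affine over their common interval. A change of sign
produces a common point, at the ratio `u / (u + v)`. This must be a shared vertex, which forces both
interpolated points into it, against the strict gaps. -/
theorem SimpleLoop.edgeBelow_asymm {X Y : ZMod n → ℝ} (h : SimpleLoop X Y) {j l : ZMod n}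
    (hjl : j ≠ l) (h1 : EdgeBelow X Y j l) (h2 : EdgeBelow X Y l j) : False := by
  obtain ⟨s, hs, t, ht, eX, lY⟩ := h1
  obtain ⟨t', ht', s', hs', eX', lY'⟩ := h2
  set u := pl Y l t - pl Y j s with hu
  set v := pl Y j s' - pl Y l t' with hv
  have hu0 : 0 < u := sub_pos.mpr lY
  have hv0 : 0 < v := sub_pos.mpr lY'
  have huv : u + v ≠ 0 := by positivity
  have hr : u / (u + v) ∈ Ioo (0 : ℝ) 1 :=
    ⟨by positivity, by rw [div_lt_one (by positivity)]; linarith⟩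
  set r := u / (u + v) with hrdef
  have hruv : r * (u + v) = u := div_mul_cancel₀ _ huv
  have key := h j l _ (combo_mem hs hs' ⟨hr.1.le, hr.2.le⟩) _ (combo_mem ht ht' ⟨hr.1.le, hr.2.le⟩)
    (by rw [pl_combo, pl_combo, eX, eX']) (by
      rw [pl_combo, pl_combo]
      simp only [hu, hv] at hruv
      linear_combination hruv)
  rcases key with ⟨h, -⟩ | ⟨-, h1, h0⟩ | ⟨-, h0, h1⟩
  · exact hjl h
  · obtain ⟨rfl, rfl⟩ := combo_eq_one hs hs' hr h1
    obtain ⟨rfl, rfl⟩ := combo_eq_zero ht ht' hr h0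
    linarith
  · obtain ⟨rfl, rfl⟩ := combo_eq_zero hs hs' hr h0
    obtain ⟨rfl, rfl⟩ := combo_eq_one ht ht' hr h1
    linarith

theorem VertexBelow.edgeBelow {X Y : ZMod n → ℝ} {p l : ZMod n} (h : VertexBelow X Y p l) :
    EdgeBelow X Y p l ∧ EdgeBelow X Y (p - 1) l := by
  obtain ⟨t, ht, eX, lY⟩ := h
  refine ⟨⟨0, by simp, t, ht, ?_, ?_⟩, 1, by simp, t, ht, ?_, ?_⟩
  · rw [pl_zero, eX]
  · rwa [pl_zero]
  · rw [pl_one, eX, sub_add_cancel]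
  · rwa [pl_one, sub_add_cancel]

namespace SteepLoop

variable {X Y : ZMod n → ℝ}

theorem anti_iff (h : SteepLoop X Y) {i j : ZMod n} : X j < X i ↔ Y i < Y j := by
  refine ⟨fun hX => ?_, h.anti i j⟩
  rcases lt_trichotomy (Y i) (Y j) with hY | hY | hY
  · exact hY
  · rw [h.inj hY] at hX; exact absurd hX (lt_irrefl _)
  · exact absurd (h.anti j i hY) hX.not_gt

theorem injX (h : SteepLoop X Y) : Function.Injective X := by
  intro i j hX
  by_contra hne
  rcases lt_or_gt_of_ne (fun e => hne (h.inj e)) with hY | hY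
  · exact (h.anti _ _ hY).ne' hX
  · exact (h.anti _ _ hY).ne hX

/-- A vertex over or under the interior of an edge lies strictly below or above that edge. -/
theorem vertexBelow_or (h : SteepLoop X Y) {p l : ZMod n} (hb : Between (X p) (X l) (X (l + 1))) :
    VertexBelow X Y p l ∨
      ((EdgeBelow X Y l p ∧ EdgeBelow X Y l (p - 1)) ∧ ¬ VertexBelow X Y p l) := by
  have hne : X (l + 1) - X l ≠ 0 := by
    rcases hb with hb | hb <;> intro h0 <;> linarith [hb.1, hb.2]
  have eX : pl X l ((X p - X l) / (X (l + 1) - X l)) = X p := by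
    rw [pl, div_mul_cancel₀ _ hne]; ring
  have ht : (X p - X l) / (X (l + 1) - X l) ∈ Icc (0 : ℝ) 1 := by
    rcases hb with ⟨h1, h2⟩ | ⟨h1, h2⟩
    · exact ⟨div_nonneg (by linarith) (by linarith), by
        rw [div_le_one (by linarith)]; linarith⟩
    · exact ⟨div_nonneg_of_nonpos (by linarith) (by linarith), by
        rw [div_le_one_of_neg (by linarith)]; linarith⟩
  set t := (X p - X l) / (X (l + 1) - X l) with htdef
  rcases lt_trichotomy (Y p) (pl Y l t) with hY | hY | hY
  · exact Or.inl ⟨t, ht, eX, hY⟩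
  · exfalso
    rcases h.simple p l 0 (by simp) t ht (by rw [pl_zero, eX]) (by rw [pl_zero, hY]) with
      ⟨e, -⟩ | ⟨-, e, -⟩ | ⟨e, -⟩
    · subst e; rcases hb with hb | hb <;> linarith [hb.1, hb.2]
    · exact zero_ne_one e
    · rw [← e] at hb; rcases hb with hb | hb <;> linarith [hb.1, hb.2]
  · refine Or.inr ⟨⟨⟨t, ht, 0, by simp, ?_, ?_⟩, t, ht, 1, by simp, ?_, ?_⟩, ?_⟩
    · rw [pl_zero, eX]
    · rwa [pl_zero]
    · rw [pl_one, eX, sub_add_cancel]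
    · rwa [pl_one, sub_add_cancel]
    · rintro ⟨t', ht', eX', hY'⟩
      have : t' = t := by
        rw [pl] at eX'
        rw [htdef, eq_div_iff hne]; linarith
      rw [this] at hY'
      linarith

theorem between_of_vertexBelow (h : SteepLoop X Y) {p l : ZMod n} (hv : VertexBelow X Y p l) :
    Between (X p) (X l) (X (l + 1)) := by
  obtain ⟨t, ht, eX, lY⟩ := hv
  have h0 : X p ≠ X l := by
    intro e
    have e' := h.injX e
    subst e'
    have hne : X (p + 1) - X p ≠ 0 := fun h0 => by
      have e2 := h.injX (sub_eq_zero.mp h0)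
      rw [pl, e2] at lY; simp at lY
    have : t = 0 := by
      have : t * (X (p + 1) - X p) = 0 := by rw [pl] at eX; linarith
      exact (mul_eq_zero.mp this).resolve_right hne
    rw [this, pl_zero] at lY
    exact lt_irrefl _ lY
  have h1 : X p ≠ X (l + 1) := by
    intro e
    have e' := h.injX e
    subst e'
    have hne : X (l + 1) - X l ≠ 0 := fun e => h0 (sub_eq_zero.mp e)
    have : 1 - t = 0 := by
      have : (1 - t) * (X (l + 1) - X l) = 0 := by rw [pl] at eX; linarith
      exact (mul_eq_zero.mp this).resolve_right hne
    have : t = 1 := by linarith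
    rw [this, pl_one] at lY
    exact lt_irrefl _ lY
  rcases lt_or_gt_of_ne h0 with a | a <;> rcases lt_or_gt_of_ne h1 with b | b
  · exact absurd eX (pl_mem_of_convex (convex_Ioi (X p)) ht a b).ne'
  · exact Or.inr ⟨b, a⟩
  · exact Or.inl ⟨a, b⟩
  · exact absurd eX (pl_mem_of_convex (convex_Iio (X p)) ht a b).ne

theorem add_one_ne_self (h3 : 3 ≤ n) (i : ZMod n) : i + 1 ≠ i := fun h =>
  zmod_one_ne_zero h3 (by linear_combination h)

theorem sub_one_ne_self (h3 : 3 ≤ n) (i : ZMod n) : i - 1 ≠ i := fun h =>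
  zmod_one_ne_zero h3 (by linear_combination -h)

theorem sub_one_ne_add_one (h3 : 3 ≤ n) (i : ZMod n) : i - 1 ≠ i + 1 := fun h =>
  zmod_two_ne_zero h3 (by linear_combination -h)

theorem localMin_or_localMax_iff (h3 : 3 ≤ n) (h : SteepLoop X Y) (q : ZMod n) :
    ind (LocalMin Y q ∨ LocalMax Y q) = ind (Y (q - 1) < Y q) + ind (Y q < Y (q + 1)) := by
  have h1 : Y (q - 1) ≠ Y q := h.inj.ne (sub_one_ne_self h3 q)
  have h2 : Y q ≠ Y (q + 1) := h.inj.ne (add_one_ne_self h3 q).symm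
  rcases lt_or_gt_of_ne h1 with a | a <;> rcases lt_or_gt_of_ne h2 with b | b
  · rw [ind_true a, ind_true b, ind_false, zmod_two_add_self]
    rintro (h | h)
    · exact a.not_gt h.1
    · exact b.not_gt h.2
  · rw [ind_true a, ind_false b.not_gt, ind_true (Or.inr ⟨a, b⟩), add_zero]
  · rw [ind_true b, ind_false a.not_gt, ind_true (Or.inl ⟨a, b⟩), zero_add]
  · rw [ind_false b.not_gt, ind_false a.not_gt, ind_false, add_zero]
    rintro (h | h)
    · exact b.not_gt h.2
    · exact a.not_gt h.1

theorem ind_lt_eq (h : SteepLoop X Y) {i j : ZMod n} (hij : i ≠ j) :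
    ind (X i < X j) = ind (Y i < Y j) + 1 := by
  rw [ind_congr (h.anti_iff (i := j) (j := i)), ← ind_lt_add_ind_gt (h.inj.ne hij), ← add_assoc,
    zmod_two_add_self, zero_add]

/-- The number of vertices of two consecutive edges over the interior of the other edge. -/
theorem ind_between_add_ind_between (h3 : 3 ≤ n) (h : SteepLoop X Y) (q : ZMod n) :
    ind (Between (X (q - 1)) (X q) (X (q + 1))) + ind (Between (X (q + 1)) (X (q - 1)) (X q)) =
      ind (LocalMin Y q ∨ LocalMax Y q) := by
  have n1 := sub_one_ne_self h3 q
  have n2 := add_one_ne_self h3 q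
  have n3 := sub_one_ne_add_one h3 q
  rw [ind_between (h.injX.ne n1) (h.injX.ne n3), ind_between (h.injX.ne n3.symm) (h.injX.ne n2),
    h.localMin_or_localMax_iff h3]
  have e1 := ind_lt_add_ind_gt (h.injX.ne n3)
  have e2 := ind_lt_add_ind_gt (h.inj.ne n2)
  rw [h.ind_lt_eq n1, h.ind_lt_eq n2]
  have e3 : (1 : ZMod 2) + 1 = 0 := rfl
  linear_combination e1 + e2 + 2 * e3 - zmod_two_add_self (ind (Y q < Y (q + 1)))

end SteepLoop

/-- The type of a pair of edges over a common interval, relative to the orientation and the order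
of the edges. -/
noncomputable def pairType (X Y : ZMod n → ℝ) (j l : ZMod n) : ZMod 2 :=
  ind (EdgeBelow X Y j l) * (ind (Y j < Y (j + 1)) + ind (j.val < l.val)) +
    ind (EdgeBelow X Y l j) * (ind (Y l < Y (l + 1)) + ind (l.val < j.val))

theorem pairType_comm (X Y : ZMod n → ℝ) (j l : ZMod n) : pairType X Y j l = pairType X Y l j :=
  add_comm _ _

theorem SimpleLoop.pairType_eq {X Y : ZMod n → ℝ} (h : SimpleLoop X Y) {j l : ZMod n} (hjl : j ≠ l)
    (hb : EdgeBelow X Y j l) :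
    pairType X Y j l = ind (Y j < Y (j + 1)) + ind (j.val < l.val) := by
  rw [pairType, ind_true hb, ind_false (h.edgeBelow_asymm hjl hb), one_mul, zero_mul, add_zero]

theorem val_sub_one_add_one [NeZero n] (h3 : 3 ≤ n) {p : ZMod n} (hp : p ≠ 0) :
    (p - 1).val + 1 = p.val := by
  have h1 : (1 : ZMod n).val = 1 := ZMod.val_one'' (by omega)
  have hp' : p.val ≠ 0 := (ZMod.val_ne_zero p).mpr hp
  rw [ZMod.val_sub (by omega), h1]
  omega

theorem val_zero_sub_one [NeZero n] (h3 : 3 ≤ n) : ((0 : ZMod n) - 1).val ≠ 0 := by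
  rw [ZMod.val_ne_zero]
  exact fun h => zmod_one_ne_zero h3 (by linear_combination -h)

namespace SteepLoop

variable {X Y : ZMod n → ℝ}

/-- If `p` is below `l`, so are both edges at `p`. Their order indicators cancel, since `p - 1` and
`p` lie on the same side of `l` in the order of values, and their directions add up to 1 exactly at
an extremum. If `p` is above `l`, the two terms are equal. The vertex 0, where the order wraps
around, is the leftmost one and lies over the interior of no edge. -/
theorem between_mul_pairType [NeZero n] (h3 : 3 ≤ n) (h : SteepLoop X Y) (p l : ZMod n) :
    ind (Between (X p) (X l) (X (l + 1))) * (pairType X Y p l + pairType X Y (p - 1) l) =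
      ind ((LocalMin Y p ∨ LocalMax Y p) ∧ VertexBelow X Y p l) := by
  by_cases hb : Between (X p) (X l) (X (l + 1))
  swap
  · rw [ind_false hb, zero_mul, ind_false]
    exact fun h' => hb (h.between_of_vertexBelow h'.2)
  have hpl : p ≠ l := by
    rintro rfl; rcases hb with hb | hb <;> linarith [hb.1, hb.2]
  have hpl' : p - 1 ≠ l := by
    rintro rfl; rw [sub_add_cancel] at hb; rcases hb with hb | hb <;> linarith [hb.1, hb.2]
  have hp : p ≠ 0 := by
    rintro rfl
    have hx : ∀ i : ZMod n, X 0 ≤ X i := fun i => by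
      by_cases hi : i = 0
      · rw [hi]
      · exact (h.anti _ _ (h.top i hi)).le
    rcases hb with hb | hb
    · linarith [hb.1, hx l]
    · linarith [hb.1, hx (l + 1)]
  have hval := val_sub_one_add_one h3 hp
  have hv1 : p.val ≠ l.val := fun e => hpl (ZMod.val_injective n e)
  have hv2 : (p - 1).val ≠ l.val := fun e => hpl' (ZMod.val_injective n e)
  rw [ind_true hb, one_mul]
  rcases h.vertexBelow_or hb with hv | ⟨⟨h1, h2⟩, hv⟩
  · obtain ⟨h1, h2⟩ := hv.edgeBelow
    rw [h.simple.pairType_eq hpl h1, h.simple.pairType_eq hpl' h2,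
      ind_congr (show ((LocalMin Y p ∨ LocalMax Y p) ∧ VertexBelow X Y p l) ↔
        (LocalMin Y p ∨ LocalMax Y p) from ⟨fun h => h.1, fun h => ⟨h, hv⟩⟩),
      h.localMin_or_localMax_iff h3, sub_add_cancel,
      ind_congr (show (p - 1).val < l.val ↔ p.val < l.val by omega)]
    linear_combination zmod_two_add_self (ind (p.val < l.val))
  · rw [pairType_comm, pairType_comm X Y (p - 1), h.simple.pairType_eq hpl.symm h1,
      h.simple.pairType_eq hpl'.symm h2, ind_false (P := _ ∧ VertexBelow X Y p l) (fun h => hv h.2),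
      ind_congr (show l.val < (p - 1).val ↔ l.val < p.val by omega), zmod_two_add_self]

/-- For `q ≠ 0`, whichever of the two edges at the extremum is the lower one, its type detects a
local minimum. At `q = 0` the order of the two edges is reversed by the wrap-around, and the maximum
there contributes 1. This is the source of the odd parity. -/
theorem ind_mul_pairType [NeZero n] (h3 : 3 ≤ n) (h : SteepLoop X Y) (q : ZMod n) :
    ind (LocalMin Y q ∨ LocalMax Y q) * pairType X Y (q - 1) q =
      ind (LocalMin Y q) + ind (q = 0) := by
  by_cases hq : LocalMin Y q ∨ LocalMax Y q
  swap
  · rw [ind_false hq, zero_mul, ind_false (fun h => hq (Or.inl h)), ind_false, add_zero]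
    rintro rfl
    exact hq (Or.inr ⟨h.top _ (sub_one_ne_self h3 0), h.top _ (add_one_ne_self h3 0)⟩)
  have hne := sub_one_ne_self h3 q
  have hbelow : EdgeBelow X Y (q - 1) q ∨ EdgeBelow X Y q (q - 1) := by
    have key := h.ind_between_add_ind_between h3 q
    rw [ind_true hq] at key
    by_cases hb : Between (X (q - 1)) (X q) (X (q + 1))
    · rcases h.vertexBelow_or hb with hv | hv
      · exact Or.inl hv.edgeBelow.1
      · exact Or.inr hv.1.1
    · by_cases hb' : Between (X (q + 1)) (X (q - 1)) (X q)
      · have hb'' : Between (X (q + 1)) (X (q - 1)) (X (q - 1 + 1)) := by rwa [sub_add_cancel]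
        rcases h.vertexBelow_or hb'' with hv | hv
        · right
          have := hv.edgeBelow.2
          rwa [add_sub_cancel_right] at this
        · left
          have := hv.1.2
          rwa [add_sub_cancel_right] at this
      · rw [ind_false hb, ind_false hb', add_zero] at key
        exact absurd key zero_ne_one
  rw [ind_true hq, one_mul]
  by_cases hq0 : q = 0
  · have hmin : ¬ LocalMin Y q := by
      rintro ⟨-, hm⟩
      rw [hq0] at hm
      exact hm.not_gt (h.top _ (add_one_ne_self h3 0))
    rw [ind_false hmin, ind_true hq0, zero_add]
    have hv := val_zero_sub_one h3
    rcases hbelow with hb | hb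
    · rw [h.simple.pairType_eq hne hb, hq0, sub_add_cancel,
        ind_true (h.top _ (sub_one_ne_self h3 0)), ind_false (by rw [ZMod.val_zero]; omega),
        add_zero]
    · rw [pairType_comm, h.simple.pairType_eq hne.symm hb, hq0,
        ind_false (h.top _ (add_one_ne_self h3 0)).not_gt,
        ind_true (by rw [ZMod.val_zero]; omega), zero_add]
  · have hval := val_sub_one_add_one h3 hq0
    rw [ind_false hq0, add_zero]
    have h1 : Y (q - 1) ≠ Y q := h.inj.ne hne
    rcases hbelow with hb | hb
    · rw [h.simple.pairType_eq hne hb, sub_add_cancel, ind_true (by omega : (q - 1).val < q.val)]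
      have e : ind (LocalMin Y q) = ind (Y q < Y (q - 1)) := by
        refine ind_congr ⟨fun h => h.1, fun h => hq.resolve_right fun h' => h.not_gt h'.1⟩
      rw [e, ← ind_lt_add_ind_gt h1, ← add_assoc, zmod_two_add_self, zero_add]
    · rw [pairType_comm, h.simple.pairType_eq hne.symm hb,
        ind_false (by omega : ¬ q.val < (q - 1).val), add_zero]
      exact ind_congr ⟨fun h => hq.resolve_right fun h' => h.not_gt h'.2, fun h => h.2⟩

/-- Modulo `2`, the number of edges above local extrema of the height is one more than the number
of local minima. -/
theorem sum_vertexBelow [NeZero n] (h3 : 3 ≤ n) (h : SteepLoop X Y) :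
    ∑ p, ∑ l, ind ((LocalMin Y p ∨ LocalMax Y p) ∧ VertexBelow X Y p l) =
      ∑ p, ind (LocalMin Y p) + 1 := by
  let B : ZMod n → ZMod n → ZMod 2 := fun p l => ind (Between (X p) (X l) (X (l + 1)))
  -- The sum over vertices is regrouped by edges: each edge `j` collects its two ends.
  have e1 : ∑ p, ∑ l, ind ((LocalMin Y p ∨ LocalMax Y p) ∧ VertexBelow X Y p l) =
      ∑ j, ∑ l, pairType X Y j l * (B j l + B (j + 1) l) := by
    simp only [mul_add, Finset.sum_add_distrib]
    rw [← Equiv.sum_comp (Equiv.subRight (1 : ZMod n))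
      (fun j => ∑ l, pairType X Y j l * B (j + 1) l), ← Finset.sum_add_distrib]
    refine Finset.sum_congr rfl fun p _ => ?_
    rw [← Finset.sum_add_distrib]
    refine Finset.sum_congr rfl fun l _ => ?_
    rw [← h.between_mul_pairType h3 p l, Equiv.subRight_apply, sub_add_cancel]
    simp only [B]; ring
  -- As `pairType` is symmetric, only the number of ends of either edge over the interior of the
  -- other matters. It is even for disjoint edges; for adjacent ones it is odd exactly when their
  -- common vertex is an extremum.
  have e2 : ∑ j, ∑ l, pairType X Y j l * (B j l + B (j + 1) l) =
      ∑ j, ∑ l, pairType X Y j l * ind (l = j + 1 ∧ (LocalMin Y l ∨ LocalMax Y l)) := by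
    refine sum_sum_eq_of_symm ?_ ?_
    · intro j
      have hB1 : B j j = 0 := ind_false fun hb => by
        rcases hb with hb | hb <;> linarith [hb.1, hb.2]
      have hB2 : B (j + 1) j = 0 := ind_false fun hb => by
        rcases hb with hb | hb <;> linarith [hb.1, hb.2]
      rw [hB1, hB2, ind_false (fun h' => add_one_ne_self h3 j h'.1.symm), add_zero]
    · intro j l hjl
      rw [pairType_comm X Y l j, ← mul_add, ← mul_add]
      congr 1
      have adj : ∀ q, B (q - 1) q + B q q + (B q (q - 1) + B (q + 1) (q - 1)) =
          ind (LocalMin Y q ∨ LocalMax Y q) := by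
        intro q
        have hB1 : B q q = 0 := ind_false fun hb => by
          rcases hb with hb | hb <;> linarith [hb.1, hb.2]
        have hB2 : B q (q - 1) = 0 := ind_false fun hb => by
          rw [sub_add_cancel] at hb
          rcases hb with hb | hb <;> linarith [hb.1, hb.2]
        rw [hB1, hB2, ← h.ind_between_add_ind_between h3 q]
        simp only [B, sub_add_cancel, add_zero, zero_add]
      by_cases h1 : l = j + 1
      · have h2 : ¬ (j = l + 1 ∧ (LocalMin Y j ∨ LocalMax Y j)) := by
          rintro ⟨e, -⟩
          exact zmod_two_ne_zero h3 (by linear_combination -h1 - e)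
        rw [ind_false h2, add_zero, ind_congr (show (l = j + 1 ∧ (LocalMin Y l ∨ LocalMax Y l)) ↔
          (LocalMin Y l ∨ LocalMax Y l) from ⟨fun h => h.2, fun h => ⟨h1, h⟩⟩), ← adj l]
        have : l - 1 = j := by rw [h1]; ring
        rw [this, ← h1]
      · rw [ind_false (fun h => h1 h.1), zero_add]
        by_cases h2 : j = l + 1
        · rw [ind_congr (show (j = l + 1 ∧ (LocalMin Y j ∨ LocalMax Y j)) ↔
            (LocalMin Y j ∨ LocalMax Y j) from ⟨fun h => h.2, fun h => ⟨h2, h⟩⟩), ← adj j]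
          have : j - 1 = l := by rw [h2]; ring
          rw [this, ← h2]; ring
        -- Each of the four pairs of ends of disjoint edges is compared in both directions, for a
        -- total of 4, which is zero modulo 2.
        · rw [ind_false (fun h => h2 h.1)]
          have h4 : j + 1 ≠ l + 1 := fun e => hjl (add_right_cancel e)
          simp only [B]
          rw [ind_between (h.injX.ne hjl) (h.injX.ne h2),
            ind_between (h.injX.ne (Ne.symm h1)) (h.injX.ne h4),
            ind_between (h.injX.ne hjl.symm) (h.injX.ne h1),
            ind_between (h.injX.ne (Ne.symm h2)) (h.injX.ne h4.symm)]
          have f1 := ind_lt_add_ind_gt (h.injX.ne hjl)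
          have f2 := ind_lt_add_ind_gt (h.injX.ne h2)
          have f3 := ind_lt_add_ind_gt (h.injX.ne (Ne.symm h1))
          have f4 := ind_lt_add_ind_gt (h.injX.ne h4)
          have f5 : (1 : ZMod 2) + 1 + 1 + 1 = 0 := rfl
          linear_combination f1 + f2 + f3 + f4 + f5
  have e3 : ∑ j, ∑ l, pairType X Y j l * ind (l = j + 1 ∧ (LocalMin Y l ∨ LocalMax Y l)) =
      ∑ q, ind (LocalMin Y q ∨ LocalMax Y q) * pairType X Y (q - 1) q := by
    rw [Finset.sum_comm]
    refine Finset.sum_congr rfl fun q _ => ?_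
    rw [Finset.sum_eq_single (q - 1)]
    · rw [mul_comm, ind_congr (show (q = q - 1 + 1 ∧ (LocalMin Y q ∨ LocalMax Y q)) ↔
        (LocalMin Y q ∨ LocalMax Y q) from ⟨fun h => h.2, fun h => ⟨by ring, h⟩⟩)]
    · intro j _ hj
      rw [ind_false, mul_zero]
      rintro ⟨e, -⟩
      exact hj (by rw [e]; ring)
    · simp
  have e4 : ∑ q : ZMod n, ind (q = 0) = 1 := by
    rw [Finset.sum_eq_single 0]
    · exact ind_true rfl
    · intro q _ hq; exact ind_false hq
    · simp
  rw [e1, e2, e3, Finset.sum_congr rfl fun q _ => h.ind_mul_pairType h3 q,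
    Finset.sum_add_distrib, e4]

end SteepLoop

end Steep

/-! ### The line of shifted solutions in a cell -/

section Line

/-- A version of `sum_ind_facets` for a line given by affine functions instead of base point and
direction, as `lineX` and `lineT` are. -/
theorem sum_ind_facets_affine {ι : Type*} [Fintype ι] {f : ι → ℝ → ℝ}
    (hf : ∀ i r, f i r = f i 0 + r * (f i 1 - f i 0)) (hk : ∃ i, f i 1 ≠ f i 0) {ψ : ℝ → ℝ}
    (hψ : Continuous ψ)
    (h2 : ∀ r, (∀ i, f i r ∈ Icc (0 : ℝ) 1) → 0 < ψ r → ∀ i j,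
      (f i r = 0 ∨ f i r = 1) → (f j r = 0 ∨ f j r = 1) → i = j)
    (h0 : ∀ r, (∀ i, f i r ∈ Icc (0 : ℝ) 1) → ψ r = 0 →
      ∃ i, f i 1 ≠ f i 0 ∧ (f i r = 0 ∨ f i r = 1))
    (hu : ∀ r r', (∀ i, f i r ∈ Icc (0 : ℝ) 1) → (∀ i, f i r' ∈ Icc (0 : ℝ) 1) →
      ψ r = 0 → ψ r' = 0 → r = r') :
    ∑ i, (ind (∃ r, (∀ i, f i r ∈ Icc (0 : ℝ) 1) ∧ f i r = 0 ∧ 0 < ψ r) +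
      ind (∃ r, (∀ i, f i r ∈ Icc (0 : ℝ) 1) ∧ f i r = 1 ∧ 0 < ψ r)) =
    ind ((∃ r, (∀ i, f i r ∈ Icc (0 : ℝ) 1) ∧ ψ r = 0) ∧
      ∃ r, (∀ i, f i r ∈ Icc (0 : ℝ) 1) ∧ 0 < ψ r) := by
  have e : ∀ i r, f i 0 + r * (f i 1 - f i 0) = f i r := fun i r => (hf i r).symm
  have key := sum_ind_facets (z := fun i => f i 0) (k := fun i => f i 1 - f i 0) (ψ := ψ)
    (hk.imp fun i h => sub_ne_zero.mpr h) hψ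
    (by simpa only [e] using h2) (by simpa only [e, sub_ne_zero] using h0)
    (by simpa only [e] using hu)
  simpa only [e] using key

variable {n : ℕ} (X Y : ZMod n → ℝ)

/-- The inverse slope of an edge. -/
noncomputable def invSlope (i : ZMod n) : ℝ := (X (i + 1) - X i) / (Y (i + 1) - Y i)

/-- The first coordinate of the midpoint of `ac`, if `ac` has height `r`. -/
noncomputable def lineM (c : Fin 4 → ZMod n) (r : ℝ) : ℝ :=
  (X (c 0) + invSlope X Y (c 0) * (r - Y (c 0)) + (X (c 2) + invSlope X Y (c 2) * (r - Y (c 2)))) / 2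

/-- The quadruples of points on four edges such that `ac` is horizontal of height `r` and `bd` is
vertical with the midpoint of `ac` on the same vertical line. -/
noncomputable def lineX (c : Fin 4 → ZMod n) (r : ℝ) : Fin 4 → ℝ :=
  ![(r - Y (c 0)) / (Y (c 0 + 1) - Y (c 0)), (lineM X Y c r - X (c 1)) / (X (c 1 + 1) - X (c 1)),
    (r - Y (c 2)) / (Y (c 2 + 1) - Y (c 2)), (lineM X Y c r - X (c 3)) / (X (c 3 + 1) - X (c 3))]

/-- The difference of the heights of the midpoints of `bd` and `ac`. -/
noncomputable def lineT (c : Fin 4 → ZMod n) (r : ℝ) : ℝ :=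
  (pl Y (c 1) (lineX X Y c r 1) + pl Y (c 3) (lineX X Y c r 3)) / 2 - r

/-- The target for which the midpoint of `bd` lies at distance `t` above that of `ac`. -/
def shiftTarget (t : ℝ) : Fin 4 → ℝ := ![0, 0, 0, -2 * t]

variable {X Y}

theorem lineX_affine (c : Fin 4 → ZMod n) (k : Fin 4) (r : ℝ) :
    lineX X Y c r k = lineX X Y c 0 k + r * (lineX X Y c 1 k - lineX X Y c 0 k) := by
  fin_cases k <;> simp [lineX, lineM] <;> ring

theorem lineT_affine (c : Fin 4 → ZMod n) (r : ℝ) :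
    lineT X Y c r = lineT X Y c 0 + r * (lineT X Y c 1 - lineT X Y c 0) := by
  unfold lineT pl
  rw [lineX_affine c 1 r, lineX_affine c 3 r]
  ring

theorem cellMap_eq_shiftTarget_iff {c : Fin 4 → ZMod n} {x : Fin 4 → ℝ} {t : ℝ} :
    cellMap (quadG X Y) c x = shiftTarget t ↔ pl Y (c 0) (x 0) = pl Y (c 2) (x 2) ∧
      pl X (c 1) (x 1) = pl X (c 3) (x 3) ∧
      pl X (c 0) (x 0) + pl X (c 2) (x 2) = 2 * pl X (c 1) (x 1) ∧
      pl Y (c 1) (x 1) + pl Y (c 3) (x 3) = 2 * (pl Y (c 0) (x 0) + t) := by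
  rw [cellMap_quadG_eq_iff]
  simp only [shiftTarget, Matrix.cons_val_zero, Matrix.cons_val_one, Matrix.cons_val]
  constructor
  · rintro ⟨h0, h1, h2, h3⟩
    exact ⟨by linarith, by linarith, by linarith, by linarith⟩
  · rintro ⟨h0, h1, h2, h3⟩
    exact ⟨by linarith, by linarith, by linarith, by linarith⟩

namespace SteepLoop

theorem dY_ne (h3 : 3 ≤ n) (h : SteepLoop X Y) (i : ZMod n) : Y (i + 1) - Y i ≠ 0 :=
  sub_ne_zero.mpr (h.inj.ne (add_one_ne_self h3 i))

theorem dX_ne (h3 : 3 ≤ n) (h : SteepLoop X Y) (i : ZMod n) : X (i + 1) - X i ≠ 0 :=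
  sub_ne_zero.mpr (h.injX.ne (add_one_ne_self h3 i))

theorem slope_neg (h3 : 3 ≤ n) (h : SteepLoop X Y) (i : ZMod n) : invSlope X Y i < 0 := by
  rcases lt_or_gt_of_ne (h.inj.ne (add_one_ne_self h3 i)) with hY | hY
  · exact div_neg_of_pos_of_neg (sub_pos.mpr (h.anti _ _ hY)) (sub_neg.mpr hY)
  · exact div_neg_of_neg_of_pos (sub_neg.mpr (h.anti _ _ hY)) (sub_pos.mpr hY)

theorem slope_mul (h3 : 3 ≤ n) (h : SteepLoop X Y) (i : ZMod n) :
    invSlope X Y i * (Y (i + 1) - Y i) = X (i + 1) - X i :=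
  div_mul_cancel₀ _ (h.dY_ne h3 i)

theorem pl_lineX_zero (h3 : 3 ≤ n) (h : SteepLoop X Y) (c : Fin 4 → ZMod n) (r : ℝ) :
    pl Y (c 0) (lineX X Y c r 0) = r ∧ pl Y (c 2) (lineX X Y c r 2) = r ∧
      pl X (c 1) (lineX X Y c r 1) = lineM X Y c r ∧
      pl X (c 3) (lineX X Y c r 3) = lineM X Y c r := by
  simp only [lineX, pl, Matrix.cons_val_zero, Matrix.cons_val_one, Matrix.cons_val]
  rw [div_mul_cancel₀ _ (h.dY_ne h3 _), div_mul_cancel₀ _ (h.dY_ne h3 _),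
    div_mul_cancel₀ _ (h.dX_ne h3 _), div_mul_cancel₀ _ (h.dX_ne h3 _)]
  exact ⟨by ring, by ring, by ring, by ring⟩

theorem pl_X_eq (h3 : 3 ≤ n) (h : SteepLoop X Y) (i : ZMod n) (t : ℝ) :
    pl X i t = X i + invSlope X Y i * (pl Y i t - Y i) := by
  unfold pl
  linear_combination -t * h.slope_mul h3 i

theorem pl_Y_injective (h3 : 3 ≤ n) (h : SteepLoop X Y) (i : ZMod n) :
    Function.Injective (pl Y i) := by
  intro s t hst
  unfold pl at hst
  exact mul_right_cancel₀ (h.dY_ne h3 i) (add_left_cancel hst)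

theorem pl_X_injective (h3 : 3 ≤ n) (h : SteepLoop X Y) (i : ZMod n) :
    Function.Injective (pl X i) := by
  intro s t hst
  unfold pl at hst
  exact mul_right_cancel₀ (h.dX_ne h3 i) (add_left_cancel hst)

/-- The height `r` of `ac` determines `a` and `c` on their edges, hence the vertical line through
their midpoint, hence `b` and `d`. The last equation then only defines `t`. -/
theorem cellMap_eq_iff_exists (h3 : 3 ≤ n) (h : SteepLoop X Y) {c : Fin 4 → ZMod n} {x : Fin 4 → ℝ}
    {t : ℝ} : cellMap (quadG X Y) c x = shiftTarget t ↔
      ∃ r, x = lineX X Y c r ∧ t = lineT X Y c r := by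
  rw [cellMap_eq_shiftTarget_iff]
  constructor
  · rintro ⟨e0, e1, e2, e3⟩
    refine ⟨pl Y (c 0) (x 0), ?_⟩
    obtain ⟨l0, l2, l1, l3⟩ := h.pl_lineX_zero h3 c (pl Y (c 0) (x 0))
    have hM : lineM X Y c (pl Y (c 0) (x 0)) = pl X (c 1) (x 1) := by
      have a := h.pl_X_eq h3 (c 0) (x 0)
      have b := h.pl_X_eq h3 (c 2) (x 2)
      rw [← e0] at b
      unfold lineM
      linarith
    have hx : x = lineX X Y c (pl Y (c 0) (x 0)) := by
      ext k
      fin_cases k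
      · exact h.pl_Y_injective h3 _ l0.symm
      · exact h.pl_X_injective h3 _ (l1.trans hM).symm
      · exact h.pl_Y_injective h3 _ (l2.trans e0).symm
      · exact h.pl_X_injective h3 _ (l3.trans (hM.trans e1)).symm
    refine ⟨hx, ?_⟩
    rw [lineT, ← hx]
    linarith
  · rintro ⟨r, rfl, rfl⟩
    obtain ⟨l0, l2, l1, l3⟩ := h.pl_lineX_zero h3 c r
    have a := h.pl_X_eq h3 (c 0) (lineX X Y c r 0)
    have b := h.pl_X_eq h3 (c 2) (lineX X Y c r 2)
    rw [l0] at a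
    rw [l2] at b
    refine ⟨l0.trans l2.symm, l1.trans l3.symm, ?_, ?_⟩
    · rw [l1, a, b, lineM]; ring
    · rw [l0, lineT]; ring

/-- All inverse slopes are negative, so the midpoint of `ac` moves strictly with the height. Hence
all four points move along the line. -/
theorem lineX_ne (h3 : 3 ≤ n) (h : SteepLoop X Y) (c : Fin 4 → ZMod n) (k : Fin 4) :
    lineX X Y c 1 k ≠ lineX X Y c 0 k := by
  have hm : lineM X Y c 1 ≠ lineM X Y c 0 := by
    unfold lineM
    intro e
    linarith [h.slope_neg h3 (c 0), h.slope_neg h3 (c 2)]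
  obtain ⟨l0, l2, l1, l3⟩ := h.pl_lineX_zero h3 c 0
  obtain ⟨m0, m2, m1, m3⟩ := h.pl_lineX_zero h3 c 1
  intro e
  fin_cases k <;> simp only [Fin.zero_eta, Fin.mk_one, Fin.reduceFinMk] at e
  · rw [e, l0] at m0; exact zero_ne_one m0
  · rw [e, l1] at m1; exact hm m1.symm
  · rw [e, l2] at m2; exact zero_ne_one m2
  · rw [e, l3] at m3; exact hm m3.symm

theorem continuous_lineX (c : Fin 4 → ZMod n) : Continuous (lineX X Y c) := by
  refine continuous_pi fun k => ?_
  have : (fun r => lineX X Y c r k) = fun r => lineX X Y c 0 k +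
      r * (lineX X Y c 1 k - lineX X Y c 0 k) := funext (lineX_affine c k)
  rw [this]
  fun_prop

theorem continuous_lineT (c : Fin 4 → ZMod n) : Continuous (lineT X Y c) := by
  have : lineT X Y c = fun r => lineT X Y c 0 + r * (lineT X Y c 1 - lineT X Y c 0) :=
    funext (lineT_affine c)
  rw [this]
  fun_prop

/-- For almost all `t`, the solutions are interior and transversal. -/
theorem eventually_generic [NeZero n] (h3 : 3 ≤ n) (h : SteepLoop X Y) :
    ∀ᶠ w in 𝓝[>] (0 : ℝ), ∀ c, ∀ x ∈ Icc (0 : Fin 4 → ℝ) 1,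
      cellMap (quadG X Y) c x = shiftTarget w →
        (∀ k, 0 < x k ∧ x k < 1) ∧ (cellMatrix (quadG X Y) c).det ≠ 0 := by
  have hne : ∀ v : ℝ, ∀ᶠ w in 𝓝[>] (0 : ℝ), w ≠ v := by
    intro v
    rcases le_or_gt v 0 with hv | hv
    · filter_upwards [self_mem_nhdsWithin] with w hw
      exact (hv.trans_lt hw).ne'
    · filter_upwards [nhdsWithin_le_nhds (gt_mem_nhds hv)] with w hw
      exact hw.ne
  rw [eventually_all]
  intro c
  -- The parameters at which the coordinate `k` is 0 or 1. Their values of `lineT` are avoided, and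
  -- also `lineT X Y c 0`, the only possible target where `lineT` is constant.
  let r₀ : Fin 4 → ℝ := fun k => -lineX X Y c 0 k / (lineX X Y c 1 k - lineX X Y c 0 k)
  let r₁ : Fin 4 → ℝ := fun k => (1 - lineX X Y c 0 k) / (lineX X Y c 1 k - lineX X Y c 0 k)
  have e0 := eventually_all.mpr fun k => hne (lineT X Y c (r₀ k))
  have e1 := eventually_all.mpr fun k => hne (lineT X Y c (r₁ k))
  filter_upwards [e0, e1, hne (lineT X Y c 0)] with w h0 h1 h2 x hx hF
  obtain ⟨r, rfl, hw⟩ := (h.cellMap_eq_iff_exists h3).mp hF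
  refine ⟨fun k => ⟨lt_of_le_of_ne (hx.1 k) fun e => h0 k ?_,
    lt_of_le_of_ne (hx.2 k) fun e => h1 k ?_⟩, ?_⟩
  · have : r = r₀ k := by
      rw [eq_div_iff (sub_ne_zero.mpr (h.lineX_ne h3 c k))]
      rw [lineX_affine] at e; change 0 = _ at e; linarith
    rw [hw, this]
  · have : r = r₁ k := by
      rw [eq_div_iff (sub_ne_zero.mpr (h.lineX_ne h3 c k))]
      rw [lineX_affine] at e; change _ = 1 at e; linarith
    rw [hw, this]
  · have hτ : lineT X Y c 1 - lineT X Y c 0 ≠ 0 := by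
      intro e
      rw [lineT_affine, e, mul_zero, add_zero] at hw
      exact h2 hw
    rw [det_cellMatrix_ne_zero_iff]
    intro u v huv
    rw [cellMap_eq, cellMap_eq _ _ v] at huv
    have hker := add_left_cancel huv
    -- A kernel vector, added to a point of the line, stays on the line without changing `t`. Since
    -- `lineT` is not constant, the vector is zero.
    have hline : cellMap (quadG X Y) c (lineX X Y c 0 + (u - v)) =
        shiftTarget (lineT X Y c 0) := by
      rw [cellMap_eq, Matrix.mulVec_add, Matrix.mulVec_sub, hker, sub_self, add_zero, ← cellMap_eq,
        h.cellMap_eq_iff_exists h3]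
      exact ⟨0, rfl, rfl⟩
    obtain ⟨r', hr1, hr2⟩ := (h.cellMap_eq_iff_exists h3).mp hline
    rw [lineT_affine c r'] at hr2
    have : r' * (lineT X Y c 1 - lineT X Y c 0) = 0 := by linarith
    rw [(mul_eq_zero.mp this).resolve_right hτ, add_eq_left] at hr1
    exact sub_eq_zero.mp hr1

end SteepLoop

end Line

/-! ### Arcs of linked solutions and their ends -/

section Facets

variable {n : ℕ} {X Y : ZMod n → ℝ}

theorem exists_vertex_of_boundary (i : ZMod n) {t : ℝ} (ht : t = 0 ∨ t = 1) :
    ∃ p, ∀ g : ZMod n → ℝ, pl g i t = g p := by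
  rcases ht with rfl | rfl
  · exact ⟨i, fun g => pl_zero g i⟩
  · exact ⟨i + 1, fun g => pl_one g i⟩

/-- The targets with `t ≥ w`. -/
def shiftRay (w : ℝ) : Set (Fin 4 → ℝ) := {y | ∃ t ≥ w, y = shiftTarget t}

namespace SteepLoop

/-- If `a, c` were both vertices, their equal heights would make them coincide, and equal first
coordinates do the same for `b, d`. One vertex from each pair is excluded by the field `mid`. -/
theorem boundary_unique (h : SteepLoop X Y) {c : Fin 4 → ZMod n} {x : Fin 4 → ℝ}
    (hx : x ∈ Icc (0 : Fin 4 → ℝ) 1) {t : ℝ} (hF : cellMap (quadG X Y) c x = shiftTarget t)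
    (hψ : 0 < psi 0 X Y c x) {i j : Fin 4} (hi : x i = 0 ∨ x i = 1) (hj : x j = 0 ∨ x j = 1) :
    i = j := by
  obtain ⟨e0, e1, e2, -⟩ := cellMap_eq_shiftTarget_iff.mp hF
  obtain ⟨-, hac, hbd⟩ := psi_pos_iff.mp hψ
  have h02 : ¬ ((x 0 = 0 ∨ x 0 = 1) ∧ (x 2 = 0 ∨ x 2 = 1)) := by
    rintro ⟨ha, hc⟩
    obtain ⟨p, hp⟩ := exists_vertex_of_boundary (c 0) ha
    obtain ⟨q, hq⟩ := exists_vertex_of_boundary (c 2) hc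
    rw [hp, hq] at e0 hac
    rw [h.inj e0] at hac
    exact lt_irrefl _ hac
  have h13 : ¬ ((x 1 = 0 ∨ x 1 = 1) ∧ (x 3 = 0 ∨ x 3 = 1)) := by
    rintro ⟨hb, hd⟩
    obtain ⟨p, hp⟩ := exists_vertex_of_boundary (c 1) hb
    obtain ⟨q, hq⟩ := exists_vertex_of_boundary (c 3) hd
    rw [hp, hq] at e1 hbd
    rw [h.injX e1] at hbd
    exact lt_irrefl _ hbd
  have hmix : ¬ ((x 0 = 0 ∨ x 0 = 1) ∨ (x 2 = 0 ∨ x 2 = 1)) ∨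
      ¬ ((x 1 = 0 ∨ x 1 = 1) ∨ (x 3 = 0 ∨ x 3 = 1)) := by
    by_contra! hcon
    obtain ⟨hac', hbd'⟩ := hcon
    have hq : ∃ q, pl X (c 1) (x 1) = X q := by
      rcases hbd' with hb | hd
      · obtain ⟨q, hq⟩ := exists_vertex_of_boundary (c 1) hb
        exact ⟨q, hq X⟩
      · obtain ⟨q, hq⟩ := exists_vertex_of_boundary (c 3) hd
        exact ⟨q, e1.trans (hq X)⟩
    obtain ⟨q, hq⟩ := hq
    rcases hac' with ha | hc
    · obtain ⟨p, hp⟩ := exists_vertex_of_boundary (c 0) ha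
      rw [hp] at e0 e2 hac
      exact h.mid p (c 2) q (x 2) ⟨hx.1 2, hx.2 2⟩ e0.symm hac.ne' (by rw [e2, hq])
    · obtain ⟨p, hp⟩ := exists_vertex_of_boundary (c 2) hc
      rw [hp] at e0 e2 hac
      exact h.mid p (c 0) q (x 0) ⟨hx.1 0, hx.2 0⟩ e0 hac.ne (by rw [add_comm, e2, hq])
  fin_cases i <;> fin_cases j <;> first | rfl | (exfalso; simp at hi hj; tauto)

/-- The solutions on the boundary of the region of linked quadruples are triple points. -/
theorem exists_vertex_of_psi_eq_zero [NeZero n] (h : SteepLoop X Y)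
    {c : Fin 4 → ZMod n} {x : Fin 4 → ℝ} (hx : x ∈ Icc (0 : Fin 4 → ℝ) 1) {t : ℝ} (ht : 0 < t)
    (hF : cellMap (quadG X Y) c x = shiftTarget t) (hψ : psi 0 X Y c x = 0) (h02 : c 0 ≠ c 2) :
    ∃ p, ((c 0 = p ∧ c 2 = p - 1) ∨ (c 0 = p - 1 ∧ c 2 = p)) ∧ (c 1 = p ∨ c 1 = p - 1) ∧
      VertexBelow X Y p (c 3) ∧ pl Y (c 0) (x 0) = Y p ∧ (x 0 = 0 ∨ x 0 = 1) := by
  obtain ⟨e0, e1, e2, e3⟩ := cellMap_eq_shiftTarget_iff.mp hF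
  have hmem : ∀ k, x k ∈ Icc (0 : ℝ) 1 := fun k => ⟨hx.1 k, hx.2 k⟩
  unfold psi at hψ
  have h1 : 0 ≤ min (-link c x - 0) (pl X (c 2) (x 2) - pl X (c 0) (x 0)) :=
    hψ.ge.trans (min_le_left _ _)
  have hl : link c x ≤ 0 := by linarith [h1.trans (min_le_left _ _)]
  have hbd : pl Y (c 1) (x 1) ≤ pl Y (c 3) (x 3) := 
    sub_nonneg.mp (hψ.ge.trans (min_le_right _ _))
  have hl0 : pl X (c 2) (x 2) = pl X (c 0) (x 0) ∨ pl Y (c 3) (x 3) = pl Y (c 1) (x 1) ∨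
      link c x = 0 := by
    rcases min_choice (min (-link c x - 0) (pl X (c 2) (x 2) - pl X (c 0) (x 0)))
      (pl Y (c 3) (x 3) - pl Y (c 1) (x 1)) with h' | h'
    · rcases min_choice (-link c x - 0) (pl X (c 2) (x 2) - pl X (c 0) (x 0)) with h'' | h''
      · right; right; linarith
      · left; linarith
    · right; left; linarith
  -- If one of the other terms of `psi` vanishes, then `a = c` or `b = d`, which makes `link`
  -- nonnegative and hence zero.
  have hlink : link c x = 0 := by
    rcases hl0 with h' | h' | h'
    · exact le_antisymm hl (link_nonneg_of_eq (h.simple.val_add_eq (hmem 2) (hmem 0) h' e0.symm))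
    · exact le_antisymm hl
        (link_nonneg_of_eq' (h.simple.val_add_eq (hmem 3) (hmem 1) e1.symm h'))
    · exact h'
  have hX : pl X (c 0) (x 0) = pl X (c 2) (x 2) := by
    rcases link_eq_zero_imp hx hlink X Y with h' | h' | h' | h' <;> linarith [h'.1]
  -- If `d` were equal to `a` or `c`, the point `b` would lie `2 * t` above `d`, contrary to `hbd`.
  -- So `b` coincides with `a` or `c`, and the midpoint condition gives `a = b = c`.
  have hb : pl Y (c 1) (x 1) = pl Y (c 0) (x 0) := by
    rcases link_eq_zero_imp hx hlink X Y with h' | h' | h' | h' <;> linarith [h'.2]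
  have hbX : pl X (c 1) (x 1) = pl X (c 0) (x 0) := by linarith
  have key : ∃ p, ((c 0 = p ∧ c 2 = p - 1) ∨ (c 0 = p - 1 ∧ c 2 = p)) ∧
      (∀ g : ZMod n → ℝ, pl g (c 0) (x 0) = g p) ∧ (x 0 = 0 ∨ x 0 = 1) := by
    rcases h.simple _ _ _ (hmem 0) _ (hmem 2) hX e0 with ⟨e, -⟩ | ⟨e, a, -⟩ | ⟨e, a, -⟩
    · exact absurd e h02
    · refine ⟨c 2, Or.inr ⟨by rw [e]; ring, rfl⟩, fun g => ?_, Or.inr a⟩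
      rw [a, pl_one, e]
    · refine ⟨c 0, Or.inl ⟨rfl, by rw [e]; ring⟩, fun g => ?_, Or.inl a⟩
      rw [a, pl_zero]
  obtain ⟨p, hp, hg, hx0⟩ := key
  rw [hg] at hb hbX
  refine ⟨p, hp, ?_, ⟨x 3, hmem 3, ?_, ?_⟩, hg Y, hx0⟩
  · rcases h.simple p (c 1) 0 (by simp) _ (hmem 1) (by rw [pl_zero, hbX])
      (by rw [pl_zero, hb]) with ⟨e, -⟩ | ⟨-, e, -⟩ | ⟨e, -⟩
    · exact Or.inl e.symm
    · exact absurd e zero_ne_one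
    · right; rw [e]; ring
  · rw [← e1, hbX]
  · rw [hg] at e3; linarith

theorem pl_abs_le [NeZero n] (Y : ZMod n → ℝ) (i : ZMod n) {t : ℝ} (ht : t ∈ Icc (0 : ℝ) 1) :
    pl Y i t ∈ Icc (-∑ j, |Y j|) (∑ j, |Y j|) := by
  have hY : ∀ i, Y i ∈ Icc (-∑ j, |Y j|) (∑ j, |Y j|) := fun i => by
    have := Finset.single_le_sum (f := fun j => |Y j|) (fun _ _ => abs_nonneg _)
      (Finset.mem_univ i)
    exact abs_le.mp this
  exact pl_mem_of_convex (convex_Icc _ _) ht (hY i) (hY (i + 1))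

/-- The part of the solution line in the cell with `w ≤ t` meets an odd number of facets exactly
when one end has `psi = 0` and the other `0 < psi`. The facet `t = w` carries the solutions to be
counted. If `c 0 = c 2`, then `a = c` and both sides vanish. -/
theorem sum_facets_cell [NeZero n] (h3 : 3 ≤ n) (h : SteepLoop X Y) {w : ℝ} (hw : 0 < w)
    (c : Fin 4 → ZMod n)
    (hgen : ∀ x ∈ Icc (0 : Fin 4 → ℝ) 1, cellMap (quadG X Y) c x = shiftTarget w →
      ∀ k, 0 < x k ∧ x k < 1) :
    ∑ k, (ind (∃ x ∈ Icc (0 : Fin 4 → ℝ) 1, x k = 0 ∧ cellMap (quadG X Y) c x ∈ shiftRay w ∧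
          0 < psi 0 X Y c x) +
        ind (∃ x ∈ Icc (0 : Fin 4 → ℝ) 1, x k = 1 ∧ cellMap (quadG X Y) c x ∈ shiftRay w ∧
          0 < psi 0 X Y c x)) +
      ind (∃ x ∈ Icc (0 : Fin 4 → ℝ) 1, cellMap (quadG X Y) c x = shiftTarget w ∧
        0 < psi 0 X Y c x) =
    ind ((∃ x ∈ Icc (0 : Fin 4 → ℝ) 1, cellMap (quadG X Y) c x ∈ shiftRay w ∧
        psi 0 X Y c x = 0) ∧
      ∃ x ∈ Icc (0 : Fin 4 → ℝ) 1, cellMap (quadG X Y) c x ∈ shiftRay w ∧ 0 < psi 0 X Y c x) := by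
  by_cases h02 : c 0 = c 2
  · have hno : ∀ x t, cellMap (quadG X Y) c x = shiftTarget t → ¬ 0 < psi 0 X Y c x := by
      intro x t hF hψ
      obtain ⟨e0, -⟩ := cellMap_eq_shiftTarget_iff.mp hF
      obtain ⟨-, hac, -⟩ := psi_pos_iff.mp hψ
      rw [h02] at e0 hac
      rw [h.pl_Y_injective h3 _ e0] at hac
      exact lt_irrefl _ hac
    rw [ind_false, ind_false, add_zero]
    · refine Finset.sum_eq_zero fun k _ => ?_
      rw [ind_false, ind_false, add_zero]
      · rintro ⟨x, -, -, ⟨t, -, hF⟩, hψ⟩; exact hno x t hF hψ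
      · rintro ⟨x, -, -, ⟨t, -, hF⟩, hψ⟩; exact hno x t hF hψ
    · rintro ⟨-, x, -, ⟨t, -, hF⟩, hψ⟩; exact hno x t hF hψ
    · rintro ⟨x, -, hF, hψ⟩; exact hno x w hF hψ
  set C := ∑ j, |Y j| with hC
  have hC0 : 0 ≤ C := Finset.sum_nonneg fun _ _ => abs_nonneg _
  -- All heights lie in `[-C, C]`, so `t ≤ 2 * C` and the facet `t = W` is never reached.
  set W := 2 * C + w + 1 with hW
  have hWw : 0 < W - w := by linarith
  -- The shift `t`, rescaled from `[w, W]` to `[0, 1]`, becomes the fifth coordinate `none` of a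
  -- cube.
  let f : Option (Fin 4) → ℝ → ℝ := fun o r =>
    o.elim ((lineT X Y c r - w) / (W - w)) (fun k => lineX X Y c r k)
  have hbound : ∀ r, lineX X Y c r ∈ Icc (0 : Fin 4 → ℝ) 1 → lineT X Y c r < W := by
    intro r hr
    have hmem : ∀ k, lineX X Y c r k ∈ Icc (0 : ℝ) 1 := fun k => ⟨hr.1 k, hr.2 k⟩
    have a := (pl_abs_le Y (c 0) (hmem 0)).1
    rw [(h.pl_lineX_zero h3 c r).1] at a
    have b := (pl_abs_le Y (c 1) (hmem 1)).2
    have d := (pl_abs_le Y (c 3) (hmem 3)).2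
    unfold lineT
    linarith
  have hcube : ∀ r, (∀ i, f i r ∈ Icc (0 : ℝ) 1) ↔
      lineX X Y c r ∈ Icc (0 : Fin 4 → ℝ) 1 ∧ w ≤ lineT X Y c r := by
    intro r
    constructor
    · intro hr
      refine ⟨⟨fun k => (hr (some k)).1, fun k => (hr (some k)).2⟩, ?_⟩
      have := (hr none).1
      simp only [f, Option.elim_none] at this
      rw [le_div_iff₀ hWw] at this
      linarith
    · rintro ⟨hr, hw'⟩ (_ | k)
      · have := hbound r hr
        simp only [f, Option.elim_none]
        exact ⟨div_nonneg (by linarith) hWw.le, by rw [div_le_one hWw]; linarith⟩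
      · exact ⟨hr.1 k, hr.2 k⟩
  have hray : ∀ x, cellMap (quadG X Y) c x ∈ shiftRay w ↔
      ∃ r, x = lineX X Y c r ∧ w ≤ lineT X Y c r := by
    intro x
    constructor
    · rintro ⟨t, ht, hF⟩
      obtain ⟨r, hr, rfl⟩ := (h.cellMap_eq_iff_exists h3).mp hF
      exact ⟨r, hr, ht⟩
    · rintro ⟨r, hr, ht⟩
      exact ⟨_, ht, (h.cellMap_eq_iff_exists h3).mpr ⟨r, hr, rfl⟩⟩
  have hF : ∀ r, cellMap (quadG X Y) c (lineX X Y c r) = shiftTarget (lineT X Y c r) := fun r =>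
    (h.cellMap_eq_iff_exists h3).mpr ⟨r, rfl, rfl⟩
  have hnone0 : ∀ r, f none r = 0 ↔ lineT X Y c r = w := by
    intro r
    simp only [f, Option.elim_none]
    rw [div_eq_zero_iff, or_iff_left hWw.ne', sub_eq_zero]
  have hnone1 : ∀ r, f none r = 1 ↔ lineT X Y c r = W := by
    intro r
    simp only [f, Option.elim_none]
    rw [div_eq_one_iff_eq hWw.ne', sub_left_inj]
  have main := sum_ind_facets_affine (f := f) (ψ := fun r => psi 0 X Y c (lineX X Y c r)) ?_
    ⟨some 0, h.lineX_ne h3 c 0⟩ ((continuous_psi_cell 0 X Y c).comp (continuous_lineX c)) ?_ ?_ ?_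
  · rw [Fintype.sum_option] at main
    have g0 : ∀ k, (∃ x ∈ Icc (0 : Fin 4 → ℝ) 1, x k = 0 ∧ cellMap (quadG X Y) c x ∈ shiftRay w ∧
          0 < psi 0 X Y c x) ↔ ∃ r, (∀ i, f i r ∈ Icc (0 : ℝ) 1) ∧ f (some k) r = 0 ∧
          0 < psi 0 X Y c (lineX X Y c r) := by
      intro k
      simp only [hcube, hray]
      constructor
      · rintro ⟨_, hx, hk, ⟨r, rfl, hr⟩, hψ⟩
        exact ⟨r, ⟨hx, hr⟩, hk, hψ⟩
      · rintro ⟨r, ⟨hx, hr⟩, hk, hψ⟩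
        exact ⟨_, hx, hk, ⟨r, rfl, hr⟩, hψ⟩
    have g1 : ∀ k, (∃ x ∈ Icc (0 : Fin 4 → ℝ) 1, x k = 1 ∧ cellMap (quadG X Y) c x ∈ shiftRay w ∧
          0 < psi 0 X Y c x) ↔ ∃ r, (∀ i, f i r ∈ Icc (0 : ℝ) 1) ∧ f (some k) r = 1 ∧
          0 < psi 0 X Y c (lineX X Y c r) := by
      intro k
      simp only [hcube, hray]
      constructor
      · rintro ⟨_, hx, hk, ⟨r, rfl, hr⟩, hψ⟩
        exact ⟨r, ⟨hx, hr⟩, hk, hψ⟩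
      · rintro ⟨r, ⟨hx, hr⟩, hk, hψ⟩
        exact ⟨_, hx, hk, ⟨r, rfl, hr⟩, hψ⟩
    have g2 : (∃ x ∈ Icc (0 : Fin 4 → ℝ) 1, cellMap (quadG X Y) c x = shiftTarget w ∧
          0 < psi 0 X Y c x) ↔ ∃ r, (∀ i, f i r ∈ Icc (0 : ℝ) 1) ∧ f none r = 0 ∧
          0 < psi 0 X Y c (lineX X Y c r) := by
      simp only [hcube, hnone0, h.cellMap_eq_iff_exists h3]
      constructor
      · rintro ⟨_, hx, ⟨r, rfl, hr⟩, hψ⟩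
        exact ⟨r, ⟨hx, hr.le⟩, hr.symm, hψ⟩
      · rintro ⟨r, ⟨hx, -⟩, hr, hψ⟩
        exact ⟨_, hx, ⟨r, rfl, hr.symm⟩, hψ⟩
    have g3 : ¬ ∃ r, (∀ i, f i r ∈ Icc (0 : ℝ) 1) ∧ f none r = 1 ∧
          0 < psi 0 X Y c (lineX X Y c r) := by
      rintro ⟨r, hr, h1, -⟩
      exact (hbound r ((hcube r).mp hr).1).ne ((hnone1 r).mp h1)
    have g4 : (∃ x ∈ Icc (0 : Fin 4 → ℝ) 1, cellMap (quadG X Y) c x ∈ shiftRay w ∧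
        psi 0 X Y c x = 0) ↔ ∃ r, (∀ i, f i r ∈ Icc (0 : ℝ) 1) ∧
          psi 0 X Y c (lineX X Y c r) = 0 := by
      simp only [hcube, hray]
      constructor
      · rintro ⟨_, hx, ⟨r, rfl, hr⟩, hψ⟩
        exact ⟨r, ⟨hx, hr⟩, hψ⟩
      · rintro ⟨r, ⟨hx, hr⟩, hψ⟩
        exact ⟨_, hx, ⟨r, rfl, hr⟩, hψ⟩
    have g5 : (∃ x ∈ Icc (0 : Fin 4 → ℝ) 1, cellMap (quadG X Y) c x ∈ shiftRay w ∧
        0 < psi 0 X Y c x) ↔ ∃ r, (∀ i, f i r ∈ Icc (0 : ℝ) 1) ∧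
          0 < psi 0 X Y c (lineX X Y c r) := by
      simp only [hcube, hray]
      constructor
      · rintro ⟨_, hx, ⟨r, rfl, hr⟩, hψ⟩
        exact ⟨r, ⟨hx, hr⟩, hψ⟩
      · rintro ⟨r, ⟨hx, hr⟩, hψ⟩
        exact ⟨_, hx, ⟨r, rfl, hr⟩, hψ⟩
    rw [ind_false g3, add_zero, add_comm] at main
    rw [ind_congr g2, ind_congr (and_congr g4 g5), ← main]
    congr 1
    refine Finset.sum_congr rfl fun k _ => ?_
    rw [ind_congr (g0 k), ind_congr (g1 k)]
  · rintro (_ | k) r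
    · simp only [f, Option.elim_none]
      rw [lineT_affine c r]; ring
    · exact lineX_affine c k r
  · intro r hr hψ
    obtain ⟨hx, hwr⟩ := (hcube r).mp hr
    have hn : ∀ k, (f none r = 0 ∨ f none r = 1) → (f (some k) r = 0 ∨ f (some k) r = 1) →
        False := by
      intro k hnone hk
      rcases hnone with hnone | hnone
      · have := hgen _ hx (by rw [hF, (hnone0 r).mp hnone]) k
        rcases hk with hk | hk
        · exact this.1.ne' hk
        · exact this.2.ne hk
      · exact (hbound r hx).ne ((hnone1 r).mp hnone)
    rintro (_ | i) (_ | j) hi hj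
    · rfl
    · exact (hn j hi hj).elim
    · exact (hn i hj hi).elim
    · exact congrArg some (h.boundary_unique hx (hF r) hψ hi hj)
  · intro r hr hψ
    obtain ⟨hx, hwr⟩ := (hcube r).mp hr
    obtain ⟨p, -, -, -, -, hp⟩ := h.exists_vertex_of_psi_eq_zero hx (hw.trans_le hwr) (hF r) hψ h02
    exact ⟨some 0, h.lineX_ne h3 c 0, hp⟩
  · intro r r' hr hr' hψ hψ'
    obtain ⟨hx, hwr⟩ := (hcube r).mp hr
    obtain ⟨hx', hwr'⟩ := (hcube r').mp hr'
    -- The edges `c 0` and `c 2` have only one common vertex, and the triple point has its height,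
    -- so its parameter `r` is unique.
    obtain ⟨p, hp, -, -, hY, -⟩ :=
      h.exists_vertex_of_psi_eq_zero hx (hw.trans_le hwr) (hF r) hψ h02
    obtain ⟨p', hp', -, -, hY', -⟩ :=
      h.exists_vertex_of_psi_eq_zero hx' (hw.trans_le hwr') (hF r') hψ' h02
    rw [(h.pl_lineX_zero h3 c r).1] at hY
    rw [(h.pl_lineX_zero h3 c r').1] at hY'
    have : p = p' := by
      rcases hp with ⟨a, b⟩ | ⟨a, b⟩ <;> rcases hp' with ⟨a', b'⟩ | ⟨a', b'⟩
      · rw [← a, a']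
      · exact absurd (show (2 : ZMod n) = 0 by linear_combination a' - a + b - b')
          (zmod_two_ne_zero h3)
      · exact absurd (show (2 : ZMod n) = 0 by linear_combination a - a' + b' - b)
          (zmod_two_ne_zero h3)
      · rw [← b, b']
    rw [hY, hY', this]

/-- The number of linked solutions equals the number of arcs of solutions which end in a triple
point. -/
theorem count_eq_sum [NeZero n] (h3 : 3 ≤ n) (h : SteepLoop X Y) {w : ℝ} (hw : 0 < w)
    (hgen : ∀ c, ∀ x ∈ Icc (0 : Fin 4 → ℝ) 1, cellMap (quadG X Y) c x = shiftTarget w →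
      ∀ k, 0 < x k ∧ x k < 1) :
    count (quadG X Y) (psi 0 X Y) (shiftTarget w) =
      ∑ c, ind ((∃ x ∈ Icc (0 : Fin 4 → ℝ) 1, cellMap (quadG X Y) c x ∈ shiftRay w ∧
        psi 0 X Y c x = 0) ∧
      ∃ x ∈ Icc (0 : Fin 4 → ℝ) 1, cellMap (quadG X Y) c x ∈ shiftRay w ∧
        0 < psi 0 X Y c x) := by
  -- The facets between cells cancel, so only the facet `t = w` and the ends at triple points
  -- remain.
  have hsum := sum_facets_eq_zero (quadG X Y) (glued_psi 0 X Y) (shiftRay w)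
  rw [← Finset.sum_congr rfl fun c _ => h.sum_facets_cell h3 hw c (hgen c),
    Finset.sum_add_distrib, hsum, zero_add]
  rfl

end SteepLoop

end Facets

/-! ### Local geometry at a vertex -/

section Corner

variable {n : ℕ} {X Y : ZMod n → ℝ}

theorem pl_eq_add_relPos (g : ZMod n → ℝ) {p e : ZMod n} (he : e = p ∨ e = p - 1) (t : ℝ) :
    pl g e t = g p + relPos p e t * (g (e + 1) - g e) := by
  unfold relPos pl
  split_ifs with h
  · rw [h]
  · rw [he.resolve_left h, sub_add_cancel]; ring

theorem mem_Icc_of_relPos {p e : ZMod n} {t : ℝ} (h1 : |relPos p e t| ≤ 1)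
    (hp : e = p → 0 ≤ relPos p e t) (hm : e ≠ p → relPos p e t ≤ 0) : t ∈ Icc (0 : ℝ) 1 := by
  unfold relPos at *
  rw [abs_le] at h1
  split_ifs at * with h
  · exact ⟨hp h, h1.2⟩
  · have := hm h
    exact ⟨by linarith, by linarith⟩

theorem relPos_nonneg {p e : ZMod n} {t : ℝ} (ht : t ∈ Icc (0 : ℝ) 1) (h : e = p) :
    0 ≤ relPos p e t := by
  rw [relPos, if_pos h]; exact ht.1

theorem relPos_nonpos {p e : ZMod n} {t : ℝ} (ht : t ∈ Icc (0 : ℝ) 1) (h : e ≠ p) :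
    relPos p e t ≤ 0 := by
  rw [relPos, if_neg h]; linarith [ht.2]

/-- The edges `e` and `e'` are the two edges at the vertex `p`. -/
def EdgesAt (p e e' : ZMod n) : Prop := (e = p ∧ e' = p - 1) ∨ (e = p - 1 ∧ e' = p)

theorem EdgesAt.left {p e e' : ZMod n} (h : EdgesAt p e e') : e = p ∨ e = p - 1 :=
  h.imp And.left And.left

theorem EdgesAt.right {p e e' : ZMod n} (h : EdgesAt p e e') : e' = p ∨ e' = p - 1 :=
  (h.imp And.right And.right).symm

theorem EdgesAt.ne (h3 : 3 ≤ n) {p e e' : ZMod n} (h : EdgesAt p e e') : e ≠ e' := by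
  have hne := SteepLoop.sub_one_ne_self h3 p
  rcases h with ⟨rfl, rfl⟩ | ⟨rfl, rfl⟩
  · exact hne.symm
  · exact hne

theorem EdgesAt.eq_or {p e e' f : ZMod n} (h : EdgesAt p e e') (hf : f = p ∨ f = p - 1) :
    f = e ∨ f = e' := by
  rcases h with ⟨rfl, rfl⟩ | ⟨rfl, rfl⟩
  · exact hf
  · exact hf.symm

theorem EdgesAt.vertex_eq (h3 : 3 ≤ n) {p p' e e' : ZMod n} (h : EdgesAt p e e')
    (h' : EdgesAt p' e e') : p = p' := by
  rcases h with ⟨a, b⟩ | ⟨a, b⟩ <;> rcases h' with ⟨a', b'⟩ | ⟨a', b'⟩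
  · rw [← a, a']
  · exact absurd (show (2 : ZMod n) = 0 by linear_combination a' - a + b - b')
      (zmod_two_ne_zero h3)
  · exact absurd (show (2 : ZMod n) = 0 by linear_combination a - a' + b' - b)
      (zmod_two_ne_zero h3)
  · rw [← b, b']

theorem EdgesAt.relPos_mul_nonpos (h3 : 3 ≤ n) {p e e' : ZMod n} (h : EdgesAt p e e') {s t : ℝ}
    (hs : s ∈ Icc (0 : ℝ) 1) (ht : t ∈ Icc (0 : ℝ) 1) : relPos p e s * relPos p e' t ≤ 0 := by
  have hne := SteepLoop.sub_one_ne_self h3 p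
  rcases h with ⟨rfl, rfl⟩ | ⟨rfl, rfl⟩
  · exact mul_nonpos_of_nonneg_of_nonpos (relPos_nonneg hs rfl) (relPos_nonpos ht hne)
  · exact mul_nonpos_of_nonpos_of_nonneg (relPos_nonpos hs hne) (relPos_nonneg ht rfl)

theorem pos_of_mul_pos_of_neg {a b : ℝ} (hb : b < 0) : 0 < a * b ↔ a < 0 :=
  ⟨fun h => by by_contra! ha; exact h.not_ge (mul_nonpos_of_nonneg_of_nonpos ha hb.le),
    fun h => mul_pos_of_neg_of_neg h hb⟩

namespace SteepLoop

theorem pl_X_eq_of_edge (h3 : 3 ≤ n) (h : SteepLoop X Y) {p e : ZMod n} (he : e = p ∨ e = p - 1)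
    (t : ℝ) : pl X e t = X p + invSlope X Y e * (pl Y e t - Y p) := by
  rw [pl_eq_add_relPos X he, pl_eq_add_relPos Y he, ← h.slope_mul h3 e]; ring

/-- Consecutive edges at a local extremum have different slopes. -/
theorem invSlope_ne (h3 : 3 ≤ n) (h : SteepLoop X Y) {p : ZMod n}
    (hp : LocalMin Y p ∨ LocalMax Y p) : invSlope X Y (p - 1) ≠ invSlope X Y p := by
  intro e
  obtain ⟨α, β, h1, h2⟩ := h.simple.exists_functional h3 p
  have a := h.slope_mul h3 (p - 1)
  have b := h.slope_mul h3 p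
  rw [sub_add_cancel, e] at a
  rw [← a] at h1
  rw [← b] at h2
  set s := invSlope X Y p
  -- With a common inverse slope the functional is one multiple of the height along both edges, but
  -- at an extremum the height changes in opposite directions.
  have h1' : 0 < (α * s + β) * (Y p - Y (p - 1)) := by linarith
  have h2' : 0 < (α * s + β) * (Y (p + 1) - Y p) := by linarith
  have := mul_pos h1' h2'
  have hle : (Y p - Y (p - 1)) * (Y (p + 1) - Y p) ≤ 0 := by
    rcases hp with hp | hp
    · exact mul_nonpos_of_nonpos_of_nonneg (by linarith [hp.1]) (by linarith [hp.2])
    · exact mul_nonpos_of_nonneg_of_nonpos (by linarith [hp.1]) (by linarith [hp.2])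
  nlinarith [mul_nonneg (sq_nonneg (α * s + β)) (neg_nonneg.mpr hle)]

theorem localMin_of_lt {p e e' : ZMod n} (he : EdgesAt p e e')
    {s t : ℝ} (hs : s ∈ Icc (0 : ℝ) 1) (ht : t ∈ Icc (0 : ℝ) 1) (h1 : Y p < pl Y e s)
    (h2 : Y p < pl Y e' t) : LocalMin Y p := by
  have key : ∀ {s t : ℝ}, s ∈ Icc (0 : ℝ) 1 → t ∈ Icc (0 : ℝ) 1 → Y p < pl Y p s →
      Y p < pl Y (p - 1) t → LocalMin Y p := by
    intro s t hs ht h1 h2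
    constructor
    · by_contra! hle
      have : pl Y (p - 1) t ∈ Iic (Y p) :=
        pl_mem_of_convex (convex_Iic _) ht hle (by rw [sub_add_cancel]; exact self_mem_Iic)
      exact h2.not_ge this
    · by_contra! hle
      have : pl Y p s ∈ Iic (Y p) := pl_mem_of_convex (convex_Iic _) hs self_mem_Iic hle
      exact h1.not_ge this
  rcases he with ⟨rfl, rfl⟩ | ⟨rfl, rfl⟩
  · exact key hs ht h1 h2
  · exact key ht hs h2 h1

theorem localMax_of_lt {p e e' : ZMod n} (he : EdgesAt p e e')
    {s t : ℝ} (hs : s ∈ Icc (0 : ℝ) 1) (ht : t ∈ Icc (0 : ℝ) 1) (h1 : pl Y e s < Y p)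
    (h2 : pl Y e' t < Y p) : LocalMax Y p := by
  have := localMin_of_lt (Y := -Y) he hs ht (by rw [pl_neg]; exact neg_lt_neg h1)
    (by rw [pl_neg]; exact neg_lt_neg h2)
  exact ⟨neg_lt_neg_iff.mp this.1, neg_lt_neg_iff.mp this.2⟩

theorem mem_Icc_of_localMin {p e : ZMod n} (hp : LocalMin Y p) (he : e = p ∨ e = p - 1) {t : ℝ}
    (h1 : |relPos p e t| ≤ 1) (h2 : Y p ≤ pl Y e t) : t ∈ Icc (0 : ℝ) 1 := by
  rw [pl_eq_add_relPos Y he] at h2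
  refine mem_Icc_of_relPos h1 ?_ ?_
  · rintro rfl
    by_contra! hlt
    nlinarith [hp.2]
  · intro hne
    obtain rfl := he.resolve_left hne
    rw [sub_add_cancel] at h2
    by_contra! hlt
    nlinarith [hp.1]

theorem mem_Icc_of_localMax {p e : ZMod n} (hp : LocalMax Y p) (he : e = p ∨ e = p - 1) {t : ℝ}
    (h1 : |relPos p e t| ≤ 1) (h2 : pl Y e t ≤ Y p) : t ∈ Icc (0 : ℝ) 1 :=
  mem_Icc_of_localMin (Y := -Y) ⟨neg_lt_neg hp.1, neg_lt_neg hp.2⟩ he h1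
    (by rw [pl_neg]; exact neg_le_neg h2)

/-- Near a vertex `p`, the point `b` lies between `a` and `c` if and only if it lies on the edge of
smaller slope. -/
theorem relPos_between_iff (h3 : 3 ≤ n) (h : SteepLoop X Y) {p : ZMod n} {c : Fin 4 → ZMod n}
    {x : Fin 4 → ℝ} (hc : EdgesAt p (c 0) (c 2)) (hc1 : c 1 = p ∨ c 1 = p - 1)
    (hx0 : x 0 ∈ Icc (0 : ℝ) 1) (hx2 : x 2 ∈ Icc (0 : ℝ) 1)
    (hY : pl Y (c 0) (x 0) = pl Y (c 2) (x 2))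
    (hX : pl X (c 0) (x 0) + pl X (c 2) (x 2) = 2 * pl X (c 1) (x 1))
    (hu : pl Y (c 0) (x 0) ≠ Y p) :
    0 < (relPos p (c 0) (x 0) - relPos p (c 1) (x 1)) *
        (relPos p (c 1) (x 1) - relPos p (c 2) (x 2)) ↔
      (c 1 = c 0 ∧ invSlope X Y (c 0) < invSlope X Y (c 2)) ∨
      (c 1 = c 2 ∧ invSlope X Y (c 2) < invSlope X Y (c 0)) := by
  have hAC := hc.relPos_mul_nonpos h3 hx0 hx2
  have e0 := pl_eq_add_relPos Y hc.left (x 0)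
  have e2 := pl_eq_add_relPos Y hc.right (x 2)
  have e1 := pl_eq_add_relPos Y hc1 (x 1)
  have f0 := h.pl_X_eq_of_edge h3 hc.left (x 0)
  have f2 := h.pl_X_eq_of_edge h3 hc.right (x 2)
  have f1 := h.pl_X_eq_of_edge h3 hc1 (x 1)
  have s0 := h.slope_neg h3 (c 0)
  have s2 := h.slope_neg h3 (c 2)
  have s0' := s0.ne
  have s2' := s2.ne
  have v0 := h.dY_ne h3 (c 0)
  have v2 := h.dY_ne h3 (c 2)
  have hne := hc.ne h3
  set A := relPos p (c 0) (x 0)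
  set B := relPos p (c 1) (x 1)
  set C := relPos p (c 2) (x 2)
  set a := invSlope X Y (c 0)
  set b := invSlope X Y (c 2)
  have hA : A ≠ 0 := by
    rintro hA; rw [hA] at e0; exact hu (by linarith)
  have hC : C ≠ 0 := by
    rintro hC; rw [hC] at e2; exact hu (by linarith)
  have hA2 : 0 < A ^ 2 := by positivity
  have hC2 : 0 < C ^ 2 := by positivity
  rcases hc.eq_or hc1 with hj | hj
  · rw [hj] at f1 e1 hX
    have hB : B * a = (a + b) / 2 * A := by
      refine mul_right_cancel₀ v0 ?_
      rw [f0, f1, f2, ← hY, e0, e1] at hX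
      linarith
    -- The second factor on the right is negative because `A * C ≤ 0`, so the sign is that of `b -
    -- a`: the point `b` is closer to `p` than `a` exactly if its edge has the smaller inverse
    -- slope.
    have hP : (A - B) * (B - C) * a ^ 2 =
        (a - (a + b) / 2) * (A ^ 2 * ((a + b) / 2) - A * C * a) := by
      have : (A - B) * (B - C) * a ^ 2 = (A * a - B * a) * (B * a - C * a) := by ring
      rw [this, hB]; ring
    have hQ : A ^ 2 * ((a + b) / 2) - A * C * a < 0 := by
      have := mul_neg_of_pos_of_neg hA2 (show (a + b) / 2 < 0 by linarith)
      have := mul_nonneg_of_nonpos_of_nonpos hAC s0.le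
      linarith
    rw [← mul_pos_iff_of_pos_right (show 0 < a ^ 2 by positivity), hP, pos_of_mul_pos_of_neg hQ]
    constructor
    · intro hlt; exact Or.inl ⟨hj, by linarith⟩
    · rintro (⟨-, h'⟩ | ⟨h', -⟩)
      · linarith
      · exact absurd (hj.symm.trans h') hne
  · rw [hj] at f1 e1 hX
    have hB : B * b = (a + b) / 2 * C := by
      refine mul_right_cancel₀ v2 ?_
      rw [f0, f1, f2, hY, e2, e1] at hX
      linarith
    have hP : (A - B) * (B - C) * b ^ 2 =
        (b - (a + b) / 2) * (C ^ 2 * ((a + b) / 2) - A * C * b) := by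
      have : (A - B) * (B - C) * b ^ 2 = (A * b - B * b) * (B * b - C * b) := by ring
      rw [this, hB]; ring
    have hQ : C ^ 2 * ((a + b) / 2) - A * C * b < 0 := by
      have := mul_neg_of_pos_of_neg hC2 (show (a + b) / 2 < 0 by linarith)
      have := mul_nonneg_of_nonpos_of_nonpos hAC s2.le
      linarith
    rw [← mul_pos_iff_of_pos_right (show 0 < b ^ 2 by positivity), hP, pos_of_mul_pos_of_neg hQ]
    constructor
    · intro hlt; exact Or.inr ⟨hj, by linarith⟩
    · rintro (⟨h', -⟩ | ⟨-, h'⟩)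
      · exact absurd (h'.symm.trans hj) hne
      · linarith

end SteepLoop

theorem val_add_eq_val_sub [NeZero n] (p l : ZMod n) (t : ℝ) :
    ∃ m : ℤ, (l.val : ℝ) + t = p.val + ((l - p).val + t) + m * n := by
  have h : (((l.val : ℤ) - p.val - (l - p).val : ℤ) : ZMod n) = 0 := by simp
  rw [ZMod.intCast_zmod_eq_zero_iff_dvd] at h
  obtain ⟨m, hm⟩ := h
  refine ⟨m, ?_⟩
  have : ((l.val : ℤ) : ℝ) - (p.val : ℤ) - ((l - p).val : ℤ) = n * m := by exact_mod_cast hm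
  push_cast at this
  linarith

theorem val_sub_bounds [NeZero n] {p l : ZMod n} (h1 : l ≠ p) (h2 : l ≠ p - 1) :
    (1 : ℝ) ≤ (l - p).val ∧ ((l - p).val : ℝ) + 1 ≤ n - 1 := by
  have a : (l - p).val ≠ 0 := (ZMod.val_ne_zero _).mpr (sub_ne_zero.mpr h1)
  have b : (l - p).val < n := ZMod.val_lt _
  have d : (l - p).val + 1 ≠ n := by
    intro e
    have := congrArg (Nat.cast : ℕ → ZMod n) e
    simp only [Nat.cast_add, ZMod.natCast_zmod_val, Nat.cast_one, ZMod.natCast_self] at this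
    exact h2 (by linear_combination this)
  have a' : 1 ≤ (l - p).val := by omega
  have b' : (l - p).val + 1 + 1 ≤ n := by omega
  have b'' : (((l - p).val : ℝ) + 1 + 1) ≤ n := by exact_mod_cast b'
  exact ⟨by exact_mod_cast a', by linarith⟩

/-- If `a, b, c` lie on the edges at `p` and `d` does not, then the sign of the linking function is
determined by the position of `b` relative to `a` and `c`. -/
theorem exists_link_eq_mul_mul [NeZero n] (h3 : 3 ≤ n) {c : Fin 4 → ZMod n} {x : Fin 4 → ℝ}
    {p : ZMod n} (hc0 : c 0 = p ∨ c 0 = p - 1) (hc1 : c 1 = p ∨ c 1 = p - 1)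
    (hc2 : c 2 = p ∨ c 2 = p - 1) (h1 : c 3 ≠ p) (h2 : c 3 ≠ p - 1)
    (hx : x ∈ Icc (0 : Fin 4 → ℝ) 1) :
    ∃ κ ≤ 0, link c x = κ * ((relPos p (c 0) (x 0) - relPos p (c 1) (x 1)) *
        (relPos p (c 1) (x 1) - relPos p (c 2) (x 2))) ∧ (0 < x 3 → x 3 < 1 → κ < 0) := by
  have hmem : ∀ k, x k ∈ Icc (0 : ℝ) 1 := fun k => ⟨hx.1 k, hx.2 k⟩
  have hA := relPos_mem (p := p) (i := c 0) (hmem 0)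
  have hB := relPos_mem (p := p) (i := c 1) (hmem 1)
  have hC := relPos_mem (p := p) (i := c 2) (hmem 2)
  have hD := val_sub_bounds h1 h2
  have hn : (3 : ℝ) ≤ n := by exact_mod_cast h3
  have hn0 : (0 : ℝ) < n := by linarith
  have key := linkFn_congr (s := fun k => ((c k).val : ℝ) + x k)
    (t := ![(p.val : ℝ) + relPos p (c 0) (x 0), (p.val : ℝ) + relPos p (c 1) (x 1),
      (p.val : ℝ) + relPos p (c 2) (x 2), (p.val : ℝ) + ((c 3 - p).val + x 3)]) (by
      intro k
      fin_cases k
      · exact val_add_eq_relPos (x 0) hc0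
      · exact val_add_eq_relPos (x 1) hc1
      · exact val_add_eq_relPos (x 2) hc2
      · exact val_add_eq_val_sub p (c 3) (x 3))
  simp only [Matrix.cons_val_zero, Matrix.cons_val_one, Matrix.cons_val] at key
  set A := relPos p (c 0) (x 0)
  set B := relPos p (c 1) (x 1)
  set C := relPos p (c 2) (x 2)
  -- The position of `d` counted forward from `p`. It lies in `[1, n - 1]` and `A, B, C` in `[-1,
  -- 1]`, so `D - A` and `D - C` are in `[0, n]` and their sines are nonnegative.
  set D := ((c 3 - p).val : ℝ) + x 3 with hDdef
  obtain ⟨k0, hk0, e0⟩ := exists_sin_eq_mul (n := n) (d := A - B)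
    (abs_lt.mpr ⟨by linarith [hA.1, hB.2], by linarith [hA.2, hB.1]⟩)
  obtain ⟨k1, hk1, e1⟩ := exists_sin_eq_mul (n := n) (d := B - C)
    (abs_lt.mpr ⟨by linarith [hB.1, hC.2], by linarith [hB.2, hC.1]⟩)
  have hx3 := hmem 3
  have hpi := Real.pi_pos
  have scale : ∀ d : ℝ, d ≤ n → Real.pi * d / n ≤ Real.pi := fun d hd => by
    rw [div_le_iff₀ hn0]; exact mul_le_mul_of_nonneg_left hd hpi.le
  have scale' : ∀ d : ℝ, d < n → Real.pi * d / n < Real.pi := fun d hd => by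
    rw [div_lt_iff₀ hn0]; exact mul_lt_mul_of_pos_left hd hpi
  have e3 : Real.pi * (C - D) / n = -(Real.pi * (D - C) / n) := by ring
  refine ⟨k0 * k1 * (Real.sin (Real.pi * (C - D) / n) * Real.sin (Real.pi * (D - A) / n)),
    ?_, ?_, ?_⟩
  · refine mul_nonpos_of_nonneg_of_nonpos (by positivity) ?_
    rw [e3, Real.sin_neg, neg_mul, neg_nonpos]
    refine mul_nonneg ?_ ?_
    · exact Real.sin_nonneg_of_nonneg_of_le_pi
        (div_nonneg (mul_nonneg hpi.le (by linarith [hC.2, hx3.1])) hn0.le)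
        (scale _ (by linarith [hC.1, hx3.2]))
    · exact Real.sin_nonneg_of_nonneg_of_le_pi
        (div_nonneg (mul_nonneg hpi.le (by linarith [hA.2, hx3.1])) hn0.le)
        (scale _ (by linarith [hA.1, hx3.2]))
  · rw [link, key, linkFn, show (p.val : ℝ) + A - (p.val + B) = A - B by ring,
      show (p.val : ℝ) + B - (p.val + C) = B - C by ring,
      show (p.val : ℝ) + C - (p.val + D) = C - D by ring,
      show (p.val : ℝ) + D - (p.val + A) = D - A by ring, e0, e1]
    ring
  · intro hp0 hp1
    refine mul_neg_of_pos_of_neg (by positivity) ?_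
    rw [e3, Real.sin_neg, neg_mul, neg_lt_zero]
    refine mul_pos ?_ ?_
    · exact Real.sin_pos_of_pos_of_lt_pi
        (div_pos (mul_pos hpi (by linarith [hC.2])) hn0) (scale' _ (by linarith [hC.1]))
    · exact Real.sin_pos_of_pos_of_lt_pi
        (div_pos (mul_pos hpi (by linarith [hA.2])) hn0) (scale' _ (by linarith [hA.1]))

end Corner

/-! ### Cells with arcs ending in triple points, and cells with small solutions -/

section Arcs

variable {n : ℕ} {X Y : ZMod n → ℝ}

theorem sum_ind_exists {α β : Type*} [Fintype α] [Fintype β] {P : α → Prop} {φ : α → β}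
    (hφ : ∀ a b, P a → P b → φ a = φ b → a = b) :
    ∑ b, ind (∃ a, P a ∧ b = φ a) = ∑ a, ind (P a) := by
  have h1 : ∀ b, ind (∃ a, P a ∧ b = φ a) = ∑ a, ind (P a ∧ b = φ a) := by
    intro b
    by_cases h : ∃ a, P a ∧ b = φ a
    · rw [ind_true h]
      obtain ⟨a, ha, hb⟩ := h
      rw [Finset.sum_eq_single a, ind_true ⟨ha, hb⟩]
      · intro a' _ hne
        exact ind_false fun h' => hne (hφ a' a h'.1 ha (h'.2.symm.trans hb))
      · simp
    · rw [ind_false h]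
      exact (Finset.sum_eq_zero fun a _ => ind_false fun h' => h ⟨a, h'⟩).symm
  rw [Finset.sum_congr rfl fun b _ => h1 b, Finset.sum_comm]
  refine Finset.sum_congr rfl fun a _ => ?_
  rw [Finset.sum_eq_single (φ a)]
  · exact ind_congr ⟨fun h => h.1, fun h => ⟨h, rfl⟩⟩
  · intro b _ hne
    exact ind_false fun h' => hne h'.2
  · simp

/-- The cells in which an arc of linked solutions ends in a triple point at the vertex `p`. -/
def ArcCell (X Y : ZMod n → ℝ) (p : ZMod n) (c : Fin 4 → ZMod n) : Prop :=
  EdgesAt p (c 0) (c 2) ∧ VertexBelow X Y p (c 3) ∧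
    ((LocalMin Y p ∧ invSlope X Y (c 0) < invSlope X Y (c 2) ∧ c 1 = c 0) ∨
      (LocalMax Y p ∧ invSlope X Y (c 2) < invSlope X Y (c 0) ∧ c 1 = c 2))

/-- The cells which contain small linked solutions at the vertex `p`. -/
def CornerCell (X Y : ZMod n → ℝ) (p : ZMod n) (c : Fin 4 → ZMod n) : Prop :=
  EdgesAt p (c 0) (c 2) ∧ LocalMin Y p ∧ invSlope X Y (c 0) < invSlope X Y (c 2) ∧
    c 1 = c 0 ∧ c 3 = c 2

open Classical in
/-- The edge at `p` of smaller inverse slope. -/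
noncomputable def lowEdge (X Y : ZMod n → ℝ) (p : ZMod n) : ZMod n :=
  if invSlope X Y (p - 1) < invSlope X Y p then p - 1 else p

open Classical in
/-- The edge at `p` of larger inverse slope. -/
noncomputable def highEdge (X Y : ZMod n → ℝ) (p : ZMod n) : ZMod n :=
  if invSlope X Y (p - 1) < invSlope X Y p then p else p - 1

theorem edgesAt_lowEdge (p : ZMod n) : EdgesAt p (lowEdge X Y p) (highEdge X Y p) := by
  unfold lowEdge highEdge
  split_ifs
  · exact Or.inr ⟨rfl, rfl⟩
  · exact Or.inl ⟨rfl, rfl⟩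

theorem EdgesAt.symm {p e e' : ZMod n} (h : EdgesAt p e e') : EdgesAt p e' e := by
  rcases h with ⟨a, b⟩ | ⟨a, b⟩
  · exact Or.inr ⟨b, a⟩
  · exact Or.inl ⟨b, a⟩

theorem EdgesAt.eq_lowEdge {p e e' : ZMod n} (h : EdgesAt p e e')
    (hs : invSlope X Y e < invSlope X Y e') : e = lowEdge X Y p ∧ e' = highEdge X Y p := by
  unfold lowEdge highEdge
  rcases h with ⟨rfl, rfl⟩ | ⟨rfl, rfl⟩
  · rw [if_neg hs.not_gt, if_neg hs.not_gt]; exact ⟨rfl, rfl⟩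
  · rw [if_pos hs, if_pos hs]; exact ⟨rfl, rfl⟩

theorem continuous_relPos (p e : ZMod n) : Continuous (relPos p e) := by
  unfold relPos
  split_ifs <;> fun_prop

theorem LocalMin.not_localMax {p : ZMod n} (h : LocalMin Y p) : ¬ LocalMax Y p :=
  fun h' => h.1.not_gt h'.1

namespace SteepLoop

theorem invSlope_lowEdge_lt (h3 : 3 ≤ n) (h : SteepLoop X Y) {p : ZMod n}
    (hp : LocalMin Y p ∨ LocalMax Y p) :
    invSlope X Y (lowEdge X Y p) < invSlope X Y (highEdge X Y p) := by
  unfold lowEdge highEdge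
  split_ifs with hs
  · exact hs
  · exact lt_of_le_of_ne (not_lt.mp hs) (h.invSlope_ne h3 hp).symm

theorem ne_of_vertexBelow (h : SteepLoop X Y) {p l : ZMod n} (hv : VertexBelow X Y p l) :
    l ≠ p ∧ l ≠ p - 1 := by
  have hb := h.between_of_vertexBelow hv
  constructor
  · rintro rfl; rcases hb with hb | hb <;> linarith [hb.1, hb.2]
  · rintro rfl; rw [sub_add_cancel] at hb; rcases hb with hb | hb <;> linarith [hb.1, hb.2]

/-- The vertex `p` and the edge `l` of `d` determine the cell: the inverse slopes decide which edge
carries `a` and which `c`, and `b` is on the one of smaller inverse slope. Conversely the edges of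
`a` and `c` determine `p`. -/
theorem sum_arcCell [NeZero n] (h3 : 3 ≤ n) (h : SteepLoop X Y) :
    ∑ c, ind (∃ p, ArcCell X Y p c) =
      ∑ p, ∑ l, ind ((LocalMin Y p ∨ LocalMax Y p) ∧ VertexBelow X Y p l) := by
  classical
  let φ : ZMod n × ZMod n → Fin 4 → ZMod n := fun q =>
    if LocalMin Y q.1 then ![lowEdge X Y q.1, lowEdge X Y q.1, highEdge X Y q.1, q.2]
    else ![highEdge X Y q.1, lowEdge X Y q.1, lowEdge X Y q.1, q.2]
  have hφ3 : ∀ q, φ q 3 = q.2 := by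
    intro q; simp only [φ]; split_ifs <;> rfl
  have hφe : ∀ q, EdgesAt q.1 (φ q 0) (φ q 2) := by
    intro q; simp only [φ]
    split_ifs
    · exact edgesAt_lowEdge q.1
    · exact (edgesAt_lowEdge q.1).symm
  have key : ∀ c, (∃ p, ArcCell X Y p c) ↔ ∃ q : ZMod n × ZMod n,
      ((LocalMin Y q.1 ∨ LocalMax Y q.1) ∧ VertexBelow X Y q.1 q.2) ∧ c = φ q := by
    intro c
    constructor
    · rintro ⟨p, he, hv, h'⟩
      refine ⟨(p, c 3), ⟨h'.imp And.left And.left, hv⟩, ?_⟩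
      rcases h' with ⟨hm, hs, h1⟩ | ⟨hm, hs, h1⟩
      · obtain ⟨e0, e2⟩ := he.eq_lowEdge hs
        simp only [φ, if_pos hm, ← e0, ← e2]
        ext k; fin_cases k <;> simp [h1]
      · obtain ⟨e0, e2⟩ := he.symm.eq_lowEdge hs
        have hm' : ¬ LocalMin Y p := fun h => h.not_localMax hm
        simp only [φ, if_neg hm', ← e0, ← e2]
        ext k; fin_cases k <;> simp [h1]
    · rintro ⟨⟨p, l⟩, ⟨hp, hv⟩, rfl⟩
      have hs := h.invSlope_lowEdge_lt h3 hp
      refine ⟨p, hφe (p, l), by rw [hφ3]; exact hv, ?_⟩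
      by_cases hm : LocalMin Y p
      · left
        simp only [φ, if_pos hm]
        exact ⟨hm, hs, rfl⟩
      · right
        simp only [φ, if_neg hm]
        exact ⟨hp.resolve_left hm, hs, rfl⟩
  rw [Finset.sum_congr rfl fun c _ => ind_congr (key c), sum_ind_exists, Fintype.sum_prod_type]
  intro q q' _ _ e
  have e3 : q.2 = q'.2 := by rw [← hφ3 q, ← hφ3 q', e]
  have he := hφe q
  rw [e] at he
  exact Prod.ext (he.vertex_eq h3 (hφe q')) e3

theorem sum_cornerCell [NeZero n] (h3 : 3 ≤ n) (h : SteepLoop X Y) :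
    ∑ c, ind (∃ p, CornerCell X Y p c) = ∑ p, ind (LocalMin Y p) := by
  let φ : ZMod n → Fin 4 → ZMod n := fun p =>
    ![lowEdge X Y p, lowEdge X Y p, highEdge X Y p, highEdge X Y p]
  have key : ∀ c, (∃ p, CornerCell X Y p c) ↔ ∃ p, LocalMin Y p ∧ c = φ p := by
    intro c
    constructor
    · rintro ⟨p, he, hm, hs, h1, h2⟩
      refine ⟨p, hm, ?_⟩
      obtain ⟨e0, e2⟩ := he.eq_lowEdge hs
      simp only [φ, ← e0, ← e2]
      ext k; fin_cases k <;> simp [h1, h2]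
    · rintro ⟨p, hm, rfl⟩
      exact ⟨p, edgesAt_lowEdge p, hm, h.invSlope_lowEdge_lt h3 (Or.inl hm), rfl, rfl⟩
  rw [Finset.sum_congr rfl fun c _ => ind_congr (key c), sum_ind_exists]
  intro p p' _ _ e
  have he : EdgesAt p (φ p 0) (φ p 2) := edgesAt_lowEdge p
  rw [e] at he
  exact he.vertex_eq h3 (edgesAt_lowEdge p')

/-- The triple point provides `p` and the edge above it. The linked solution in the same cell shows
on which side of `p` the arc runs, hence the kind of extremum and the edge of `b`. -/
theorem exists_arcCell [NeZero n] (h3 : 3 ≤ n) (h : SteepLoop X Y) {c : Fin 4 → ZMod n}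
    {x x' : Fin 4 → ℝ} (hx : x ∈ Icc (0 : Fin 4 → ℝ) 1) {t t' : ℝ} (ht : 0 < t)
    (hF : cellMap (quadG X Y) c x = shiftTarget t) (hψ : psi 0 X Y c x = 0)
    (hx' : x' ∈ Icc (0 : Fin 4 → ℝ) 1) (hF' : cellMap (quadG X Y) c x' = shiftTarget t')
    (hψ' : 0 < psi 0 X Y c x') : ∃ p, ArcCell X Y p c := by
  obtain ⟨e0, e1, e2, e3⟩ := cellMap_eq_shiftTarget_iff.mp hF'
  obtain ⟨hl, hac, hbd⟩ := psi_pos_iff.mp hψ'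
  rw [neg_zero] at hl
  have h02 : c 0 ≠ c 2 := by
    intro e
    rw [e] at e0 hac
    rw [h.pl_Y_injective h3 _ e0] at hac
    exact lt_irrefl _ hac
  obtain ⟨p, he, h1, hv, -, -⟩ := h.exists_vertex_of_psi_eq_zero hx ht hF hψ h02
  have he : EdgesAt p (c 0) (c 2) := he
  obtain ⟨n1, n2⟩ := h.ne_of_vertexBelow hv
  have f0 := h.pl_X_eq_of_edge h3 he.left (x' 0)
  have f2 := h.pl_X_eq_of_edge h3 he.right (x' 2)
  rw [← e0] at f2
  have hu : pl Y (c 0) (x' 0) ≠ Y p := by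
    intro e
    rw [e, sub_self, mul_zero] at f0 f2
    linarith
  obtain ⟨κ, hκ, hlink, -⟩ := exists_link_eq_mul_mul h3 he.left h1 he.right n1 n2 hx'
  rw [hlink] at hl
  have hP := (h.relPos_between_iff h3 he h1 ⟨hx'.1 0, hx'.2 0⟩ ⟨hx'.1 2, hx'.2 2⟩ e0 e2 hu).mp (by
    by_contra! hle
    exact hl.not_ge (mul_nonneg_of_nonpos_of_nonpos hκ hle))
  refine ⟨p, he, hv, ?_⟩
  -- The width of `ac` is the difference of the inverse slopes times the height above `p`, so both
  -- factors have the same sign.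
  have hsu : 0 < (invSlope X Y (c 2) - invSlope X Y (c 0)) * (pl Y (c 0) (x' 0) - Y p) := by
    linarith
  rcases lt_or_gt_of_ne hu with hlt | hgt
  · have hs := (pos_of_mul_pos_of_neg (sub_neg.mpr hlt)).mp hsu
    right
    refine ⟨localMax_of_lt he ⟨hx'.1 0, hx'.2 0⟩ ⟨hx'.1 2, hx'.2 2⟩ hlt (e0 ▸ hlt),
      sub_neg.mp hs, ?_⟩
    rcases hP with hP | hP
    · linarith [hP.2]
    · exact hP.1
  · have hs := pos_of_mul_pos_left hsu (sub_pos.mpr hgt).le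
    left
    refine ⟨localMin_of_lt he ⟨hx'.1 0, hx'.2 0⟩ ⟨hx'.1 2, hx'.2 2⟩ hgt (e0 ▸ hgt),
      sub_pos.mp hs, ?_⟩
    rcases hP with hP | hP
    · exact hP.1
    · linarith [hP.2]

/-- The height of `b` on an edge at the vertex `p`. -/
theorem pl_Y_lineX (h3 : 3 ≤ n) (h : SteepLoop X Y) {p : ZMod n} {c : Fin 4 → ZMod n}
    (he : EdgesAt p (c 0) (c 2)) (r : ℝ) {k : Fin 4} (hk : c k = p ∨ c k = p - 1)
    (hl : pl X (c k) (lineX X Y c r k) = lineM X Y c r) :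
    pl Y (c k) (lineX X Y c r k) = Y p +
      (invSlope X Y (c 0) + invSlope X Y (c 2)) / 2 / invSlope X Y (c k) * (r - Y p) := by
  obtain ⟨l0, l2, -, -⟩ := h.pl_lineX_zero h3 c r
  have f0 := h.pl_X_eq_of_edge h3 he.left (lineX X Y c r 0)
  have f2 := h.pl_X_eq_of_edge h3 he.right (lineX X Y c r 2)
  have a := h.pl_X_eq h3 (c 0) (lineX X Y c r 0)
  have b := h.pl_X_eq h3 (c 2) (lineX X Y c r 2)
  have fk := h.pl_X_eq_of_edge h3 hk (lineX X Y c r k)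
  rw [l0] at f0 a
  rw [l2] at f2 b
  have hs := (h.slope_neg h3 (c k)).ne
  have hM : lineM X Y c r = X p +
      (invSlope X Y (c 0) + invSlope X Y (c 2)) / 2 * (r - Y p) := by
    rw [lineM, ← a, ← b, f0, f2]; ring
  rw [hl, hM] at fk
  have : pl Y (c k) (lineX X Y c r k) - Y p =
      (invSlope X Y (c 0) + invSlope X Y (c 2)) / 2 * (r - Y p) / invSlope X Y (c k) := by
    rw [eq_div_iff hs]; linarith
  linear_combination this

theorem relPos_eq_zero (h3 : 3 ≤ n) (h : SteepLoop X Y) {p e : ZMod n} (he : e = p ∨ e = p - 1)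
    {t : ℝ} (ht : pl Y e t = Y p) : relPos p e t = 0 := by
  rw [pl_eq_add_relPos Y he, add_eq_left] at ht
  exact (mul_eq_zero.mp ht).resolve_right (h.dY_ne h3 e)

/-- On the line of solutions the parameter `r = Y p` is the triple point, with `0 < lineT` since `d`
lies above `p`. For `r` slightly above a minimum or below a maximum, all points are on their edges
and linked. -/
theorem eventually_of_arcCell [NeZero n] (h3 : 3 ≤ n) (h : SteepLoop X Y) {c : Fin 4 → ZMod n}
    {p : ZMod n} (hc : ArcCell X Y p c) : ∀ᶠ w in 𝓝[>] (0 : ℝ),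
      (∃ x ∈ Icc (0 : Fin 4 → ℝ) 1, cellMap (quadG X Y) c x ∈ shiftRay w ∧ psi 0 X Y c x = 0) ∧
      ∃ x ∈ Icc (0 : Fin 4 → ℝ) 1, cellMap (quadG X Y) c x ∈ shiftRay w ∧
        0 < psi 0 X Y c x := by
  obtain ⟨he, hv, hcase⟩ := hc
  have hext : LocalMin Y p ∨ LocalMax Y p := hcase.imp And.left And.left
  have hc1 : c 1 = p ∨ c 1 = p - 1 := by
    rcases hcase with h' | h'
    · rw [h'.2.2]; exact he.left
    · rw [h'.2.2]; exact he.right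
  obtain ⟨n1, n2⟩ := h.ne_of_vertexBelow hv
  have hb := h.between_of_vertexBelow hv
  obtain ⟨t₀, ht₀, hX₀, hY₀⟩ := hv
  have ht0 : t₀ ≠ 0 := by
    rintro rfl; rw [pl_zero] at hX₀; rcases hb with hb | hb <;> linarith [hb.1, hb.2]
  have ht1 : t₀ ≠ 1 := by
    rintro rfl; rw [pl_one] at hX₀; rcases hb with hb | hb <;> linarith [hb.1, hb.2]
  have hmpos : 0 < (invSlope X Y (c 0) + invSlope X Y (c 2)) / 2 / invSlope X Y (c 1) :=
    div_pos_of_neg_of_neg (by linarith [h.slope_neg h3 (c 0), h.slope_neg h3 (c 2)])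
      (h.slope_neg h3 (c 1))
  have hY1 := fun r => h.pl_Y_lineX h3 he r hc1 (h.pl_lineX_zero h3 c r).2.2.1
  have hlc : ∀ k, Continuous fun r => lineX X Y c r k := fun k =>
    (continuous_apply k).comp (continuous_lineX c)
  -- the triple point
  have hr0 : relPos p (c 0) (lineX X Y c (Y p) 0) = 0 :=
    h.relPos_eq_zero h3 he.left (h.pl_lineX_zero h3 c (Y p)).1
  have hr2 : relPos p (c 2) (lineX X Y c (Y p) 2) = 0 :=
    h.relPos_eq_zero h3 he.right (h.pl_lineX_zero h3 c (Y p)).2.1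
  have hb0 : pl Y (c 1) (lineX X Y c (Y p) 1) = Y p := by rw [hY1, sub_self, mul_zero, add_zero]
  have hr1 : relPos p (c 1) (lineX X Y c (Y p) 1) = 0 := h.relPos_eq_zero h3 hc1 hb0
  have hM0 : lineM X Y c (Y p) = X p := by
    rw [← (h.pl_lineX_zero h3 c (Y p)).2.2.1, pl_eq_add_relPos X hc1, hr1, zero_mul, add_zero]
  have hx3 : lineX X Y c (Y p) 3 = t₀ := by
    refine h.pl_X_injective h3 (c 3) ?_
    rw [(h.pl_lineX_zero h3 c (Y p)).2.2.2, hM0, hX₀]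
  have hT : 0 < lineT X Y c (Y p) := by
    rw [lineT, hb0, hx3]; linarith
  have hcond : ∀ᶠ r in 𝓝 (Y p), |relPos p (c 0) (lineX X Y c r 0)| < 1 ∧
      |relPos p (c 1) (lineX X Y c r 1)| < 1 ∧ |relPos p (c 2) (lineX X Y c r 2)| < 1 ∧
      0 < lineX X Y c r 3 ∧ lineX X Y c r 3 < 1 ∧
      pl Y (c 1) (lineX X Y c r 1) < pl Y (c 3) (lineX X Y c r 3) := by
    have habs : ∀ k, relPos p (c k) (lineX X Y c (Y p) k) = 0 →
        ∀ᶠ r in 𝓝 (Y p), |relPos p (c k) (lineX X Y c r k)| < 1 := by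
      intro k hk
      have hcont : Continuous fun r => |relPos p (c k) (lineX X Y c r k)| :=
        ((continuous_relPos p (c k)).comp (hlc k)).abs
      refine hcont.continuousAt.eventually (gt_mem_nhds ?_)
      beta_reduce
      rw [hk, abs_zero]; exact one_pos
    have hcY : ∀ k, Continuous fun r => pl Y (c k) (lineX X Y c r k) := fun k => by
      have := hlc k
      unfold pl; fun_prop
    refine (habs 0 hr0).and ((habs 1 hr1).and ((habs 2 hr2).and
      (((hlc 3).continuousAt.eventually (lt_mem_nhds ?_)).and
      (((hlc 3).continuousAt.eventually (gt_mem_nhds ?_)).and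
        ((hcY 1).continuousAt.eventually_lt (hcY 3).continuousAt ?_)))))
    · beta_reduce; rw [hx3]; exact lt_of_le_of_ne ht₀.1 ht0.symm
    · beta_reduce; rw [hx3]; exact lt_of_le_of_ne ht₀.2 ht1
    · rw [hx3, hb0]; exact hY₀
  -- The heights of `a, b, c` are on the side of `Y p` on which the edges at the extremum lie, so
  -- these points are on the edges and not on their extensions beyond `p`.
  have hmem : ∀ r, |relPos p (c 0) (lineX X Y c r 0)| < 1 ∧
      |relPos p (c 1) (lineX X Y c r 1)| < 1 ∧ |relPos p (c 2) (lineX X Y c r 2)| < 1 ∧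
      0 < lineX X Y c r 3 ∧ lineX X Y c r 3 < 1 ∧
      pl Y (c 1) (lineX X Y c r 1) < pl Y (c 3) (lineX X Y c r 3) →
      ((LocalMin Y p ∧ Y p ≤ r) ∨ (LocalMax Y p ∧ r ≤ Y p)) →
      lineX X Y c r ∈ Icc (0 : Fin 4 → ℝ) 1 := by
    rintro r ⟨a0, a1, a2, a3, a4, -⟩ hr
    have hall : ∀ k, lineX X Y c r k ∈ Icc (0 : ℝ) 1 := by
      obtain ⟨l0, l2, -, -⟩ := h.pl_lineX_zero h3 c r
      intro k
      rcases hr with ⟨hm, hr⟩ | ⟨hm, hr⟩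
      · fin_cases k
        · exact mem_Icc_of_localMin hm he.left a0.le (hr.trans l0.ge)
        · refine mem_Icc_of_localMin hm hc1 a1.le (le_trans ?_ (hY1 r).ge)
          have := mul_nonneg hmpos.le (sub_nonneg.mpr hr)
          linarith
        · exact mem_Icc_of_localMin hm he.right a2.le (hr.trans l2.ge)
        · exact ⟨a3.le, a4.le⟩
      · fin_cases k
        · exact mem_Icc_of_localMax hm he.left a0.le (l0.le.trans hr)
        · refine mem_Icc_of_localMax hm hc1 a1.le ((hY1 r).le.trans ?_)
          have := mul_nonneg hmpos.le (sub_nonneg.mpr hr)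
          linarith
        · exact mem_Icc_of_localMax hm he.right a2.le (l2.le.trans hr)
        · exact ⟨a3.le, a4.le⟩
    exact ⟨fun k => (hall k).1, fun k => (hall k).2⟩
  have hF : ∀ r, cellMap (quadG X Y) c (lineX X Y c r) = shiftTarget (lineT X Y c r) := fun r =>
    (h.cellMap_eq_iff_exists h3).mpr ⟨r, rfl, rfl⟩
  filter_upwards [nhdsWithin_le_nhds (gt_mem_nhds hT)] with w hw
  constructor
  · have hx := hmem (Y p) hcond.self_of_nhds
      (hext.imp (fun h => ⟨h, le_rfl⟩) fun h => ⟨h, le_rfl⟩)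
    refine ⟨_, hx, ⟨_, hw.le, hF (Y p)⟩, ?_⟩
    obtain ⟨κ, -, hlink, -⟩ := exists_link_eq_mul_mul h3 he.left hc1 he.right n1 n2 hx
    have hX : pl X (c 2) (lineX X Y c (Y p) 2) - pl X (c 0) (lineX X Y c (Y p) 0) = 0 := by
      rw [pl_eq_add_relPos X he.left, pl_eq_add_relPos X he.right, hr0, hr2]; ring
    have hlink0 : link c (lineX X Y c (Y p)) = 0 := by rw [hlink, hr0, hr1]; ring
    rw [psi, hlink0, hX, neg_zero, sub_zero, min_self, min_eq_left]
    rw [hb0, hx3]; linarith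
  · have hTw : ∀ᶠ r in 𝓝 (Y p), w < lineT X Y c r :=
      (continuous_lineT c).continuousAt.eventually (lt_mem_nhds hw)
    have hex : ∃ r, ((LocalMin Y p ∧ Y p < r) ∨ (LocalMax Y p ∧ r < Y p)) ∧
        (|relPos p (c 0) (lineX X Y c r 0)| < 1 ∧
          |relPos p (c 1) (lineX X Y c r 1)| < 1 ∧ |relPos p (c 2) (lineX X Y c r 2)| < 1 ∧
          0 < lineX X Y c r 3 ∧ lineX X Y c r 3 < 1 ∧
          pl Y (c 1) (lineX X Y c r 1) < pl Y (c 3) (lineX X Y c r 3)) ∧ w < lineT X Y c r := by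
      rcases hext with hm | hm
      · obtain ⟨r, h1, h2⟩ := (((hcond.and hTw).filter_mono nhdsWithin_le_nhds).and
          (self_mem_nhdsWithin (s := Ioi (Y p)))).exists
        exact ⟨r, Or.inl ⟨hm, h2⟩, h1⟩
      · obtain ⟨r, h1, h2⟩ := (((hcond.and hTw).filter_mono nhdsWithin_le_nhds).and
          (self_mem_nhdsWithin (s := Iio (Y p)))).exists
        exact ⟨r, Or.inr ⟨hm, h2⟩, h1⟩
    obtain ⟨r, hr, hcr, hwr⟩ := hex
    have hx := hmem r hcr (hr.imp (fun h => ⟨h.1, h.2.le⟩) fun h => ⟨h.1, h.2.le⟩)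
    refine ⟨_, hx, ⟨_, hwr.le, hF r⟩, ?_⟩
    obtain ⟨κ, -, hlink, hκ⟩ := exists_link_eq_mul_mul h3 he.left hc1 he.right n1 n2 hx
    obtain ⟨e0, -, e2, -⟩ := cellMap_eq_shiftTarget_iff.mp (hF r)
    obtain ⟨l0, l2, -, -⟩ := h.pl_lineX_zero h3 c r
    have hu : pl Y (c 0) (lineX X Y c r 0) ≠ Y p := by
      rw [l0]
      rcases hr with hr | hr
      · exact hr.2.ne'
      · exact hr.2.ne
    have hP := (h.relPos_between_iff h3 he hc1 ⟨hx.1 0, hx.2 0⟩ ⟨hx.1 2, hx.2 2⟩ e0 e2 hu).mpr (by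
      rcases hcase with h' | h'
      · exact Or.inl ⟨h'.2.2, h'.2.1⟩
      · exact Or.inr ⟨h'.2.2, h'.2.1⟩)
    refine psi_pos_iff.mpr ⟨?_, ?_, hcr.2.2.2.2.2⟩
    · rw [hlink, neg_zero]
      exact mul_neg_of_neg_of_pos (hκ hcr.2.2.2.1 hcr.2.2.2.2.1) hP
    · rw [h.pl_X_eq_of_edge h3 he.left, h.pl_X_eq_of_edge h3 he.right, l0, l2]
      rcases hr with ⟨hm, hr⟩ | ⟨hm, hr⟩
      · have hs : invSlope X Y (c 0) < invSlope X Y (c 2) := by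
          rcases hcase with h' | h'
          · exact h'.2.1
          · exact absurd h'.1 hm.not_localMax
        nlinarith
      · have hs : invSlope X Y (c 2) < invSlope X Y (c 0) := by
          rcases hcase with h' | h'
          · exact absurd hm h'.1.not_localMax
          · exact h'.2.1
        nlinarith

/-- Among solutions on the two edges at `p`, a positive shift forces `ac` above `p`, hence a local
minimum. The order of `b` and `d` then fixes their edges. -/
theorem cornerCell_of_psi_pos (h3 : 3 ≤ n) (h : SteepLoop X Y)
    {c : Fin 4 → ZMod n} {p : ZMod n} (hc : ∀ k, c k = p ∨ c k = p - 1) {x : Fin 4 → ℝ}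
    (hx : x ∈ Icc (0 : Fin 4 → ℝ) 1) {w : ℝ} (hw : 0 < w)
    (hF : cellMap (quadG X Y) c x = shiftTarget w) (hψ : 0 < psi 0 X Y c x) :
    CornerCell X Y p c := by
  obtain ⟨e0, e1, e2, e3⟩ := cellMap_eq_shiftTarget_iff.mp hF
  obtain ⟨-, hac, hbd⟩ := psi_pos_iff.mp hψ
  have h02 : c 0 ≠ c 2 := by
    intro e
    rw [e] at e0 hac
    rw [h.pl_Y_injective h3 _ e0] at hac
    exact lt_irrefl _ hac
  have h13 : c 1 ≠ c 3 := by
    intro e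
    rw [e] at e1 hbd
    rw [h.pl_X_injective h3 _ e1] at hbd
    exact lt_irrefl _ hbd
  have he : EdgesAt p (c 0) (c 2) := by
    rcases hc 0 with a | a <;> rcases hc 2 with b | b
    · exact absurd (a.trans b.symm) h02
    · exact Or.inl ⟨a, b⟩
    · exact Or.inr ⟨a, b⟩
    · exact absurd (a.trans b.symm) h02
  have f0 := h.pl_X_eq_of_edge h3 (hc 0) (x 0)
  have f1 := h.pl_X_eq_of_edge h3 (hc 1) (x 1)
  have f2 := h.pl_X_eq_of_edge h3 (hc 2) (x 2)
  have f3 := h.pl_X_eq_of_edge h3 (hc 3) (x 3)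
  have s0 := h.slope_neg h3 (c 0)
  have s2 := h.slope_neg h3 (c 2)
  rw [← e0] at f2
  have hmin : 0 < pl Y (c 0) (x 0) - Y p → LocalMin Y p := fun hu =>
    localMin_of_lt he ⟨hx.1 0, hx.2 0⟩ ⟨hx.1 2, hx.2 2⟩ (sub_pos.mp hu) (e0 ▸ sub_pos.mp hu)
  -- Elimination of `v₁` and `v₃` gives `w = u * (a - b) ^ 2 / (4 * a * b)`, so `u` is positive with
  -- `w`.
  have key : ∀ {a b u v₁ v₃ : ℝ}, a < 0 → b < 0 → a * v₁ = (a + b) / 2 * u →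
      b * v₃ = (a + b) / 2 * u → v₁ + v₃ = 2 * (u + w) → 0 < u := by
    intro a b u v₁ v₃ ha hb h1 h2 h3
    by_contra! hu
    have hab : 0 < a * b := mul_pos_of_neg_of_neg ha hb
    have e : 2 * (a * b) * w = u * (a - b) ^ 2 / 2 := by
      linear_combination -(a * b) * h3 + b * h1 + a * h2
    nlinarith [mul_pos hab hw, mul_nonneg (neg_nonneg.mpr hu) (sq_nonneg (a - b))]
  rcases he.eq_or (hc 1) with h1 | h1
  · have h3' : c 3 = c 2 := (he.eq_or (hc 3)).resolve_left fun e => h13 (h1.trans e.symm)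
    rw [h1] at f1 e3 e2 e1
    rw [h3'] at f3 e3 e1
    have hu := key (u := pl Y (c 0) (x 0) - Y p) (v₁ := pl Y (c 0) (x 1) - Y p)
      (v₃ := pl Y (c 2) (x 3) - Y p) s0 s2 (by linarith) (by linarith) (by linarith)
    refine ⟨he, hmin hu, ?_, h1, h3'⟩
    have : 0 < (invSlope X Y (c 2) - invSlope X Y (c 0)) * (pl Y (c 0) (x 0) - Y p) := by
      linarith
    exact sub_pos.mp (pos_of_mul_pos_left this hu.le)
  -- With `b` on the edge of `c` and `d` on the edge of `a`, the inverse slopes would put `b` above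
  -- `d`.
  · exfalso
    have h3' : c 3 = c 0 := (he.eq_or (hc 3)).resolve_right fun e => h13 (h1.trans e.symm)
    rw [h1] at f1 e3 e2 e1 hbd
    rw [h3'] at f3 e3 e1 hbd
    have hu := key (u := pl Y (c 0) (x 0) - Y p) (v₁ := pl Y (c 0) (x 3) - Y p)
      (v₃ := pl Y (c 2) (x 1) - Y p) s0 s2 (by linarith) (by linarith) (by linarith)
    have hs : 0 < (invSlope X Y (c 2) - invSlope X Y (c 0)) * (pl Y (c 0) (x 0) - Y p) := by
      linarith
    have hs' := sub_pos.mp (pos_of_mul_pos_left hs hu.le)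
    set a := invSlope X Y (c 0)
    set b := invSlope X Y (c 2)
    set v₁ := pl Y (c 2) (x 1) - Y p
    set v₃ := pl Y (c 0) (x 3) - Y p
    have g : b * v₁ = a * v₃ := by linarith
    have hv : v₁ < v₃ := sub_lt_sub_right hbd _
    have hv₁ : 0 < v₁ := by
      have : b * v₁ = (a + b) / 2 * (pl Y (c 0) (x 0) - Y p) := by linarith
      have : b * v₁ < 0 := by
        rw [this]; exact mul_neg_of_neg_of_pos (by linarith) hu
      by_contra! hle
      exact this.not_ge (mul_nonneg_of_nonpos_of_nonpos s2.le hle)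
    nlinarith [mul_pos (sub_pos.mpr hs') hv₁, mul_pos (neg_pos.mpr s0) (sub_pos.mpr hv)]

/-- Along the wedge the parameters come in the order `a, b, c, d`, up to reversal: `b` is nearer to
`p` than `a` is, and `d` is farther away than `c`. So the quadruple is linked, although it shrinks
to `p` with `w`. -/
theorem eventually_of_cornerCell [NeZero n] (h3 : 3 ≤ n) (h : SteepLoop X Y)
    {c : Fin 4 → ZMod n} {p : ZMod n} (hc : CornerCell X Y p c) : ∀ᶠ w in 𝓝[>] (0 : ℝ),
      ∃ x ∈ Icc (0 : Fin 4 → ℝ) 1, cellMap (quadG X Y) c x = shiftTarget w ∧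
        0 < psi 0 X Y c x := by
  obtain ⟨he, hm, hs, h1, h3'⟩ := hc
  have hall : ∀ k, c k = p ∨ c k = p - 1 := by
    intro k
    fin_cases k
    exacts [he.left, h1.symm ▸ he.left, he.right, h3'.symm ▸ he.right]
  set a := invSlope X Y (c 0) with ha
  set b := invSlope X Y (c 2) with hb
  have ha0 : a < 0 := h.slope_neg h3 (c 0)
  have hb0 : b < 0 := h.slope_neg h3 (c 2)
  have ha' := ha0.ne
  have hb' := hb0.ne
  have hab : (a - b) ^ 2 ≠ 0 := pow_ne_zero 2 (sub_ne_zero.mpr hs.ne)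
  -- The inverse of the rate at which `lineT` grows with the height above `p`; the shift `w` is thus
  -- attained at height `w * K`.
  set K := 4 * (a * b) / (a - b) ^ 2 with hK
  have hK0 : 0 < K := div_pos (mul_pos four_pos (mul_pos_of_neg_of_neg ha0 hb0)) (by positivity)
  have hY0 := fun r => (h.pl_lineX_zero h3 c r).1
  have hY2 := fun r => (h.pl_lineX_zero h3 c r).2.1
  have hY1 : ∀ r, pl Y (c 1) (lineX X Y c r 1) = Y p + (a + b) / 2 / a * (r - Y p) := fun r => by
    rw [h.pl_Y_lineX h3 he r (hall 1) (h.pl_lineX_zero h3 c r).2.2.1, ha, ← h1]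
  have hY3 : ∀ r, pl Y (c 3) (lineX X Y c r 3) = Y p + (a + b) / 2 / b * (r - Y p) := fun r => by
    rw [h.pl_Y_lineX h3 he r (hall 3) (h.pl_lineX_zero h3 c r).2.2.2, hb, ← h3']
  have hT : ∀ w, lineT X Y c (Y p + w * K) = w := by
    intro w
    have e1 : ((a + b) / 2 / a + (a + b) / 2 / b) / 2 - 1 = (a - b) ^ 2 / (4 * (a * b)) := by
      field_simp; ring
    have e2 : K * ((a - b) ^ 2 / (4 * (a * b))) = 1 := by
      rw [hK, div_mul_div_comm, mul_comm, div_self]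
      exact mul_ne_zero hab (mul_ne_zero four_ne_zero (mul_ne_zero ha' hb'))
    rw [lineT, hY1, hY3]
    linear_combination w * K * e1 + w * e2
  have hlc : ∀ k, Continuous fun r => lineX X Y c r k := fun k =>
    (continuous_apply k).comp (continuous_lineX c)
  have hzero : ∀ k, pl Y (c k) (lineX X Y c (Y p) k) = Y p := by
    intro k
    fin_cases k
    · exact hY0 _
    · exact (hY1 _).trans (by ring)
    · exact hY2 _
    · exact (hY3 _).trans (by ring)
  have hsmall : ∀ᶠ w in 𝓝 (0 : ℝ), ∀ k, |relPos p (c k) (lineX X Y c (Y p + w * K) k)| < 1 := by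
    rw [eventually_all]
    intro k
    have hcont : Continuous fun w => |relPos p (c k) (lineX X Y c (Y p + w * K) k)| :=
      ((continuous_relPos p (c k)).comp ((hlc k).comp (by fun_prop))).abs
    refine hcont.continuousAt.eventually (gt_mem_nhds ?_)
    beta_reduce
    rw [zero_mul, add_zero, h.relPos_eq_zero h3 (hall k) (hzero k), abs_zero]
    exact one_pos
  filter_upwards [nhdsWithin_le_nhds hsmall, self_mem_nhdsWithin] with w hw hw0
  have hu : 0 < w * K := mul_pos hw0 hK0
  set r := Y p + w * K with hr
  have hur : 0 < r - Y p := by rw [hr]; linarith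
  have hma : 0 < (a + b) / 2 / a := div_pos_of_neg_of_neg (by linarith) ha0
  have hmb : 0 < (a + b) / 2 / b := div_pos_of_neg_of_neg (by linarith) hb0
  have hYk : ∀ k, Y p ≤ pl Y (c k) (lineX X Y c r k) := by
    intro k
    fin_cases k
    · exact (hY0 r).symm ▸ by linarith
    · have := mul_pos hma hur
      exact (hY1 r).symm ▸ by linarith
    · exact (hY2 r).symm ▸ by linarith
    · have := mul_pos hmb hur
      exact (hY3 r).symm ▸ by linarith
  have hmem : ∀ k, lineX X Y c r k ∈ Icc (0 : ℝ) 1 := fun k =>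
    mem_Icc_of_localMin hm (hall k) (hw k).le (hYk k)
  have hx : lineX X Y c r ∈ Icc (0 : Fin 4 → ℝ) 1 :=
    ⟨fun k => (hmem k).1, fun k => (hmem k).2⟩
  have hF : cellMap (quadG X Y) c (lineX X Y c r) = shiftTarget w :=
    (h.cellMap_eq_iff_exists h3).mpr ⟨r, rfl, (hT w).symm⟩
  obtain ⟨e0, -, e2, -⟩ := cellMap_eq_shiftTarget_iff.mp hF
  refine ⟨_, hx, hF, psi_pos_iff.mpr ⟨?_, ?_, ?_⟩⟩
  · obtain ⟨κ, hκ, hlink⟩ := exists_link_eq_mul_relPos h3 hall hx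
    have hP := (h.relPos_between_iff h3 he (hall 1) (hmem 0) (hmem 2) e0 e2
      (by rw [hY0]; exact (sub_pos.mp hur).ne')).mpr (Or.inl ⟨h1, hs⟩)
    have hAC := he.relPos_mul_nonpos h3 (hmem 0) (hmem 2)
    have g2 := pl_eq_add_relPos Y (hall 2) (lineX X Y c r 2)
    have g3 := pl_eq_add_relPos Y (hall 3) (lineX X Y c r 3)
    rw [hY2] at g2
    rw [hY3, h3'] at g3
    rw [hlink, neg_zero]
    have hCne : relPos p (c 2) (lineX X Y c r 2) ≠ 0 := by
      intro e; rw [e] at g2; linarith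
    rw [← h3'] at g3
    set A := relPos p (c 0) (lineX X Y c r 0)
    set B := relPos p (c 1) (lineX X Y c r 1)
    set C := relPos p (c 2) (lineX X Y c r 2)
    set D := relPos p (c 3) (lineX X Y c r 3)
    have hC2 : 0 < C ^ 2 := by positivity
    have hD : D * b = (a + b) / 2 * C := by
      refine mul_right_cancel₀ (h.dY_ne h3 (c 2)) ?_
      rw [h3'] at g3
      have g3' : (a + b) / 2 / b * (r - Y p) = D * (Y (c 2 + 1) - Y (c 2)) := by linarith
      have g2' : r - Y p = C * (Y (c 2 + 1) - Y (c 2)) := by linarith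
      have : D * b * (Y (c 2 + 1) - Y (c 2)) = b * ((a + b) / 2 / b * (r - Y p)) := by
        rw [g3']; ring
      rw [this, g2']
      field_simp
    have hQ : (C - D) * (D - A) < 0 := by
      have hP2 : (C - D) * (D - A) * b ^ 2 =
          (b - (a + b) / 2) * (C ^ 2 * ((a + b) / 2) - A * C * b) := by
        have : (C - D) * (D - A) * b ^ 2 = (C * b - D * b) * (D * b - A * b) := by ring
        rw [this, hD]; ring
      have hQ' : C ^ 2 * ((a + b) / 2) - A * C * b < 0 := by
        have := mul_neg_of_pos_of_neg hC2 (show (a + b) / 2 < 0 by linarith)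
        have := mul_nonneg_of_nonpos_of_nonpos hAC hb0.le
        linarith
      have : (C - D) * (D - A) * b ^ 2 < 0 := by
        rw [hP2]; exact mul_neg_of_pos_of_neg (by linarith) hQ'
      exact neg_of_mul_neg_left this (by positivity)
    refine mul_neg_of_pos_of_neg hκ ?_
    have := mul_neg_of_pos_of_neg hP hQ
    linarith
  · rw [h.pl_X_eq_of_edge h3 he.left, h.pl_X_eq_of_edge h3 he.right, hY0, hY2]
    nlinarith
  · rw [hY1, hY3]
    have : (a + b) / 2 / a < (a + b) / 2 / b := by
      have g1 : (a + b) / 2 / a * a = (a + b) / 2 := div_mul_cancel₀ _ ha'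
      have g2 : (a + b) / 2 / b * b = (a + b) / 2 := div_mul_cancel₀ _ hb'
      by_contra! hle
      have g3 := mul_le_mul_of_nonpos_right hle ha0.le
      have g4 := mul_lt_mul_of_pos_left hs hmb
      linarith
    have := mul_lt_mul_of_pos_right this hur
    linarith

end SteepLoop

end Arcs

/-! ### The parity of a simple polygon is one -/

section Total

variable {n : ℕ} {X Y : ZMod n → ℝ}

theorem continuous_shiftTarget : Continuous shiftTarget := by
  refine continuous_pi fun k => ?_
  fin_cases k <;> simp [shiftTarget] <;> fun_prop

theorem shiftTarget_zero : shiftTarget 0 = 0 := by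
  ext k; fin_cases k <;> simp [shiftTarget]

/-- Solutions for small shifts are close to solutions for shift zero, by compactness. So a condition
on `link` only has to fail near the values at the latter. -/
theorem eventually_forall_not_solution (c : Fin 4 → ZMod n) {P : ℝ → Prop}
    (hP : ∀ x ∈ Icc (0 : Fin 4 → ℝ) 1, cellMap (quadG X Y) c x = 0 →
      ∀ᶠ v in 𝓝 (link c x), ¬ P v) :
    ∀ᶠ w in 𝓝 (0 : ℝ), ∀ x ∈ Icc (0 : Fin 4 → ℝ) 1,
      ¬ (cellMap (quadG X Y) c x = shiftTarget w ∧ P (link c x)) := by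
  refine isCompact_Icc.eventually_forall_of_forall_eventually fun x hx => ?_
  by_cases hF : cellMap (quadG X Y) c x = 0
  · have hcl : Continuous fun q : ℝ × (Fin 4 → ℝ) => link c q.2 :=
      (continuous_link c).comp continuous_snd
    have := (hcl.tendsto (0, x)).eventually (hP x hx hF)
    filter_upwards [this] with q hq h
    exact hq h.2
  · have hcF : Continuous fun q : ℝ × (Fin 4 → ℝ) =>
        cellMap (quadG X Y) c q.2 - shiftTarget q.1 := by
      refine Continuous.sub ?_ (continuous_shiftTarget.comp continuous_fst)
      exact (continuous_cellMap (L := ℝ) (G := fun _ => quadG X Y)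
        (fun _ _ _ => continuous_const) c)
    have h0 : cellMap (quadG X Y) c x - shiftTarget 0 ≠ 0 := by
      rwa [shiftTarget_zero, sub_zero]
    have := (hcF.continuousAt (x := (0, x))).eventually_ne h0
    filter_upwards [this] with q hq h
    exact hq (sub_eq_zero.mpr h.1)

namespace SteepLoop

/-- A steep polygon inscribes an odd number of linked rhombi with horizontal and vertical
diagonals. -/
theorem eventually_count_eq_one [NeZero n] (h3 : 3 ≤ n) (h : SteepLoop X Y) {δ : ℝ} (hδ : 0 < δ)
    (hlink : ∀ c, ∀ x ∈ Icc (0 : Fin 4 → ℝ) 1, cellMap (quadG X Y) c x = 0 → link c x < 0 →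
      link c x < -δ) :
    ∀ᶠ w in 𝓝[>] (0 : ℝ), RegularAt (quadG X Y) (psi δ X Y) (shiftTarget w) ∧
      count (quadG X Y) (psi δ X Y) (shiftTarget w) = 1 := by
  -- At shift zero the wedge cells have `0 ≤ link`, so for small shifts they never reach the margin:
  -- `psi δ` does not count the corner solutions.
  have ecorner : ∀ᶠ w in 𝓝 (0 : ℝ), ∀ c, (∃ p, ∀ k, c k = p ∨ c k = p - 1) →
      ∀ x ∈ Icc (0 : Fin 4 → ℝ) 1,
        ¬ (cellMap (quadG X Y) c x = shiftTarget w ∧ link c x < -δ) := by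
    rw [eventually_all]
    intro c
    by_cases hc : ∃ p, ∀ k, c k = p ∨ c k = p - 1
    · obtain ⟨p, hp⟩ := id hc
      refine (eventually_forall_not_solution c (P := fun v => v < -δ) ?_).mono fun w hw _ => hw
      intro x hx hF
      obtain ⟨-, -, h2, h3'⟩ := (cellMap_quadG_eq_iff _ _ _ _ _).mp hF
      have := h.simple.link_nonneg_of_wedge h3 hp hx h2 h3'
      filter_upwards [lt_mem_nhds (show -δ < link c x by linarith)] with v hv
      exact hv.not_gt
    · exact Eventually.of_forall fun w hc' => absurd hc' hc
  -- Away from wedges, linked solutions keep the margin, so there `psi 0` and `psi δ` count the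
  -- same.
  have eother : ∀ᶠ w in 𝓝 (0 : ℝ), ∀ c, (¬ ∃ p, ∀ k, c k = p ∨ c k = p - 1) →
      ∀ x ∈ Icc (0 : Fin 4 → ℝ) 1,
        ¬ (cellMap (quadG X Y) c x = shiftTarget w ∧ (link c x < 0 ∧ -δ ≤ link c x)) := by
    rw [eventually_all]
    intro c
    by_cases hc : ∃ p, ∀ k, c k = p ∨ c k = p - 1
    · exact Eventually.of_forall fun w hc' => absurd hc hc'
    · refine (eventually_forall_not_solution c (P := fun v => v < 0 ∧ -δ ≤ v) ?_).mono
        fun w hw _ => hw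
      intro x hx hF
      rcases lt_trichotomy (link c x) 0 with hl | hl | hl
      · filter_upwards [gt_mem_nhds (hlink c x hx hF hl)] with v hv h'
        linarith [h'.2]
      · obtain ⟨e1, e2⟩ := collapse_of_link_eq_zero hx hF hl
        exact absurd (h.simple.exists_vertex_of_collapse hx e1 e2) hc
      · filter_upwards [lt_mem_nhds hl] with v hv h'
        linarith [h'.1]
  have earc : ∀ᶠ w in 𝓝[>] (0 : ℝ), ∀ c, (∃ p, ArcCell X Y p c) →
      ((∃ x ∈ Icc (0 : Fin 4 → ℝ) 1, cellMap (quadG X Y) c x ∈ shiftRay w ∧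
          psi 0 X Y c x = 0) ∧
        ∃ x ∈ Icc (0 : Fin 4 → ℝ) 1, cellMap (quadG X Y) c x ∈ shiftRay w ∧
          0 < psi 0 X Y c x) := by
    rw [eventually_all]
    intro c
    by_cases hc : ∃ p, ArcCell X Y p c
    · obtain ⟨p, hp⟩ := hc
      exact (h.eventually_of_arcCell h3 hp).mono fun w hw _ => hw
    · exact Eventually.of_forall fun w hc' => absurd hc' hc
  have esmall : ∀ᶠ w in 𝓝[>] (0 : ℝ), ∀ c, (∃ p, CornerCell X Y p c) →
      ∃ x ∈ Icc (0 : Fin 4 → ℝ) 1, cellMap (quadG X Y) c x = shiftTarget w ∧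
        0 < psi 0 X Y c x := by
    rw [eventually_all]
    intro c
    by_cases hc : ∃ p, CornerCell X Y p c
    · obtain ⟨p, hp⟩ := hc
      exact (h.eventually_of_cornerCell h3 hp).mono fun w hw _ => hw
    · exact Eventually.of_forall fun w hc' => absurd hc' hc
  filter_upwards [h.eventually_generic h3, nhdsWithin_le_nhds ecorner, nhdsWithin_le_nhds eother,
    earc, esmall, self_mem_nhdsWithin] with w hgen hcorner hother harc hsmall hw
  have hw : 0 < w := hw
  refine ⟨fun c x hx hF _ => hgen c x hx hF, ?_⟩
  have hcell : ∀ c, ind (∃ x ∈ Icc (0 : Fin 4 → ℝ) 1, cellMap (quadG X Y) c x = shiftTarget w ∧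
        0 < psi 0 X Y c x) =
      ind (∃ x ∈ Icc (0 : Fin 4 → ℝ) 1, cellMap (quadG X Y) c x = shiftTarget w ∧
        0 < psi δ X Y c x) + ind (∃ p, CornerCell X Y p c) := by
    intro c
    by_cases hc : ∃ p, ∀ k, c k = p ∨ c k = p - 1
    · rw [ind_false (P := ∃ x ∈ Icc (0 : Fin 4 → ℝ) 1, cellMap (quadG X Y) c x = shiftTarget w ∧
        0 < psi δ X Y c x), zero_add]
      · refine ind_congr ⟨?_, fun h' => hsmall c h'⟩
        rintro ⟨x, hx, hF, hψ⟩
        obtain ⟨p, hp⟩ := hc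
        exact ⟨p, h.cornerCell_of_psi_pos h3 hp hx hw hF hψ⟩
      · rintro ⟨x, hx, hF, hψ⟩
        exact hcorner c hc x hx ⟨hF, (psi_pos_iff.mp hψ).1⟩
    · rw [ind_false (P := ∃ p, CornerCell X Y p c), add_zero]
      · refine ind_congr ⟨?_, ?_⟩
        · rintro ⟨x, hx, hF, hψ⟩
          obtain ⟨h1, h2, h4⟩ := psi_pos_iff.mp hψ
          rw [neg_zero] at h1
          refine ⟨x, hx, hF, psi_pos_iff.mpr ⟨?_, h2, h4⟩⟩
          by_contra! hle
          exact hother c hc x hx ⟨hF, h1, hle⟩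
        · rintro ⟨x, hx, hF, hψ⟩
          obtain ⟨h1, h2, h4⟩ := psi_pos_iff.mp hψ
          exact ⟨x, hx, hF, psi_pos_iff.mpr ⟨by linarith, h2, h4⟩⟩
      · rintro ⟨p, he, -, -, h1, h2⟩
        refine hc ⟨p, fun k => ?_⟩
        fin_cases k
        exacts [he.left, h1.symm ▸ he.left, he.right, h2.symm ▸ he.right]
  have htot : count (quadG X Y) (psi 0 X Y) (shiftTarget w) =
      count (quadG X Y) (psi δ X Y) (shiftTarget w) + ∑ p, ind (LocalMin Y p) := by
    rw [count, Finset.sum_congr rfl fun c _ => hcell c, Finset.sum_add_distrib,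
      h.sum_cornerCell h3]
    rfl
  -- Evaluated through the arcs, the count with `psi 0` is one more than the number of local minima.
  -- By `htot` the minima account for the small solutions, and 1 is left for `psi δ`.
  have harcs : count (quadG X Y) (psi 0 X Y) (shiftTarget w) =
      ∑ p, ind (LocalMin Y p) + 1 := by
    rw [h.count_eq_sum h3 hw fun c x hx hF => (hgen c x hx hF).1, ← h.sum_vertexBelow h3,
      ← h.sum_arcCell h3]
    refine Finset.sum_congr rfl fun c _ => ind_congr ⟨?_, fun h' => harc c h'⟩
    rintro ⟨⟨x, hx, ⟨t, ht, hF⟩, hψ⟩, x', hx', ⟨t', -, hF'⟩, hψ'⟩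
    exact h.exists_arcCell h3 hx (hw.trans_le ht) hF hψ hx' hF' hψ'
  rw [harcs, add_comm] at htot
  exact (add_right_cancel htot).symm

theorem hasParity_eq_one [NeZero n] (h3 : 3 ≤ n) (h : SteepLoop X Y) {δ : ℝ} (hδ : 0 < δ)
    (hlink : ∀ c, ∀ x ∈ Icc (0 : Fin 4 → ℝ) 1, cellMap (quadG X Y) c x = 0 → link c x < 0 →
      link c x < -δ) {d : ZMod 2} (hd : HasParity (quadG X Y) (psi δ X Y) d) : d = 1 := by
  have ht : Tendsto shiftTarget (𝓝[>] 0) (𝓝 0) := by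
    have := continuous_shiftTarget.tendsto 0
    rw [shiftTarget_zero] at this
    exact this.mono_left nhdsWithin_le_nhds
  exact hd.eq_of_frequently (ht.frequently (h.eventually_count_eq_one h3 hδ hlink).frequently)

end SteepLoop

/-- A strong horizontal shear makes `-κ * Y` dominate the first coordinate. The condition `mid` then
compares the heights of `p` and `q`, and for `p = q` it is its own hypothesis. -/
theorem SimpleLoop.eventually_steepLoop [NeZero n] {Z : ZMod n → ℝ} (h : SimpleLoop Z Y)
    (hinj : Function.Injective Y) (htop : ∀ i, i ≠ 0 → Y i < Y 0) :
    ∀ᶠ κ in atTop, SteepLoop (fun i => 1 * Z i + -κ * Y i) Y := by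
  set C := ∑ j, |Z j| with hC
  have hgap : ∀ᶠ κ : ℝ in atTop, ∀ i j, i ≠ j → 2 * C < κ * |Y i - Y j| := by
    rw [eventually_all]; intro i
    rw [eventually_all]; intro j
    by_cases hij : i = j
    · exact Eventually.of_forall fun _ h' => absurd hij h'
    · have hpos : 0 < |Y i - Y j| := abs_pos.mpr (sub_ne_zero.mpr (hinj.ne hij))
      filter_upwards [(tendsto_id.atTop_mul_const hpos).eventually_gt_atTop (2 * C)] with κ hκ _
      exact hκ
  have hZ : ∀ i, Z i ∈ Icc (-C) C := fun i => by
    simpa [pl_zero] using SteepLoop.pl_abs_le Z i (t := 0) (by simp)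
  filter_upwards [hgap] with κ hκ
  have hs := h.linear (α := 1) (β := -κ) (γ := 0) (ε := 1) (by norm_num)
  simp only [zero_mul, zero_add, one_mul] at hs
  refine ⟨by simpa only [one_mul] using hs, hinj, ?_, htop, ?_⟩
  · intro i j hij
    have := hκ j i (fun e => hij.ne (e ▸ rfl))
    rw [abs_of_pos (sub_pos.mpr hij)] at this
    linarith [(hZ i).1, (hZ j).2]
  · intro p k q t ht hY hX he
    rw [pl_linear, hY] at hX he
    by_cases hpq : p = q
    · subst hpq
      exact hX (by linarith)
    · have h1 := hκ p q hpq
      have h2 := SteepLoop.pl_abs_le Z k ht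
      rcases abs_cases (Y p - Y q) with ⟨e, -⟩ | ⟨e, -⟩ <;> rw [e] at h1 <;>
        linarith [(hZ p).1, (hZ p).2, (hZ q).1, (hZ q).2, h2.1, h2.2]

/-- Each pair of vertices excludes at most one `μ`. -/
theorem SimpleLoop.exists_injective [NeZero n] (h : SimpleLoop X Y) :
    ∃ μ : ℝ, Function.Injective fun i => μ * X i + 1 * Y i := by
  have : ∀ᶠ μ : ℝ in atTop, ∀ i j, i ≠ j → μ * X i + 1 * Y i ≠ μ * X j + 1 * Y j := by
    rw [eventually_all]; intro i
    rw [eventually_all]; intro j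
    by_cases hij : i = j
    · exact Eventually.of_forall fun _ h' => absurd hij h'
    by_cases hX : X i = X j
    · refine Eventually.of_forall fun μ _ e => ?_
      rw [hX] at e
      rcases h i j 0 (by simp) 0 (by simp) (by rw [pl_zero, pl_zero, hX])
        (by rw [pl_zero, pl_zero]; linarith) with ⟨h', -⟩ | ⟨-, h', -⟩ | ⟨-, -, h'⟩
      · exact hij h'
      · exact zero_ne_one h'
      · exact zero_ne_one h'
    · filter_upwards [eventually_ne_atTop ((Y j - Y i) / (X i - X j))] with μ hμ _ e
      refine hμ ?_
      rw [eq_div_iff (sub_ne_zero.mpr hX)]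
      linarith
  obtain ⟨μ, hμ⟩ := this.exists
  exact ⟨μ, fun i j e => by_contra fun hij => hμ i j hij e⟩

/-- A simple polygon, some shear of which has its top at the vertex `0`, inscribes an odd number of
linked rhombi with horizontal and vertical diagonals. -/
theorem SimpleLoop.exists_hasParity_eq_one [NeZero n] (h3 : 3 ≤ n) (h : SimpleLoop X Y) {μ : ℝ}
    (hinj : Function.Injective fun i => μ * X i + 1 * Y i)
    (htop : ∀ i, i ≠ 0 → μ * X i + 1 * Y i < μ * X 0 + 1 * Y 0) :
    ∃ δ₀ > 0, ∀ δ ∈ Ioc (0 : ℝ) δ₀, HasParity (quadG X Y) (psi δ X Y) 1 := by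
  have hμ : SimpleLoop X fun i => μ * X i + 1 * Y i := by
    have := h.linear (α := 1) (β := 0) (γ := μ) (ε := 1) (by norm_num)
    simpa only [one_mul, zero_mul, add_zero] using this
  obtain ⟨κ, hκ⟩ := (hμ.eventually_steepLoop hinj htop).exists
  -- The composition of the shears with parameters `l * μ` and `-l * κ`. It has determinant 1, is
  -- the identity at `l = 0` and yields the steep polygon at `l = 1`.
  have hXc : ∀ i, Continuous fun l : unitInterval =>
      (1 - (l : ℝ) * κ * (l * μ)) * X i + -(l * κ) * Y i := fun i => by fun_prop
  have hYc : ∀ i, Continuous fun l : unitInterval => ((l : ℝ) * μ) * X i + 1 * Y i :=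
    fun i => by fun_prop
  have hs : ∀ l : unitInterval, SimpleLoop
      (fun i => (1 - (l : ℝ) * κ * (l * μ)) * X i + -(l * κ) * Y i)
      (fun i => ((l : ℝ) * μ) * X i + 1 * Y i) := fun l => h.linear (by
    have : (1 - (l : ℝ) * κ * (l * μ)) * 1 - -(l * κ) * (l * μ) = 1 := by ring
    rw [this]; exact one_ne_zero)
  obtain ⟨δ₁, hδ₁, hpar⟩ := exists_hasParity_psi h3 hXc hYc hs
  obtain ⟨δ₂, hδ₂, hlink⟩ := exists_link_lt_neg h3 hXc hYc hs
  refine ⟨min δ₁ δ₂, lt_min hδ₁ hδ₂, fun δ hδ => ?_⟩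
  obtain ⟨d, hd⟩ := hpar δ ⟨hδ.1, hδ.2.trans (min_le_left _ _)⟩
  have hl := hlink δ ⟨hδ.1, hδ.2.trans (min_le_right _ _)⟩ 1
  have hd0 := hd 0
  have hd1 := hd 1
  have e : (fun i => (1 - ((1 : unitInterval) : ℝ) * κ * (((1 : unitInterval) : ℝ) * μ)) * X i +
      -(((1 : unitInterval) : ℝ) * κ) * Y i) =
      fun i => 1 * X i + -κ * (μ * X i + 1 * Y i) := by
    ext i
    simp only [Set.Icc.coe_one]
    ring
  have e' : (fun i => (((1 : unitInterval) : ℝ) * μ) * X i + 1 * Y i) =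
      fun i => μ * X i + 1 * Y i := by
    simp only [Set.Icc.coe_one, one_mul]
  rw [e, e'] at hd1 hl
  have := hκ.hasParity_eq_one h3 hδ.1 hl hd1
  subst this
  simpa only [Set.Icc.coe_zero, zero_mul, sub_zero, one_mul, neg_zero, zero_add, add_zero]
    using hd0

theorem pl_comp_add (g : ZMod n → ℝ) (O i : ZMod n) (t : ℝ) :
    pl (fun i => g (i + O)) i t = pl g (i + O) t := by
  unfold pl
  rw [add_right_comm]

/-- Every simple polygon inscribes a square. -/
theorem SimpleLoop.exists_square [NeZero n] (h3 : 3 ≤ n) (h : SimpleLoop X Y) :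
    ∃ α β : ℝ, α ^ 2 + β ^ 2 = 1 ∧ ∃ c, ∃ x ∈ Icc (0 : Fin 4 → ℝ) 1,
      cellMap (quadG (fun i => α * X i + β * Y i) (fun i => -β * X i + α * Y i)) c x = 0 ∧
      pl (fun i => α * X i + β * Y i) (c 0) (x 0) < pl (fun i => α * X i + β * Y i) (c 2) (x 2) ∧
      rho (fun i => α * X i + β * Y i) (fun i => -β * X i + α * Y i) c x = 0 := by
  by_contra hno
  obtain ⟨μ, hμ⟩ := h.exists_injective
  -- The vertices are renumbered to start at the highest one, as the field `top` requires.
  obtain ⟨O, -, hO⟩ := Finset.exists_max_image Finset.univ (fun i => μ * X i + 1 * Y i)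
    ⟨0, Finset.mem_univ _⟩
  have hs : SimpleLoop (fun i => X (i + O)) (fun i => Y (i + O)) := by
    intro i j s hs t ht hX hY
    rw [pl_comp_add, pl_comp_add] at hX hY
    rcases h _ _ s hs t ht hX hY with ⟨a, b⟩ | ⟨a, b⟩ | ⟨a, b⟩
    · exact Or.inl ⟨add_right_cancel a, b⟩
    · exact Or.inr (Or.inl ⟨by linear_combination a, b⟩)
    · exact Or.inr (Or.inr ⟨by linear_combination a, b⟩)
  obtain ⟨δ₁, hδ₁, h1⟩ := hs.exists_hasParity_eq_one h3 (μ := μ)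
    (fun i j e => add_right_cancel (hμ e)) (fun i hi => by
      refine lt_of_le_of_ne ?_ fun e => hi (add_right_cancel (hμ e))
      rw [zero_add]
      exact hO _ (Finset.mem_univ _))
  obtain ⟨δ₂, hδ₂, h2⟩ := hs.hasParity_zero h3 (by
    intro α β hαβ c x hx hF hlt hrho
    refine hno ⟨α, β, hαβ, fun k => c k + O, x, hx, ?_, ?_, ?_⟩
    · rw [cellMap_quadG_eq_iff] at hF ⊢
      rw [← pl_comp_add, ← pl_comp_add, ← pl_comp_add, ← pl_comp_add, ← pl_comp_add,
        ← pl_comp_add, ← pl_comp_add, ← pl_comp_add]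
      exact hF
    · rw [← pl_comp_add, ← pl_comp_add]
      exact hlt
    · unfold rho at hrho ⊢
      rw [← pl_comp_add, ← pl_comp_add, ← pl_comp_add, ← pl_comp_add]
      exact hrho)
  have e := (h1 (min δ₁ δ₂) ⟨lt_min hδ₁ hδ₂, min_le_left _ _⟩).unique
    (h2 (min δ₁ δ₂) ⟨lt_min hδ₁ hδ₂, min_le_right _ _⟩)
  exact one_ne_zero e

end Total

end

/-! ### Translation to polygons in the Euclidean plane -/

section Polygon

open Set

/-- The point with parameter `t` on the `i`-th edge of a polygon. -/
noncomputable def Polygon.edgePoint {n : ℕ} (X : Polygon (EuclideanSpace ℝ (Fin 2)) n) (i : Fin n)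
    (t : ℝ) : EuclideanSpace ℝ (Fin 2) :=
  AffineMap.lineMap (X i) (X (finRotate n i)) t

/-- A coordinate of the vertices of a polygon. -/
def Polygon.coord {m : ℕ} (X : Polygon (EuclideanSpace ℝ (Fin 2)) (m + 1)) (k : Fin 2) :
    ZMod (m + 1) → ℝ :=
  fun i => (X.vertices i : EuclideanSpace ℝ (Fin 2)) k

variable {m : ℕ} {X : Polygon (EuclideanSpace ℝ (Fin 2)) (m + 1)}

theorem Polygon.edgePoint_apply (i : ZMod (m + 1)) (t : ℝ) (k : Fin 2) :
    X.edgePoint i t k = pl (X.coord k) i t := by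
  have hrot : finRotate (m + 1) i = (i + 1 : ZMod (m + 1)) := finRotate_apply i
  change (AffineMap.lineMap (X.vertices i) (X.vertices (finRotate (m + 1) i)) t :
    EuclideanSpace ℝ (Fin 2)) k = _
  rw [hrot, AffineMap.lineMap_apply]
  simp only [vsub_eq_sub, vadd_eq_add, PiLp.add_apply, PiLp.smul_apply, PiLp.sub_apply,
    smul_eq_mul, pl, Polygon.coord]
  ring

theorem Polygon.edgePoint_mem (i : Fin (m + 1)) {t : ℝ} (ht : t ∈ Icc (0 : ℝ) 1) :
    X.edgePoint i t ∈ X.edgeSet ℝ i :=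
  ⟨t, ht, rfl⟩

theorem Polygon.IsSimple.simpleLoop (hX : X.IsSimple) : SimpleLoop (X.coord 0) (X.coord 1) := by
  have h3 : 3 ≤ m + 1 := hX.three_le
  have hrot : ∀ i : ZMod (m + 1), finRotate (m + 1) i = (i + 1 : ZMod (m + 1)) := fun i =>
    finRotate_apply i
  -- Edges have distinct ends, so their parametrization is injective. This turns statements on
  -- common points into statements on parameters.
  have hpar : ∀ (i : ZMod (m + 1)) (s t : ℝ), X.edgePoint i s = X.edgePoint i t → s = t := by
    intro i s t h
    by_contra hne
    have hk : ∀ k, X.coord k (i + 1) = X.coord k i := by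
      intro k
      have := congrArg (fun z : EuclideanSpace ℝ (Fin 2) => z k) h
      simp only [Polygon.edgePoint_apply, pl] at this
      have h0 : (s - t) * (X.coord k (i + 1) - X.coord k i) = 0 := by linarith
      exact sub_eq_zero.mp ((mul_eq_zero.mp h0).resolve_left (sub_ne_zero.mpr hne))
    have : X.vertices (i + 1 : ZMod (m + 1)) = X.vertices i := by
      ext k; exact hk k
    exact SteepLoop.add_one_ne_self h3 i (hX.injective this)
  have hzero : ∀ i : ZMod (m + 1), X.edgePoint i 0 = X.vertices i := fun i => by
    simp [Polygon.edgePoint]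
  have hone : ∀ i : ZMod (m + 1), X.edgePoint i 1 = X.vertices (i + 1 : ZMod (m + 1)) := fun i => by
    rw [← hrot]; simp [Polygon.edgePoint]
  have hcons : ∀ (i : ZMod (m + 1)) (s t : ℝ), s ∈ Icc (0 : ℝ) 1 → t ∈ Icc (0 : ℝ) 1 →
      X.edgePoint i s = X.edgePoint (i + 1 : ZMod (m + 1)) t → s = 1 ∧ t = 0 := by
    intro i s t hs ht h
    have hmem : X.edgePoint i s ∈ X.edgeSet ℝ i ∩ X.edgeSet ℝ (finRotate (m + 1) i) := by
      refine ⟨Polygon.edgePoint_mem i hs, ?_⟩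
      rw [hrot, h]
      exact Polygon.edgePoint_mem _ ht
    rw [hX.consecutive i, mem_singleton_iff, hrot] at hmem
    exact ⟨hpar i _ _ (hmem.trans (hone i).symm),
      hpar _ _ _ ((h.symm.trans hmem).trans (hzero _).symm)⟩
  intro i j s hs t ht h0 h1
  have h : X.edgePoint i s = X.edgePoint j t := by
    ext k
    rw [Polygon.edgePoint_apply, Polygon.edgePoint_apply]
    fin_cases k
    · exact h0
    · exact h1
  by_cases hij : i = j
  · subst hij
    exact Or.inl ⟨rfl, hpar i s t h⟩
  by_cases hji : j = i + 1
  · subst hji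
    exact Or.inr (Or.inl ⟨rfl, hcons i s t hs ht h⟩)
  by_cases hij' : i = j + 1
  · subst hij'
    obtain ⟨h1, h0⟩ := hcons j t s ht hs h.symm
    exact Or.inr (Or.inr ⟨rfl, h0, h1⟩)
  · have hd := hX.disjoint i j hij (by rw [hrot]; exact hji) (by rw [hrot]; exact hij')
    exact absurd (h ▸ Polygon.edgePoint_mem j ht)
      (disjoint_left.mp hd (Polygon.edgePoint_mem i hs))

/-- A parallelogram with orthogonal diagonals of the same length is a square. -/
theorem formSquare_of_rotated {a b c d : EuclideanSpace ℝ (Fin 2)} {α β : ℝ}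
    (hαβ : α ^ 2 + β ^ 2 = 1)
    (h0 : (-β * a 0 + α * a 1) - (-β * c 0 + α * c 1) = 0)
    (h1 : (α * b 0 + β * b 1) - (α * d 0 + β * d 1) = 0)
    (h2 : (α * a 0 + β * a 1) - (α * b 0 + β * b 1) + (α * c 0 + β * c 1) -
      (α * d 0 + β * d 1) = 0)
    (h3 : (-β * a 0 + α * a 1) - (-β * b 0 + α * b 1) + (-β * c 0 + α * c 1) -
      (-β * d 0 + α * d 1) = 0)
    (hlt : α * a 0 + β * a 1 < α * c 0 + β * c 1)
    (heq : (α * c 0 + β * c 1) - (α * a 0 + β * a 1) -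
      ((-β * d 0 + α * d 1) - (-β * b 0 + α * b 1)) = 0) : FormSquare a b c d := by
  have e0 : b 0 - a 0 = c 0 - d 0 := by
    linear_combination (c 0 - d 0 + a 0 - b 0) * hαβ - α * h2 + β * h3
  have e1 : b 1 - a 1 = c 1 - d 1 := by
    linear_combination (c 1 - d 1 + a 1 - b 1) * hαβ - β * h2 - α * h3
  set p := b 0 - a 0 with hp
  set q := b 1 - a 1 with hq
  set r := d 0 - a 0 with hr
  set s := d 1 - a 1 with hs
  -- In the rotated frame the sides `ab` and `ad` become `(u, -u)` and `(u, u)`: the diagonal `bd`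
  -- is vertical, `ac` is horizontal, and both have the same length.
  have f1 : α * p + β * q = α * r + β * s := by simp only [hp, hq, hr, hs]; linarith
  have f2 : -β * p + α * q = -(-β * r + α * s) := by simp only [hp, hq, hr, hs]; linarith
  have f3 : α * p + β * q = -β * r + α * s := by simp only [hp, hq, hr, hs]; linarith
  have hin : p * r + q * s = 0 := by
    have : (p * r + q * s) * (α ^ 2 + β ^ 2) =
        (α * p + β * q) * (α * r + β * s) + (-β * p + α * q) * (-β * r + α * s) := by ring
    rw [hαβ, mul_one, ← f1, f2, ← f3] at this
    rw [this]; ring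
  have hnorm : p ^ 2 + q ^ 2 = r ^ 2 + s ^ 2 := by
    have t1 : (p ^ 2 + q ^ 2) * (α ^ 2 + β ^ 2) = (α * p + β * q) ^ 2 + (-β * p + α * q) ^ 2 := by
      ring
    have t2 : (r ^ 2 + s ^ 2) * (α ^ 2 + β ^ 2) = (α * r + β * s) ^ 2 + (-β * r + α * s) ^ 2 := by
      ring
    rw [hαβ, mul_one] at t1 t2
    rw [t1, t2, f2, f1]; ring
  refine ⟨?_, ?_, ?_, ?_⟩
  · intro hab
    have p0 : p = 0 := by rw [hp, hab, sub_self]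
    have q0 : q = 0 := by rw [hq, hab, sub_self]
    rw [p0, q0] at f1
    simp only [hr, hs] at f1
    rw [← hab] at h2
    linarith
  · ext k
    fin_cases k
    · exact e0
    · exact e1
  · rw [PiLp.inner_apply, Fin.sum_univ_two]
    simp only [PiLp.sub_apply, RCLike.inner_apply, conj_trivial]
    linarith
  · rw [EuclideanSpace.dist_eq, EuclideanSpace.dist_eq]
    congr 1
    simp only [Fin.sum_univ_two, Real.dist_eq, sq_abs]
    linear_combination hnorm

theorem Polygon.IsSimple.exists_formSquare (hX : X.IsSimple) :
    ∃ a ∈ X.boundary ℝ, ∃ b ∈ X.boundary ℝ, ∃ c ∈ X.boundary ℝ, ∃ d ∈ X.boundary ℝ,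
      FormSquare a b c d := by
  obtain ⟨α, β, hαβ, c, x, hx, hF, hlt, hrho⟩ := hX.simpleLoop.exists_square hX.three_le
  obtain ⟨h0, h1, h2, h3⟩ := (cellMap_quadG_eq_iff _ _ _ _ _).mp hF
  have hmem : ∀ k, X.edgePoint (c k) (x k) ∈ X.boundary ℝ := fun k =>
    mem_iUnion.mpr ⟨c k, Polygon.edgePoint_mem _ ⟨hx.1 k, hx.2 k⟩⟩
  unfold rho at hrho
  simp only [pl_linear, ← Polygon.edgePoint_apply, Pi.zero_apply] at h0 h1 h2 h3 hlt hrho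
  exact ⟨_, hmem 0, _, hmem 1, _, hmem 2, _, hmem 3,
    formSquare_of_rotated hαβ h0 h1 h2 h3 hlt hrho⟩

end Polygon

theorem mainTheorem1 (n : ℕ) (X : Polygon (EuclideanSpace ℝ (Fin 2)) n) (hX : X.IsSimple) :
    ∃ a ∈ X.boundary ℝ, ∃ b ∈ X.boundary ℝ, ∃ c ∈ X.boundary ℝ, ∃ d ∈ X.boundary ℝ,
      FormSquare a b c d := by
  cases n with
  | zero => exact absurd hX.three_le (by norm_num)
  | succ m => exact hX.exists_formSquare
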